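/- **Setting.** Let $V:\mathbb R\to\mathbb R$ be a $C^2$ non-negative potential that is well behaved at infinity of exponential order $N$: $V(\phi)>0$ for all large $\phi$ and $W_V(\phi):=V'(\phi)/V(\phi)-N\to 0$ as $\phi\to\infty$. Suppose $V$ is of class 2: there are $\phi_0>0$ with $V>0$ on $[\phi_0,\infty)$ and a strictly decreasing $C^3$ map $z=f(\phi)$ of $[\phi_0,\infty)$ onto $(0,\epsilon]$, $\epsilon=f(\phi_0)$, with $f\to0$ at $\infty$, such that the functions $\overline{W}_V(z)=W_V(f^{-1}(z))$ and $\overline{f'}(z)=f'(f^{-1}(z))$, extended to $z=0$ by their limits, are $C^2$ on $[0,\epsilon]$ with vanishing first derivative at $z=0$. Fix any such $f$, $\phi_0$, and assume $N^2<6$. A *cosmology* is a solution $(\phi,\dot\phi,K)$, on an open interval of proper time $t$, of $\ddot\phi=-K\dot\phi-V'(\phi)$, $\dot K=-\tfrac32\dot\phi^2$, $K^2=3V(\phi)+\tfrac32\dot\phi^2$, $K>0$. With $y=\sqrt{3/2}\,\dot\phi/K$, $z=f(\phi)$, $d\tau=K\,dt$, the part of phase space with $\phi>\phi_0$ becomes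 $\Omega=\{-1<y<1,\ 0<z<\epsilon\}$ with $$\frac{dy}{d\tau}=-\Big(y+\tfrac1{\sqrt6}\big(\overline{W}_V(z)+N\big)\Big)(1-y^2),\qquad \frac{dz}{d\tau}=\sqrt{\tfrac23}\,\overline{f'}(z)\,y ,$$ a system which extends to $\tilde\Omega=\{-1\le y\le1,\ 0\le z<\epsilon\}$ and has the equilibrium $p_N=(-N/\sqrt6,0)$. A solution is *past-asymptotic* to $p_N$ if it is defined on some $(-\infty,T]$ and tends to $p_N$ as $\tau\to-\infty$. A cosmology *originates at $p_N$* if $\phi\to\infty$ and $y\to-N/\sqrt6$ as $t$ decreases to the left end of its interval. A *local center manifold* of $p_N$ is a curve $y=h(z)$, $0\le z<\delta$, in $\tilde\Omega$ with $h\in C^1$, $h(0)=-N/\sqrt6$, $h'(0)=0$, which is locally invariant: a solution in $\tilde\Omega$ that meets it stays in it, in both time directions, as long as $z<\delta$. **Theorem.** 1. $p_N$ has a local center manifold, and every solution in $\tilde\Omega$ past-asymptotic to $p_N$ lies, for all sufficiently negative $\tau$, in each local center manifold of $p_N$. 2. There is a single orbit $C_N$ of the system in $\Omega$ such that every solution in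 $\tilde\Omega$ past-asymptotic to $p_N$ lies in $C_N\cup\{p_N\}$, and every cosmology originating at $p_N$ satisfies $(y,z)\in C_N$ for all sufficiently early times. If $V'(\phi)\ne0$ for all sufficiently large $\phi$ (which is automatic if $N\neq0$), then $C_N$ can be chosen so that, in addition, $C_N\cup\{p_N\}$ coincides in a neighbourhood of $p_N$ with a local center manifold of $p_N$. 3. If $V'$ has arbitrarily large zeros, then no solution in $\Omega$ is past-asymptotic to $p_N$. 4. At most one cosmology originates at $p_N$: for any two such cosmologies there is a translation of time after which their time intervals coincide towards the past and $\phi$, $\dot\phi$ and $K$ agree at all common times. -/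

import Mathlib

open Filter Topology

noncomputable section

namespace ScalarCosmology

/-! ### Potentials that are well behaved at infinity -/

/-- `W_V(φ) = V'(φ) / V(φ) - N`. -/
def W (V : ℝ → ℝ) (N : ℝ) (φ : ℝ) : ℝ := deriv V φ / V φ - N

/-- `V` is a `C²` non-negative potential which is well behaved at infinity, of exponential
order `N`. -/
def IsWBI (V : ℝ → ℝ) (N : ℝ) : Prop :=
  ContDiff ℝ 2 V ∧ (∀ φ, 0 ≤ V φ) ∧
    (∃ φ₁ : ℝ, 0 < φ₁ ∧ ∀ φ, φ₁ < φ → 0 < V φ) ∧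
    Tendsto (W V N) atTop (𝓝 0)

/-- The function `z ↦ g (f⁻¹ z)` for `z > 0`, extended to `z = 0` by the limit of `g` at `∞`.
Here `f⁻¹` is the inverse of `f` on `[φ₀, ∞)`. If the extended function is continuous at `0`
from the right then the limit exists, so no junk value is involved there. -/
def bar (f : ℝ → ℝ) (φ₀ : ℝ) (g : ℝ → ℝ) (z : ℝ) : ℝ :=
  if 0 < z then g (Function.invFunOn f (Set.Ici φ₀) z) else limUnder atTop g

/-- `W_V` as a function of `z = f φ`. -/
def Wbar (V : ℝ → ℝ) (N : ℝ) (f : ℝ → ℝ) (φ₀ : ℝ) : ℝ → ℝ := bar f φ₀ (W V N)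

/-- `f'` as a function of `z = f φ`. -/
def fbar (f : ℝ → ℝ) (φ₀ : ℝ) : ℝ → ℝ := bar f φ₀ (derivWithin f (Set.Ici φ₀))

/-- `z = f φ`, `φ ≥ φ₀`, is a coordinate which takes `∞` to `0` and in which `V` is of
class `k` at infinity. -/
structure IsAdmissibleCoordinate (k : ℕ) (V : ℝ → ℝ) (N : ℝ) (f : ℝ → ℝ) (φ₀ : ℝ) : Prop where
  pos : 0 < φ₀
  V_pos : ∀ φ, φ₀ ≤ φ → 0 < V φ
  onto : f '' Set.Ici φ₀ = Set.Ioc 0 (f φ₀)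
  tendsto : Tendsto f atTop (𝓝 0)
  contDiffOn : ContDiffOn ℝ (k + 1) f (Set.Ici φ₀)
  strictAntiOn : StrictAntiOn f (Set.Ici φ₀)
  contDiffOn_Wbar : ContDiffOn ℝ k (Wbar V N f φ₀) (Set.Icc 0 (f φ₀))
  contDiffOn_fbar : ContDiffOn ℝ k (fbar f φ₀) (Set.Icc 0 (f φ₀))
  deriv_Wbar : derivWithin (Wbar V N f φ₀) (Set.Icc 0 (f φ₀)) 0 = 0
  deriv_fbar : derivWithin (fbar f φ₀) (Set.Icc 0 (f φ₀)) 0 = 0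

/-- `V` is class `k` well behaved at infinity, of exponential order `N`. -/
def IsClassWBI (k : ℕ) (V : ℝ → ℝ) (N : ℝ) : Prop :=
  IsWBI V N ∧ ContDiff ℝ k V ∧ ∃ (f : ℝ → ℝ) (φ₀ : ℝ), IsAdmissibleCoordinate k V N f φ₀

/-! ### The two-dimensional system near `φ = ∞`, in the coordinates `(y, z)` -/

/-- The vector field of the system
`dy/dτ = -(y + (W̄(z) + N)/√6) (1 - y²)`, `dz/dτ = √(2/3) f̄'(z) y`. -/
def field (V : ℝ → ℝ) (N : ℝ) (f : ℝ → ℝ) (φ₀ : ℝ) (p : ℝ × ℝ) : ℝ × ℝ :=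
  (-(p.1 + 1 / √6 * (Wbar V N f φ₀ p.2 + N)) * (1 - p.1 ^ 2),
    √(2 / 3) * fbar f φ₀ p.2 * p.1)

/-- The physical phase space `-1 < y < 1`, `0 < z < f φ₀`. -/
def phaseSpace (f : ℝ → ℝ) (φ₀ : ℝ) : Set (ℝ × ℝ) :=
  Set.Ioo (-1) 1 ×ˢ Set.Ioo 0 (f φ₀)

/-- The phase space with its three unphysical boundary pieces `y = 1`, `y = -1`, `z = 0`. -/
def extPhaseSpace (f : ℝ → ℝ) (φ₀ : ℝ) : Set (ℝ × ℝ) :=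
  Set.Icc (-1) 1 ×ˢ Set.Ico 0 (f φ₀)

/-- `γ`, restricted to `I`, is a solution of `γ' = X γ` with values in `D`. -/
def IsSolutionOn (X : ℝ × ℝ → ℝ × ℝ) (D : Set (ℝ × ℝ)) (I : Set ℝ) (γ : ℝ → ℝ × ℝ) : Prop :=
  ∀ τ ∈ I, γ τ ∈ D ∧ HasDerivWithinAt γ (X (γ τ)) I τ

/-- `C` is an orbit of `X` in `D`: all points that are joined to some point of `D`, forwards or
backwards in time, by a solution in `D`. -/
def IsOrbit (X : ℝ × ℝ → ℝ × ℝ) (D : Set (ℝ × ℝ)) (C : Set (ℝ × ℝ)) : Prop :=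
  ∃ p ∈ D, C = {q | ∃ (γ : ℝ → ℝ × ℝ) (s t : ℝ),
    IsSolutionOn X D (Set.uIcc s t) γ ∧ γ s = p ∧ γ t = q}

/-- The equilibrium `p_N = (-N/√6, 0)`. -/
def pN (N : ℝ) : ℝ × ℝ := (-N / √6, 0)

/-- `γ` is a solution on `(-∞, T]` with values in `D` which converges to `p_N` in the past. -/
def IsPastAsymptotic (V : ℝ → ℝ) (N : ℝ) (f : ℝ → ℝ) (φ₀ : ℝ) (D : Set (ℝ × ℝ)) (T : ℝ)
    (γ : ℝ → ℝ × ℝ) : Prop :=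
  IsSolutionOn (field V N f φ₀) D (Set.Iic T) γ ∧ Tendsto γ atBot (𝓝 (pN N))

/-- `M` is a local center manifold of `p_N` in the extended phase space (whose boundary contains
`p_N`): a `C¹` curve `y = h z`, `0 ≤ z < δ`, which starts at `p_N`, is tangent there to the
`z`-axis (the zero-eigenspace of the linearisation), and is locally invariant: a solution which
meets `M` stays in `M`, in both time directions, as long as `z < δ`. -/
def IsLocalCenterManifold (V : ℝ → ℝ) (N : ℝ) (f : ℝ → ℝ) (φ₀ : ℝ) (M : Set (ℝ × ℝ)) : Prop :=
  ∃ (δ : ℝ) (h : ℝ → ℝ), 0 < δ ∧ ContDiffOn ℝ 1 h (Set.Ico 0 δ) ∧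
    h 0 = -N / √6 ∧ derivWithin h (Set.Ico 0 δ) 0 = 0 ∧
    M = {p | p.2 ∈ Set.Ico 0 δ ∧ p.1 = h p.2} ∧ M ⊆ extPhaseSpace f φ₀ ∧
    ∀ (γ : ℝ → ℝ × ℝ) (s t : ℝ),
      IsSolutionOn (field V N f φ₀) (extPhaseSpace f φ₀) (Set.uIcc s t) γ →
      γ s ∈ M → (∀ τ ∈ Set.uIcc s t, (γ τ).2 < δ) → γ t ∈ M

/-- `C`, completed by the point `p_N`, is locally (in a neighbourhood of `p_N`) a center manifold
of `p_N`. -/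
def IsLocallyCenterManifold (V : ℝ → ℝ) (N : ℝ) (f : ℝ → ℝ) (φ₀ : ℝ) (C : Set (ℝ × ℝ)) : Prop :=
  ∃ M, IsLocalCenterManifold V N f φ₀ M ∧ ∃ U ∈ 𝓝 (pN N), insert (pN N) C ∩ U = M ∩ U

/-! ### Cosmologies -/

/-- An expanding spatially flat FRW scalar field cosmology on the interval `I` of proper time:
scalar field `φ`, its time derivative `ψ`, and expansion `K > 0`. -/
structure IsCosmology (V : ℝ → ℝ) (I : Set ℝ) (φ ψ K : ℝ → ℝ) : Prop where
  isOpen : IsOpen I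
  ordConnected : I.OrdConnected
  nonempty : I.Nonempty
  deriv_φ : ∀ t ∈ I, HasDerivAt φ (ψ t) t
  deriv_ψ : ∀ t ∈ I, HasDerivAt ψ (-K t * ψ t - deriv V (φ t)) t
  deriv_K : ∀ t ∈ I, HasDerivAt K (-(3 / 2) * ψ t ^ 2) t
  constraint : ∀ t ∈ I, K t ^ 2 = 3 * V (φ t) + 3 / 2 * ψ t ^ 2
  K_pos : ∀ t ∈ I, 0 < K t

/-- The coordinate `y = √(3/2) ψ / K`. -/
def yCoord (ψ K : ℝ → ℝ) (t : ℝ) : ℝ := √(3 / 2) * ψ t / K t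

/-- The cosmology originates at `p_N`: as `t` decreases to the left end of `I` (finite or
infinite), `φ → ∞` (that is, `z → 0`) and `y → -N/√6`. -/
def OriginatesAtPN (N : ℝ) (I : Set ℝ) (φ ψ K : ℝ → ℝ) : Prop :=
  Tendsto (fun t : I => φ t) atBot atTop ∧
    Tendsto (fun t : I => yCoord ψ K t) atBot (𝓝 (-N / √6))

/-- Up to a translation of time by `c` the two cosmologies start together and agree at all common
times. -/
def SameCosmology (I₁ : Set ℝ) (φ₁ ψ₁ K₁ : ℝ → ℝ) (I₂ : Set ℝ) (φ₂ ψ₂ K₂ : ℝ → ℝ) : Prop :=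
  ∃ c : ℝ, (∃ s ∈ I₁, ∀ t ≤ s, t ∈ I₁ ↔ t + c ∈ I₂) ∧
    ∀ t ∈ I₁, t + c ∈ I₂ → φ₁ t = φ₂ (t + c) ∧ ψ₁ t = ψ₂ (t + c) ∧ K₁ t = K₂ (t + c)

end ScalarCosmology

end

open ScalarCosmology

/-! The linearisation at p_N is diagonal, with eigenvalue -(1 - N²/6) < 0 in the y-direction and 0
in the z-direction. Hence backwards in time solutions are repelled from every invariant curve y =
h(z) through p_N. Precisely, u = y - h(z) satisfies u' = -ρu with ρ close to 1 - N²/6 > 0, so u² is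
non-increasing in τ near p_N; if the solution tends to p_N as τ → -∞, then u² → 0 there, which
forces u = 0 (`InvGraph.eventually_mem`). Everything therefore rests on having one such curve.

The curve is found by solving its invariance equation (`PlanarData.exists_invGraph`). Division by 1
- h² turns it into h + √(2/3) g q(h) h' = η with q(y) = y/(1 - y²) and η = -(w + N)/√6, where w and
g stand for W̄ and f̄'. Both w and g are C² and vanish to first order at z = 0, so after z = δx the
coefficients are small in C^{1,1}. An explicit transport scheme preserves a fixed C^{1,1} ball and
contracts in the sup norm, giving approximate solutions; a maximum principle shows that they
converge, and interpolation makes their derivatives converge too.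

For the single orbit, suppose that V' has no large zeros. Then h ≠ 0 for small z > 0, the graph
contains no equilibria there, and since z is strictly monotone along it the graph is part of one
orbit (`InvGraph.joined`). That orbit could still come back close to p_N away from the graph; the
monotonicity of K² in time excludes this (`InvGraph.locally_eq`). If V' has arbitrarily large zeros,
then N = 0 and these zeros are equilibria on the graph accumulating at p_N. A past-asymptotic
solution in Ω would have to sweep out the graph by continuity and so run through an equilibrium,
which is impossible (`no_pastAsymptotic`).

A cosmology originating at p_N becomes, in the time τ = ∫ K dt, a past-asymptotic solution, because
τ → -∞ towards its beginning (`IsCosmology.exists_pastAsymptotic`). Two such solutions cover a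
common piece of the graph, and a point (y, z) determines φ, ψ and K through z = f(φ) and K² (1 - y²)
= 3V. Uniqueness for the original equations then identifies the two cosmologies. -/

namespace ScalarCosmology

/-! ### Calculus of C^{1,1} functions with explicit constants -/

/-- `h'` is a derivative of `h` on `S`, with quadratic remainder: `h` is `C^{1,1}` on `S`. -/
structure IsJet (S : Set ℝ) (K M : ℝ) (h h' : ℝ → ℝ) : Prop where
  lip : ∀ z ∈ S, ∀ w ∈ S, |h w - h z| ≤ K * |w - z|
  bound : ∀ z ∈ S, |h' z| ≤ K
  taylor : ∀ z ∈ S, ∀ w ∈ S, |h w - h z - h' z * (w - z)| ≤ M * (w - z) ^ 2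

namespace IsJet

variable {S S' : Set ℝ} {K M K₁ M₁ A B : ℝ} {h h' k k' : ℝ → ℝ}

theorem mono_const (H : IsJet S K M h h') (hK : K ≤ K₁) (hM : M ≤ M₁) : IsJet S K₁ M₁ h h' where
  lip z hz w hw := (H.lip z hz w hw).trans (by gcongr)
  bound z hz := (H.bound z hz).trans hK
  taylor z hz w hw := (H.taylor z hz w hw).trans (by gcongr)

theorem comp (H : IsJet S' K M h h') (Hk : IsJet S K₁ M₁ k k') (hk : Set.MapsTo k S S')
    (hK : 0 ≤ K) (hM : 0 ≤ M) :
    IsJet S (K * K₁) (M * K₁ ^ 2 + K * M₁) (fun z => h (k z)) (fun z => h' (k z) * k' z) where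
  lip z hz w hw := (H.lip _ (hk hz) _ (hk hw)).trans <| by
    rw [mul_assoc]; exact mul_le_mul_of_nonneg_left (Hk.lip z hz w hw) hK
  bound z hz := by
    rw [abs_mul]; exact mul_le_mul (H.bound _ (hk hz)) (Hk.bound z hz) (abs_nonneg _) hK
  taylor z hz w hw := by
    have h1 := H.taylor _ (hk hz) _ (hk hw)
    have h2 := Hk.taylor z hz w hw
    have h3 : (k w - k z) ^ 2 ≤ K₁ ^ 2 * (w - z) ^ 2 := by
      rw [← sq_abs (k w - k z), ← sq_abs (w - z), ← mul_pow]
      exact pow_le_pow_left₀ (abs_nonneg _) (Hk.lip z hz w hw) 2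
    calc |h (k w) - h (k z) - h' (k z) * k' z * (w - z)|
        = |(h (k w) - h (k z) - h' (k z) * (k w - k z))
            + h' (k z) * (k w - k z - k' z * (w - z))| := by congr 1; ring
      _ ≤ M * (k w - k z) ^ 2 + K * (M₁ * (w - z) ^ 2) := by
          refine (abs_add_le _ _).trans (add_le_add h1 ?_)
          rw [abs_mul]
          exact mul_le_mul (H.bound _ (hk hz)) h2 (abs_nonneg _) hK
      _ ≤ M * (K₁ ^ 2 * (w - z) ^ 2) + K * (M₁ * (w - z) ^ 2) := by gcongr
      _ = _ := by ring

theorem mul (H : IsJet S K M h h') (Hk : IsJet S K₁ M₁ k k') (hA : ∀ z ∈ S, |h z| ≤ A)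
    (hB : ∀ z ∈ S, |k z| ≤ B) (hK : 0 ≤ K) (hA' : 0 ≤ A) (hM : 0 ≤ M) :
    IsJet S (K * B + A * K₁) (M * B + A * M₁ + K * K₁) (fun z => h z * k z)
      (fun z => h' z * k z + h z * k' z) where
  lip z hz w hw := by
    calc |h w * k w - h z * k z| = |(h w - h z) * k w + h z * (k w - k z)| := by congr 1; ring
      _ ≤ K * |w - z| * B + A * (K₁ * |w - z|) := by
          refine (abs_add_le _ _).trans (add_le_add ?_ ?_)
          · rw [abs_mul]
            exact mul_le_mul (H.lip z hz w hw) (hB w hw) (abs_nonneg _) (by positivity)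
          · rw [abs_mul]
            exact mul_le_mul (hA z hz) (Hk.lip z hz w hw) (abs_nonneg _) hA'
      _ = _ := by ring
  bound z hz := by
    refine (abs_add_le _ _).trans (add_le_add ?_ ?_)
    · rw [abs_mul]; exact mul_le_mul (H.bound z hz) (hB z hz) (abs_nonneg _) hK
    · rw [abs_mul]; exact mul_le_mul (hA z hz) (Hk.bound z hz) (abs_nonneg _) hA'
  taylor z hz w hw := by
    calc |h w * k w - h z * k z - (h' z * k z + h z * k' z) * (w - z)|
        = |(h w - h z - h' z * (w - z)) * k w + h z * (k w - k z - k' z * (w - z))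
            + h' z * ((w - z) * (k w - k z))| := by congr 1; ring
      _ ≤ M * (w - z) ^ 2 * B + A * (M₁ * (w - z) ^ 2) + K * (|w - z| * (K₁ * |w - z|)) := by
          refine (abs_add_le _ _).trans (add_le_add ((abs_add_le _ _).trans (add_le_add ?_ ?_)) ?_)
          · rw [abs_mul]
            exact mul_le_mul (H.taylor z hz w hw) (hB w hw) (abs_nonneg _) (by positivity)
          · rw [abs_mul]
            exact mul_le_mul (hA z hz) (Hk.taylor z hz w hw) (abs_nonneg _) hA'
          · rw [abs_mul, abs_mul]
            refine mul_le_mul (H.bound z hz) ?_ (by positivity) hK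
            exact mul_le_mul_of_nonneg_left (Hk.lip z hz w hw) (abs_nonneg _)
      _ = M * (w - z) ^ 2 * B + A * (M₁ * (w - z) ^ 2) + K * (K₁ * |w - z| ^ 2) := by ring
      _ = _ := by rw [sq_abs]; ring

/-- The jet of `a h + b k`. -/
theorem lincomb (H : IsJet S K M h h') (Hk : IsJet S K₁ M₁ k k') {a b : ℝ} :
    IsJet S (|a| * K + |b| * K₁) (|a| * M + |b| * M₁) (fun z => a * h z + b * k z)
      (fun z => a * h' z + b * k' z) where
  lip z hz w hw := by
    calc |a * h w + b * k w - (a * h z + b * k z)| = |a * (h w - h z) + b * (k w - k z)| := by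
          congr 1; ring
      _ ≤ |a| * (K * |w - z|) + |b| * (K₁ * |w - z|) := by
          refine (abs_add_le _ _).trans (add_le_add ?_ ?_)
          · rw [abs_mul]; exact mul_le_mul_of_nonneg_left (H.lip z hz w hw) (abs_nonneg _)
          · rw [abs_mul]; exact mul_le_mul_of_nonneg_left (Hk.lip z hz w hw) (abs_nonneg _)
      _ = _ := by ring
  bound z hz := by
    refine (abs_add_le _ _).trans (add_le_add ?_ ?_)
    · rw [abs_mul]; exact mul_le_mul_of_nonneg_left (H.bound z hz) (abs_nonneg _)
    · rw [abs_mul]; exact mul_le_mul_of_nonneg_left (Hk.bound z hz) (abs_nonneg _)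
  taylor z hz w hw := by
    calc |a * h w + b * k w - (a * h z + b * k z) - (a * h' z + b * k' z) * (w - z)|
        = |a * (h w - h z - h' z * (w - z)) + b * (k w - k z - k' z * (w - z))| := by
          congr 1; ring
      _ ≤ |a| * (M * (w - z) ^ 2) + |b| * (M₁ * (w - z) ^ 2) := by
          refine (abs_add_le _ _).trans (add_le_add ?_ ?_)
          · rw [abs_mul]; exact mul_le_mul_of_nonneg_left (H.taylor z hz w hw) (abs_nonneg _)
          · rw [abs_mul]; exact mul_le_mul_of_nonneg_left (Hk.taylor z hz w hw) (abs_nonneg _)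
      _ = _ := by ring

theorem id (S : Set ℝ) : IsJet S 1 0 (fun z => z) (fun _ => 1) where
  lip z _ w _ := by simp
  bound z _ := by simp
  taylor z _ w _ := by simp

theorem hasDerivWithinAt (H : IsJet S K M h h') {z : ℝ} (hz : z ∈ S) :
    HasDerivWithinAt h (h' z) S z := by
  rw [hasDerivWithinAt_iff_isLittleO]
  have h1 : (fun w : ℝ => (w - z) ^ 2) =o[𝓝[S] z] fun w => w - z := by
    have : (fun w : ℝ => (w - z) * (w - z)) =o[𝓝[S] z] fun w => 1 * (w - z) := by
      refine Asymptotics.IsLittleO.mul_isBigO ?_ (Asymptotics.isBigO_refl _ _)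
      rw [Asymptotics.isLittleO_one_iff]
      have : Tendsto (fun w : ℝ => w - z) (𝓝 z) (𝓝 (z - z)) :=
        (continuous_id.sub continuous_const).tendsto z
      rw [sub_self] at this
      exact this.mono_left nhdsWithin_le_nhds
    simpa [sq] using this
  refine Asymptotics.IsBigO.trans_isLittleO ?_ h1
  refine Asymptotics.IsBigO.of_bound M ?_
  filter_upwards [self_mem_nhdsWithin] with w hw
  have := H.taylor z hz w hw
  rw [Real.norm_eq_abs, Real.norm_eq_abs, abs_of_nonneg (sq_nonneg (w - z)), smul_eq_mul,
    mul_comm (w - z)]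
  exact this

/-- Adding the Taylor estimates based at z and at w cancels the values of h and leaves (h' w - h'
z)(w - z). -/
theorem abs_deriv_sub_le (H : IsJet S K M h h') {z w : ℝ} (hz : z ∈ S) (hw : w ∈ S) :
    |h' w - h' z| ≤ 2 * M * |w - z| := by
  rcases eq_or_ne w z with rfl | hne
  · simp
  have hp : 0 < |w - z| := abs_pos.2 (sub_ne_zero.2 hne)
  refine le_of_mul_le_mul_right ?_ hp
  rw [← abs_mul, mul_assoc, ← sq, sq_abs]
  calc |(h' w - h' z) * (w - z)|
      = |(h w - h z - h' z * (w - z)) + (h z - h w - h' w * (z - w))| := by congr 1; ring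
    _ ≤ M * (w - z) ^ 2 + M * (z - w) ^ 2 :=
        (abs_add_le _ _).trans (add_le_add (H.taylor z hz w hw) (H.taylor w hw z hz))
    _ = _ := by ring

/-- Interpolation: close jets have close derivatives. -/
theorem abs_deriv_sub_mul_le (H : IsJet S K M h h') (Hk : IsJet S K M k k') {E z w : ℝ}
    (hz : z ∈ S) (hw : w ∈ S) (hE : ∀ z ∈ S, |h z - k z| ≤ E) :
    |h' z - k' z| * |w - z| ≤ 2 * E + 2 * M * (w - z) ^ 2 := by
  rw [← abs_mul]
  calc |(h' z - k' z) * (w - z)|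
      = |((h w - k w) - (h z - k z)) + ((k w - k z - k' z * (w - z))
          - (h w - h z - h' z * (w - z)))| := by congr 1; ring
    _ ≤ (E + E) + (M * (w - z) ^ 2 + M * (w - z) ^ 2) := by
        refine (abs_add_le _ _).trans (add_le_add ?_ ?_)
        · exact (abs_sub _ _).trans (add_le_add (hE w hw) (hE z hz))
        · exact (abs_sub _ _).trans (add_le_add (Hk.taylor z hz w hw) (H.taylor z hz w hw))
    _ = _ := by ring

/-- A `C²` function on a compact interval is a jet. -/
theorem exists_of_contDiffOn {a b : ℝ} (hab : a < b) (hh : ContDiffOn ℝ 2 h (Set.Icc a b)) :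
    ∃ K M, 0 ≤ K ∧ 0 ≤ M ∧ IsJet (Set.Icc a b) K M h (derivWithin h (Set.Icc a b)) := by
  have hu := uniqueDiffOn_Icc hab
  have h1 : ContDiffOn ℝ 1 (derivWithin h (Set.Icc a b)) (Set.Icc a b) :=
    hh.derivWithin hu (by norm_num)
  obtain ⟨K, hK⟩ := hh.exists_lipschitzOnWith (by norm_num) (convex_Icc a b) isCompact_Icc
  obtain ⟨M, hM⟩ := h1.exists_lipschitzOnWith (by norm_num) (convex_Icc a b) isCompact_Icc
  obtain ⟨C, hC⟩ := isCompact_Icc.exists_bound_of_continuousOn h1.continuousOn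
  have hd : ∀ z ∈ Set.Icc a b,
      HasDerivWithinAt h (derivWithin h (Set.Icc a b) z) (Set.Icc a b) z := fun z hz =>
    (hh.differentiableOn (by norm_num) z hz).hasDerivWithinAt
  refine ⟨max K C, M, (K.2.trans (le_max_left _ _)), M.2, ⟨?_, ?_, ?_⟩⟩
  · intro z hz w hw
    have := hK.dist_le_mul w hw z hz
    rw [Real.dist_eq, Real.dist_eq] at this
    exact this.trans (by gcongr; exact le_max_left _ _)
  · intro z hz
    exact (hC z hz).trans (le_max_right _ _)
  · intro z hz w hw
    have hsub : Set.uIcc z w ⊆ Set.Icc a b := Set.uIcc_subset_Icc hz hw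
    -- Mean value inequality for h minus its tangent at z, whose derivative is at most M |w - z|
    -- between z and w.
    have key := (convex_uIcc z w).norm_image_sub_le_of_norm_hasDerivWithin_le
      (f := fun x => h x - derivWithin h (Set.Icc a b) z * x)
      (f' := fun x => derivWithin h (Set.Icc a b) x - derivWithin h (Set.Icc a b) z * 1)
      (C := M * |w - z|) (x := z) (y := w)
      (fun x hx => ((hd x (hsub hx)).mono hsub).sub
        ((hasDerivWithinAt_id x _).const_mul _))
      (fun x hx => by
        have h2 := hM.dist_le_mul x (hsub hx) z hz
        rw [Real.dist_eq, Real.dist_eq] at h2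
        rw [mul_one, Real.norm_eq_abs]
        refine h2.trans (mul_le_mul_of_nonneg_left ?_ M.2)
        exact Set.abs_sub_left_of_mem_uIcc hx)
      Set.left_mem_uIcc Set.right_mem_uIcc
    rw [Real.norm_eq_abs, Real.norm_eq_abs] at key
    calc |h w - h z - derivWithin h (Set.Icc a b) z * (w - z)|
        = |h w - derivWithin h (Set.Icc a b) z * w
            - (h z - derivWithin h (Set.Icc a b) z * z)| := by congr 1; ring
      _ ≤ M * |w - z| * |w - z| := key
      _ = M * (w - z) ^ 2 := by rw [mul_assoc, ← sq, sq_abs]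

end IsJet

/-! ### The invariance equation with small coefficients -/

/-- Small data `G`, `η` on `[0, 2]` for the equation `h + G q(h) h' = η`. -/
structure GraphData (s Q a b : ℝ) (G G' η η' q q' : ℝ → ℝ) : Prop where
  s_nonneg : 0 ≤ s
  one_le_Q : 1 ≤ Q
  small : 32 * (s * Q) ≤ 1
  jetG : IsJet (Set.Icc 0 2) s s G G'
  absG : ∀ z ∈ Set.Icc (0 : ℝ) 2, |G z| ≤ s
  G_zero : G 0 = 0
  G_two : G 2 = 0
  jetη : IsJet (Set.Icc 0 2) s s η η'
  η_mem : ∀ z ∈ Set.Icc (0 : ℝ) 2, η z ∈ Set.Icc a b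
  jetq : IsJet (Set.Icc a b) Q Q q q'
  absq : ∀ y ∈ Set.Icc a b, |q y| ≤ Q

/-- The class of functions in which the invariant graph is constructed. -/
structure IsCandidate (a b : ℝ) (h h' : ℝ → ℝ) : Prop where
  jet : IsJet (Set.Icc 0 2) 1 1 h h'
  mem : ∀ z ∈ Set.Icc (0 : ℝ) 2, h z ∈ Set.Icc a b

namespace GraphData

variable {s Q a b τ e : ℝ} {G G' η η' q q' h h' k k' : ℝ → ℝ}

/-- The drift along the graph of `h`. -/
def drift (G q h : ℝ → ℝ) (z : ℝ) : ℝ := G z * q (h z)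

/-- The derivative of the drift. -/
def drift' (G G' q q' h h' : ℝ → ℝ) (z : ℝ) : ℝ := G' z * q (h z) + G z * (q' (h z) * h' z)

/-- One implicit time step of length `τ` for `∂ₜ h = η - h - G q(h) h'`. -/
def step (G η q : ℝ → ℝ) (τ : ℝ) (h : ℝ → ℝ) (z : ℝ) : ℝ :=
  (1 - τ) * h (z - τ * drift G q h z) + τ * η z

/-- The derivative of a time step. -/
def step' (G G' η' q q' : ℝ → ℝ) (τ : ℝ) (h h' : ℝ → ℝ) (z : ℝ) : ℝ :=
  (1 - τ) * (h' (z - τ * drift G q h z) * (1 - τ * drift' G G' q q' h h' z)) + τ * η' z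

section

variable (D : GraphData s Q a b G G' η η' q q')
include D

theorem s_mul_le : s * Q ≤ 1 / 32 := by linarith [D.small]

theorem s_le : s ≤ 1 / 32 :=
  (le_mul_of_one_le_right D.s_nonneg D.one_le_Q).trans D.s_mul_le

theorem sQ_nonneg : 0 ≤ s * Q := mul_nonneg D.s_nonneg (by linarith [D.one_le_Q])

/-- The product rule for jets gives 2sQ for the Lipschitz constant and sQ + 2sQ + sQ for the
remainder; 4sQ serves for both. -/
theorem jet_drift (H : IsCandidate a b h h') :
    IsJet (Set.Icc 0 2) (4 * (s * Q)) (4 * (s * Q)) (drift G q h) (drift' G G' q q' h h') := by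
  have hQ : 0 ≤ Q := by linarith [D.one_le_Q]
  have h1 := D.jetq.comp H.jet (fun z hz => H.mem z hz) hQ hQ
  have h2 := D.jetG.mul h1 D.absG (fun z hz => D.absq _ (H.mem z hz)) D.s_nonneg D.s_nonneg
    D.s_nonneg
  have := D.sQ_nonneg
  exact h2.mono_const (by linarith) (by linarith)

theorem abs_drift_le (H : IsCandidate a b h h') {z : ℝ} (hz : z ∈ Set.Icc (0 : ℝ) 2) :
    |drift G q h z| ≤ s * Q := by
  rw [drift, abs_mul]
  exact mul_le_mul (D.absG z hz) (D.absq _ (H.mem z hz)) (abs_nonneg _) D.s_nonneg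

/-- The drift vanishes at both ends and has Lipschitz constant below 1, so it is bounded by the
distance to either end. Characteristics thus never leave [0, 2], and no boundary condition is
needed. -/
theorem mapsTo_foot (H : IsCandidate a b h h') (h0 : 0 ≤ τ) (h1 : τ ≤ 1) :
    Set.MapsTo (fun z => z - τ * drift G q h z) (Set.Icc 0 2) (Set.Icc 0 2) := by
  intro z hz
  have J := D.jet_drift H
  have hs := D.s_mul_le
  have hs0 := D.sQ_nonneg
  have e0 : drift G q h 0 = 0 := by simp [drift, D.G_zero]
  have e2 : drift G q h 2 = 0 := by simp [drift, D.G_two]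
  have b0 := J.lip 0 (by simp) z hz
  have b2 := J.lip 2 (by simp) z hz
  rw [e0, sub_zero, sub_zero, abs_of_nonneg hz.1] at b0
  rw [e2, sub_zero, abs_sub_comm, abs_of_nonneg (by linarith [hz.2] : 0 ≤ 2 - z)] at b2
  have c0 : |drift G q h z| ≤ z := b0.trans (by nlinarith [hz.1])
  have c2 : |drift G q h z| ≤ 2 - z := b2.trans (by nlinarith [hz.2])
  have d : |τ * drift G q h z| ≤ |drift G q h z| := by
    rw [abs_mul, abs_of_nonneg h0]
    exact mul_le_of_le_one_left (abs_nonneg _) h1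
  have := abs_le.1 (d.trans c0)
  have := abs_le.1 (d.trans c2)
  constructor <;> simp only <;> linarith

/-- Transport worsens the constants 1, 1 by a factor 1 + O(τsQ), whereas the damping factor 1 - τ
gains a full τ; the smallness of sQ makes the gain win. -/
theorem step_candidate (H : IsCandidate a b h h') (h0 : 0 ≤ τ) (h1 : τ ≤ 1) :
    IsCandidate a b (step G η q τ h) (step' G G' η' q q' τ h h') where
  mem z hz := by
    have := convex_Icc a b (H.mem _ (D.mapsTo_foot H h0 h1 hz)) (D.η_mem z hz)
      (sub_nonneg.2 h1) h0 (by ring)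
    simpa [step] using this
  jet := by
    have hs := D.s_mul_le
    have hs0 := D.sQ_nonneg
    have hs' := D.s_le
    have hs'' := D.s_nonneg
    have J1 := (IsJet.id (Set.Icc 0 2)).lincomb (D.jet_drift H) (a := 1) (b := -τ)
    have J2 : IsJet (Set.Icc 0 2) (1 + τ * (4 * (s * Q))) (τ * (4 * (s * Q)))
        (fun z => z - τ * drift G q h z) (fun z => 1 - τ * drift' G G' q q' h h' z) := by
      convert J1 using 1
      · rw [abs_neg, abs_of_nonneg h0]; simp
      · rw [abs_neg, abs_of_nonneg h0]; simp
      · funext z; ring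
      · funext z; ring
    have J3 := H.jet.comp J2 (D.mapsTo_foot H h0 h1) zero_le_one zero_le_one
    have J4 := J3.lincomb D.jetη (a := 1 - τ) (b := τ)
    -- With β = 4sQ ≤ 1/8 it remains to bound (1 - τ)(1 + τβ) + τs and (1 - τ)((1 + τβ)² + τβ) + τs
    -- by 1.
    rw [abs_of_nonneg h0, abs_of_nonneg (sub_nonneg.2 h1)] at J4
    have hb : 4 * (s * Q) ≤ 1 / 8 := by linarith
    have hb0 : 0 ≤ 4 * (s * Q) := by linarith
    set β := 4 * (s * Q)
    have hτβ : τ * β ≤ τ * (1 / 8) := mul_le_mul_of_nonneg_left hb h0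
    have hτβ0 : 0 ≤ τ * β := mul_nonneg h0 hb0
    have hτs : τ * s ≤ τ * (1 / 32) := mul_le_mul_of_nonneg_left hs' h0
    have h1' : 0 ≤ 1 - τ := sub_nonneg.2 h1
    refine J4.mono_const ?_ ?_
    · have : (1 - τ) * (1 * (1 + τ * β)) ≤ (1 - τ) * (1 + τ * (1 / 8)) := by
        rw [one_mul]; gcongr
      nlinarith
    · have e1 : (τ * β) ^ 2 ≤ τ * β := by nlinarith
      have : (1 - τ) * (1 * (1 + τ * β) ^ 2 + 1 * (τ * β)) ≤ (1 - τ) * (1 + τ * (1 / 2)) := by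
        apply mul_le_mul_of_nonneg_left _ h1'
        nlinarith
      nlinarith

/-- Changing h to k changes the value at the foot by at most e, and moves the foot by at most τsQe,
which costs no more than that since k is 1-Lipschitz. The factor 1 - τ outweighs the second effect.
-/
theorem step_contract (H : IsCandidate a b h h') (Hk : IsCandidate a b k k') (h0 : 0 ≤ τ)
    (h1 : τ ≤ 1) (he0 : 0 ≤ e) (he : ∀ z ∈ Set.Icc (0 : ℝ) 2, |h z - k z| ≤ e) {z : ℝ}
    (hz : z ∈ Set.Icc (0 : ℝ) 2) :
    |step G η q τ h z - step G η q τ k z| ≤ (1 - τ / 2) * e := by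
  have hQ : 0 ≤ Q := by linarith [D.one_le_Q]
  have hs := D.s_mul_le
  have h1' : 0 ≤ 1 - τ := sub_nonneg.2 h1
  have m1 := D.mapsTo_foot H h0 h1 hz
  have m2 := D.mapsTo_foot Hk h0 h1 hz
  have a1 := he _ m1
  have a2 := Hk.jet.lip _ m2 _ m1
  have a3 : |drift G q h z - drift G q k z| ≤ s * (Q * e) := by
    rw [drift, drift, ← mul_sub, abs_mul]
    refine mul_le_mul (D.absG z hz) ?_ (abs_nonneg _) D.s_nonneg
    exact (D.jetq.lip _ (Hk.mem z hz) _ (H.mem z hz)).trans (by gcongr; exact he z hz)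
  have a4 : |(z - τ * drift G q h z) - (z - τ * drift G q k z)| ≤ τ * (s * (Q * e)) := by
    rw [show (z - τ * drift G q h z) - (z - τ * drift G q k z)
      = -(τ * (drift G q h z - drift G q k z)) by ring, abs_neg, abs_mul, abs_of_nonneg h0]
    gcongr
  have a5 : τ * (s * (Q * e)) ≤ τ * e * (1 / 32) := by
    rw [show τ * (s * (Q * e)) = τ * e * (s * Q) by ring]; gcongr
  calc |step G η q τ h z - step G η q τ k z|
      = |(1 - τ) * ((h (z - τ * drift G q h z) - k (z - τ * drift G q h z))
          + (k (z - τ * drift G q h z) - k (z - τ * drift G q k z)))| := by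
        rw [step, step]; congr 1; ring
    _ ≤ (1 - τ) * (e + τ * e * (1 / 32)) := by
        rw [abs_mul, abs_of_nonneg h1']
        refine mul_le_mul_of_nonneg_left ((abs_add_le _ _).trans ?_) h1'
        linarith
    _ ≤ (1 - τ / 2) * e := by nlinarith [mul_nonneg h0 he0, mul_nonneg h0 (mul_nonneg h0 he0)]

/-- A near fixed point of a time step nearly solves the invariance equation. -/
theorem residual_le (H : IsCandidate a b h h') (h0 : 0 < τ) (h1 : τ ≤ 1) {z : ℝ}
    (hz : z ∈ Set.Icc (0 : ℝ) 2) :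
    |h z + drift G q h z * h' z - η z| ≤ |step G η q τ h z - h z| / τ + τ := by
  have hs := D.s_mul_le
  have h1' : 0 ≤ 1 - τ := sub_nonneg.2 h1
  have m1 := D.mapsTo_foot H h0.le h1 hz
  have t := H.jet.taylor z hz _ m1
  have hb := D.abs_drift_le H hz
  have hh := H.jet.bound z hz
  set B := drift G q h z
  have hb' : |B| ≤ 1 / 32 := hb.trans hs
  set R := h (z - τ * B) - h z - h' z * ((z - τ * B) - z) with hR
  -- Expanding h at the foot of the characteristic to first order leaves the increment of the step,
  -- a term of order τ² from (1 - τ)τ = τ - τ², and the Taylor remainder, also of order τ².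
  have e1 : h z + B * h' z - η z
      = (-(step G η q τ h z - h z) + (τ ^ 2 * (B * h' z) + (1 - τ) * R)) / τ := by
    rw [eq_div_iff h0.ne', step, hR]; ring
  have b1 : |B * h' z| ≤ 1 / 32 := by
    rw [abs_mul]
    calc |B| * |h' z| ≤ 1 / 32 * 1 := mul_le_mul hb' hh (abs_nonneg _) (by norm_num)
      _ = _ := by norm_num
  have b2 : |(1 - τ) * R| ≤ τ ^ 2 * (1 / 32) := by
    rw [abs_mul, abs_of_nonneg h1']
    have : B ^ 2 ≤ 1 / 32 := by rw [← sq_abs]; nlinarith [abs_nonneg B]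
    calc (1 - τ) * |R| ≤ 1 * (1 * (z - τ * B - z) ^ 2) :=
          mul_le_mul (by linarith) t (abs_nonneg _) zero_le_one
      _ = τ ^ 2 * B ^ 2 := by ring
      _ ≤ _ := by gcongr
  rw [e1, abs_div, abs_of_pos h0, div_add' _ _ _ h0.ne']
  gcongr
  refine (abs_add_le _ _).trans ?_
  rw [abs_neg]
  refine add_le_add le_rfl ((abs_add_le _ _).trans ?_)
  rw [abs_mul, abs_of_nonneg (sq_nonneg τ)]
  nlinarith [sq_nonneg τ]

/-- For fixed τ the iterates of the contraction eventually move by less than τe/2, and `residual_le`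
applies. An exact fixed point is not needed. -/
theorem exists_approx (hab : a ≤ b) (he : 0 < e) :
    ∃ h h', IsCandidate a b h h' ∧
      ∀ z ∈ Set.Icc (0 : ℝ) 2, |h z + drift G q h z * h' z - η z| ≤ e := by
  -- Half of e pays for the discretisation error τ, the other half for the increment divided by τ.
  set τ := min (e / 2) 1
  have h0 : 0 < τ := lt_min (by linarith) one_pos
  have h1 : τ ≤ 1 := min_le_right _ _
  have h2 : τ ≤ e / 2 := min_le_left _ _
  let F : ℕ → (ℝ → ℝ) × (ℝ → ℝ) := fun n =>
    (fun p : (ℝ → ℝ) × (ℝ → ℝ) => (step G η q τ p.1, step' G G' η' q q' τ p.1 p.2))^[n]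
      (fun _ => a, fun _ => 0)
  have hF : ∀ n, F (n + 1) = (step G η q τ (F n).1, step' G G' η' q q' τ (F n).1 (F n).2) :=
    fun n => Function.iterate_succ_apply' _ _ _
  have hc : ∀ n, IsCandidate a b (F n).1 (F n).2 := by
    intro n
    induction n with
    | zero => exact ⟨⟨by simp [F], by simp [F], fun z _ w _ => by simp [F, sq_nonneg]⟩,
        by simp [F, hab]⟩
    | succ n ih => rw [hF]; exact D.step_candidate ih h0.le h1
  have hr0 : 0 ≤ 1 - τ / 2 := by linarith
  have hd : ∀ n, ∀ z ∈ Set.Icc (0 : ℝ) 2,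
      |(F (n + 1)).1 z - (F n).1 z| ≤ (1 - τ / 2) ^ n * (b - a) := by
    intro n
    induction n with
    | zero =>
      intro z hz
      rw [pow_zero, one_mul, zero_add, abs_le]
      constructor <;> linarith [((hc 1).mem z hz).1, ((hc 1).mem z hz).2, ((hc 0).mem z hz).1,
        ((hc 0).mem z hz).2]
    | succ n ih =>
      intro z hz
      have := D.step_contract (hc (n + 1)) (hc n) h0.le h1
        (mul_nonneg (pow_nonneg hr0 n) (sub_nonneg.2 hab)) ih hz
      have e1 : (F (n + 1 + 1)).1 = step G η q τ (F (n + 1)).1 := congrArg Prod.fst (hF (n + 1))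
      have e2 : (F (n + 1)).1 = step G η q τ (F n).1 := congrArg Prod.fst (hF n)
      rw [e1, congrFun e2 z]
      refine this.trans (le_of_eq ?_)
      ring
  have ht : Tendsto (fun n : ℕ => (1 - τ / 2) ^ n * (b - a)) atTop (𝓝 (0 * (b - a))) :=
    (tendsto_pow_atTop_nhds_zero_of_lt_one hr0 (by linarith)).mul_const _
  rw [zero_mul] at ht
  obtain ⟨n, hn⟩ := (ht.eventually (gt_mem_nhds (show 0 < τ * (e / 2) by positivity))).exists
  refine ⟨_, _, hc n, fun z hz => ?_⟩
  refine (D.residual_le (hc n) h0 h1 hz).trans ?_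
  have := hd n z hz
  rw [hF] at this
  have h3 : |step G η q τ (F n).1 z - (F n).1 z| / τ ≤ e / 2 := by
    rw [div_le_iff₀ h0]; linarith
  linarith

/-- Maximum principle: at a maximum of h - k either G = 0 or the derivatives agree, so the drift
terms differ only through q(h) - q(k), a small multiple of h - k. The zeroth-order term then
controls the maximum by the residuals. -/
theorem sub_le_of_residual (H : IsCandidate a b h h') (Hk : IsCandidate a b k k')
    (hr : ∀ z ∈ Set.Icc (0 : ℝ) 2, |h z + drift G q h z * h' z - η z| ≤ e)
    (kr : ∀ z ∈ Set.Icc (0 : ℝ) 2, |k z + drift G q k z * k' z - η z| ≤ e) {z : ℝ}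
    (hz : z ∈ Set.Icc (0 : ℝ) 2) : h z - k z ≤ 4 * e := by
  have he0 : 0 ≤ e := (abs_nonneg _).trans (hr z hz)
  have hder : ∀ z ∈ Set.Icc (0 : ℝ) 2,
      HasDerivWithinAt (fun z => h z - k z) (h' z - k' z) (Set.Icc 0 2) z := fun z hz =>
    (H.jet.hasDerivWithinAt hz).sub (Hk.jet.hasDerivWithinAt hz)
  obtain ⟨x, hx, hmax⟩ := isCompact_Icc.exists_isMaxOn ⟨z, hz⟩
    (fun z hz => (hder z hz).continuousWithinAt : ContinuousOn (fun z => h z - k z) (Set.Icc 0 2))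
  refine (hmax hz).trans ?_
  simp only
  have r1 := abs_le.1 (hr x hx)
  have r2 := abs_le.1 (kr x hx)
  have key : |drift G q h x * h' x - drift G q k x * k' x| ≤ 1 / 32 * |h x - k x| := by
    by_cases hG : G x = 0
    · simp [drift, hG]
    · have hx0 : 0 < x := lt_of_le_of_ne hx.1 (by rintro rfl; exact hG D.G_zero)
      have hx2 : x < 2 := lt_of_le_of_ne hx.2 (by rintro rfl; exact hG D.G_two)
      have hn : Set.Icc (0 : ℝ) 2 ∈ 𝓝 x := Icc_mem_nhds hx0 hx2
      have hd0 := (hmax.isLocalMax hn).hasDerivAt_eq_zero ((hder x hx).hasDerivAt hn)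
      have : k' x = h' x := by linarith
      rw [this, ← sub_mul, drift, drift, ← mul_sub, abs_mul, abs_mul]
      have l := D.jetq.lip _ (Hk.mem x hx) _ (H.mem x hx)
      calc |G x| * |q (h x) - q (k x)| * |h' x| ≤ s * (Q * |h x - k x|) * 1 := by
            have := D.s_nonneg
            have := D.one_le_Q
            refine mul_le_mul (mul_le_mul (D.absG x hx) l (abs_nonneg _) D.s_nonneg)
              (H.jet.bound x hx) (abs_nonneg _) (by positivity)
        _ = s * Q * |h x - k x| := by ring
        _ ≤ _ := by gcongr; exact D.s_mul_le
  -- For a positive maximum this gives (31/32)(h - k) ≤ 2e.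
  have k1 := abs_le.1 key
  rcases le_total 0 (h x - k x) with hp | hp
  · rw [abs_of_nonneg hp] at k1
    linarith
  · linarith

/-- The equation `h + G q(h) h' = η` has a `C^{1,1}` solution on `[0, 2]`. -/
theorem exists_solution (hab : a ≤ b) : ∃ h h', IsCandidate a b h h' ∧
    ∀ z ∈ Set.Icc (0 : ℝ) 2, h z + G z * q (h z) * h' z = η z := by
  have hpos : ∀ n : ℕ, (0 : ℝ) < 1 / ((n : ℝ) + 1) := fun n => by positivity
  choose h h' hc hr using fun n : ℕ => D.exists_approx hab (hpos n)
  have hmono : ∀ {n N : ℕ}, N ≤ n → 1 / ((n : ℝ) + 1) ≤ 1 / ((N : ℝ) + 1) := fun hn => by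
    have : ((_ : ℕ) : ℝ) ≤ _ := Nat.cast_le.2 hn
    gcongr
  have hclose : ∀ n m N : ℕ, N ≤ n → N ≤ m → ∀ z ∈ Set.Icc (0 : ℝ) 2,
      |h n z - h m z| ≤ 4 * (1 / ((N : ℝ) + 1)) := by
    intro n m N hn hm z hz
    have a1 := fun z hz => (hr n z hz).trans (hmono hn)
    have a2 := fun z hz => (hr m z hz).trans (hmono hm)
    rw [abs_le]
    constructor
    · linarith [D.sub_le_of_residual (hc m) (hc n) a2 a1 hz]
    · exact D.sub_le_of_residual (hc n) (hc m) a1 a2 hz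
  have hclose' : ∀ n m N : ℕ, N ≤ n → N ≤ m → ∀ z ∈ Set.Icc (0 : ℝ) 2,
      |h' n z - h' m z| ≤ 10 * √(1 / ((N : ℝ) + 1)) := by
    intro n m N hn hm z hz
    set e : ℝ := 1 / ((N : ℝ) + 1) with he
    have e0 : 0 < e := hpos N
    have e1 : e ≤ 1 := by rw [he, div_le_one (by positivity)]; simp
    have t0 : 0 < √e := Real.sqrt_pos.2 e0
    have t1 : √e ≤ 1 := Real.sqrt_le_one.2 e1
    have t2 : √e ^ 2 = e := Real.sq_sqrt e0.le
    -- The distance √e balances the two terms of the interpolation inequality: (2·4e + 2e)/√e =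
    -- 10√e. One of z ± √e lies in [0, 2].
    obtain ⟨w, hw, hwz⟩ : ∃ w ∈ Set.Icc (0 : ℝ) 2, |w - z| = √e := by
      rcases le_total z 1 with h1 | h1
      · exact ⟨z + √e, ⟨by linarith [hz.1], by linarith⟩, by simp [abs_of_pos t0]⟩
      · exact ⟨z - √e, ⟨by linarith, by linarith [hz.2]⟩, by simp [abs_of_pos t0]⟩
    have := (hc n).jet.abs_deriv_sub_mul_le (hc m).jet hz hw (hclose n m N hn hm)
    rw [← sq_abs (w - z), hwz] at this
    refine le_of_mul_le_mul_right (this.trans (le_of_eq ?_)) t0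
    rw [mul_assoc 10, ← sq, t2, ← he]; ring
  have lim0 : Tendsto (fun N : ℕ => 1 / ((N : ℝ) + 1)) atTop (𝓝 0) :=
    tendsto_one_div_add_atTop_nhds_zero_nat
  have lim1 : Tendsto (fun N : ℕ => 4 * (1 / ((N : ℝ) + 1))) atTop (𝓝 0) := by
    simpa using lim0.const_mul 4
  have lim2 : Tendsto (fun N : ℕ => 10 * √(1 / ((N : ℝ) + 1))) atTop (𝓝 0) := by
    have := ((Real.continuous_sqrt.tendsto 0).comp lim0).const_mul 10
    simpa using this
  have hex : ∀ z, ∃ l, z ∈ Set.Icc (0 : ℝ) 2 → Tendsto (fun n => h n z) atTop (𝓝 l) := by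
    intro z
    by_cases hz : z ∈ Set.Icc (0 : ℝ) 2
    · obtain ⟨l, hl⟩ := cauchySeq_tendsto_of_complete
        (cauchySeq_of_le_tendsto_0 (s := fun n => h n z) _ (fun n m N hn hm => hclose n m N hn hm z hz) lim1)
      exact ⟨l, fun _ => hl⟩
    · exact ⟨0, fun h => absurd h hz⟩
  have hex' : ∀ z, ∃ l, z ∈ Set.Icc (0 : ℝ) 2 → Tendsto (fun n => h' n z) atTop (𝓝 l) := by
    intro z
    by_cases hz : z ∈ Set.Icc (0 : ℝ) 2
    · obtain ⟨l, hl⟩ := cauchySeq_tendsto_of_complete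
        (cauchySeq_of_le_tendsto_0 (s := fun n => h' n z) _ (fun n m N hn hm => hclose' n m N hn hm z hz) lim2)
      exact ⟨l, fun _ => hl⟩
    · exact ⟨0, fun h => absurd h hz⟩
  choose g hg using hex
  choose g' hg' using hex'
  have hmem : ∀ z ∈ Set.Icc (0 : ℝ) 2, g z ∈ Set.Icc a b := fun z hz =>
    isClosed_Icc.mem_of_tendsto (hg z hz) (Eventually.of_forall fun n => (hc n).mem z hz)
  refine ⟨g, g', ⟨⟨?_, ?_, ?_⟩, hmem⟩, ?_⟩
  · intro z hz w hw
    exact le_of_tendsto ((hg w hw).sub (hg z hz)).abs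
      (Eventually.of_forall fun n => (hc n).jet.lip z hz w hw)
  · intro z hz
    exact le_of_tendsto (hg' z hz).abs (Eventually.of_forall fun n => (hc n).jet.bound z hz)
  · intro z hz w hw
    exact le_of_tendsto (((hg w hw).sub (hg z hz)).sub ((hg' z hz).mul_const _)).abs
      (Eventually.of_forall fun n => (hc n).jet.taylor z hz w hw)
  · intro z hz
    have hq : Tendsto (fun n => q (h n z)) atTop (𝓝 (q (g z))) := by
      rw [tendsto_iff_dist_tendsto_zero]
      have : Tendsto (fun n => Q * |h n z - g z|) atTop (𝓝 0) := by
        have := ((hg z hz).sub_const (g z)).abs.const_mul Q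
        simpa using this
      exact squeeze_zero (fun _ => dist_nonneg)
        (fun n => D.jetq.lip _ (hmem z hz) _ ((hc n).mem z hz)) this
    have h1 : Tendsto (fun n => |h n z + drift G q (h n) z * h' n z - η z|) atTop
        (𝓝 |g z + G z * q (g z) * g' z - η z|) :=
      (((hg z hz).add ((hq.const_mul (G z)).mul (hg' z hz))).sub_const _).abs
    have h2 := squeeze_zero (fun _ => abs_nonneg _) (fun n => hr n z hz) lim0
    exact sub_eq_zero.1 (abs_eq_zero.1 (tendsto_nhds_unique h1 h2))

end

end GraphData

/-! ### Localisation at the critical point z = 0 -/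

theorem IsJet.continuousOn_deriv {S : Set ℝ} {K M : ℝ} {h h' : ℝ → ℝ} (H : IsJet S K M h h') :
    ContinuousOn h' S := by
  intro z hz
  rw [ContinuousWithinAt, tendsto_iff_dist_tendsto_zero]
  have : Tendsto (fun w : ℝ => 2 * M * |w - z|) (𝓝[S] z) (𝓝 (2 * M * |z - z|)) :=
    Tendsto.mono_left ((by fun_prop : Continuous fun w : ℝ => 2 * M * |w - z|).tendsto z)
      nhdsWithin_le_nhds
  rw [sub_self, abs_zero, mul_zero] at this
  refine squeeze_zero' (Eventually.of_forall fun _ => dist_nonneg) ?_ this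
  filter_upwards [self_mem_nhdsWithin] with w hw using H.abs_deriv_sub_le hz hw

/-- Near a critical point the Lipschitz constant of a jet is small. -/
theorem IsJet.near_zero {K M ε δ : ℝ} {h h' : ℝ → ℝ} (H : IsJet (Set.Icc 0 ε) K M h h')
    (h0 : h' 0 = 0) (hM : 0 ≤ M) (hδ : 0 ≤ δ) (hδε : 2 * δ ≤ ε) :
    IsJet (Set.Icc 0 (2 * δ)) (6 * M * δ) M h h' ∧
      ∀ z ∈ Set.Icc 0 (2 * δ), |h z - h 0| ≤ 4 * M * δ ^ 2 := by
  have hsub : Set.Icc 0 (2 * δ) ⊆ Set.Icc 0 ε := Set.Icc_subset_Icc le_rfl hδε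
  have h00 : (0 : ℝ) ∈ Set.Icc 0 ε := ⟨le_rfl, by linarith⟩
  have hb : ∀ z ∈ Set.Icc 0 (2 * δ), |h' z| ≤ 4 * M * δ := by
    intro z hz
    have := H.abs_deriv_sub_le h00 (hsub hz)
    rw [h0, sub_zero, sub_zero, abs_of_nonneg hz.1] at this
    nlinarith [hz.2]
  refine ⟨⟨?_, ?_, fun z hz w hw => H.taylor z (hsub hz) w (hsub hw)⟩, ?_⟩
  · intro z hz w hw
    have h1 : |w - z| ≤ 2 * δ := by rw [abs_le]; constructor <;> linarith [hz.1, hz.2, hw.1, hw.2]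
    calc |h w - h z| = |(h w - h z - h' z * (w - z)) + h' z * (w - z)| := by congr 1; ring
      _ ≤ M * (w - z) ^ 2 + 4 * M * δ * |w - z| := by
          refine (abs_add_le _ _).trans (add_le_add (H.taylor z (hsub hz) w (hsub hw)) ?_)
          rw [abs_mul]; gcongr; exact hb z hz
      _ = M * (|w - z| * |w - z|) + 4 * M * δ * |w - z| := by rw [← sq, sq_abs]
      _ ≤ M * ((2 * δ) * |w - z|) + 4 * M * δ * |w - z| := by gcongr
      _ = _ := by ring
  · intro z hz
    exact (hb z hz).trans (by nlinarith [mul_nonneg hM hδ])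
  · intro z hz
    have := H.taylor 0 h00 z (hsub hz)
    rw [h0, zero_mul, sub_zero, sub_zero] at this
    have h2 : z ^ 2 ≤ (2 * δ) ^ 2 := pow_le_pow_left₀ hz.1 hz.2 2
    calc |h z - h 0| ≤ M * z ^ 2 := this
      _ ≤ M * (2 * δ) ^ 2 := by gcongr
      _ = _ := by ring

/-- The cutoff `1 - max (x - 1) 0 ^ 2` on `[0, 2]`. -/
theorem IsJet.cutoff : IsJet (Set.Icc 0 2) 2 1 (fun x => 1 - max (x - 1) 0 ^ 2)
    (fun x => -2 * max (x - 1) 0) where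
  lip z hz w hw := by
    obtain ⟨-, hz⟩ := hz
    obtain ⟨-, hw⟩ := hw
    have a1 : max (z - 1) 0 ≤ 1 := max_le (by linarith) zero_le_one
    have a2 : max (w - 1) 0 ≤ 1 := max_le (by linarith) zero_le_one
    have b1 : 0 ≤ max (z - 1) 0 := le_max_right _ _
    have b2 : 0 ≤ max (w - 1) 0 := le_max_right _ _
    have l : |max (w - 1) 0 - max (z - 1) 0| ≤ |w - z| := by
      simpa using abs_max_sub_max_le_abs (w - 1) (z - 1) 0
    calc |1 - max (w - 1) 0 ^ 2 - (1 - max (z - 1) 0 ^ 2)|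
        = |max (w - 1) 0 + max (z - 1) 0| * |max (w - 1) 0 - max (z - 1) 0| := by
          rw [← abs_mul, ← abs_neg]; congr 1; ring
      _ ≤ 2 * |w - z| := by
          rw [abs_of_nonneg (add_nonneg b2 b1)]
          exact mul_le_mul (by linarith) l (abs_nonneg _) zero_le_two
  bound z hz := by
    have a1 : max (z - 1) 0 ≤ 1 := max_le (by linarith [hz.2]) zero_le_one
    have b1 : 0 ≤ max (z - 1) 0 := le_max_right _ _
    rw [abs_le]; constructor <;> linarith
  taylor z hz w hw := by
    rcases le_total z 1 with h1 | h1 <;> rcases le_total w 1 with h2 | h2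
    · rw [max_eq_right (sub_nonpos.2 h1), max_eq_right (sub_nonpos.2 h2)]
      simp [sq_nonneg]
    · rw [max_eq_right (sub_nonpos.2 h1), max_eq_left (sub_nonneg.2 h2), abs_le]
      constructor <;> nlinarith
    · rw [max_eq_left (sub_nonneg.2 h1), max_eq_right (sub_nonpos.2 h2), abs_le]
      constructor <;> nlinarith
    · rw [max_eq_left (sub_nonneg.2 h1), max_eq_left (sub_nonneg.2 h2), abs_le]
      constructor <;> nlinarith

/-- In the equation both η - η(0) and G are O(x²) while q(h) and h' stay bounded, so h - h(0) =
O(x²). -/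
theorem GraphData.deriv_zero {s Q a b : ℝ} {G G' η η' q q' h h' : ℝ → ℝ}
    (D : GraphData s Q a b G G' η η' q q') (H : IsCandidate a b h h')
    (heq : ∀ z ∈ Set.Icc (0 : ℝ) 2, h z + G z * q (h z) * h' z = η z)
    (hG : G' 0 = 0) (hη : η' 0 = 0) : h' 0 = 0 := by
  have h00 : (0 : ℝ) ∈ Set.Icc (0 : ℝ) 2 := by simp
  have e0 : h 0 = η 0 := by have := heq 0 h00; simpa [D.G_zero] using this
  have hs := D.s_le
  have hsQ := D.s_mul_le
  have hs0 := D.s_nonneg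
  have hQ := D.one_le_Q
  have key : ∀ x : ℝ, 0 < x → x ≤ 1 → |h' 0| ≤ 2 * x := by
    intro x hx hx1
    have hx2 : x ∈ Set.Icc (0 : ℝ) 2 := ⟨hx.le, by linarith⟩
    have t1 := H.jet.taylor 0 h00 x hx2
    have t2 := D.jetη.taylor 0 h00 x hx2
    have t3 := D.jetG.taylor 0 h00 x hx2
    rw [hη, zero_mul, sub_zero, sub_zero] at t2
    rw [hG, D.G_zero, zero_mul, sub_zero, sub_zero, sub_zero] at t3
    rw [sub_zero] at t1
    have t4 : |G x * q (h x) * h' x| ≤ s * x ^ 2 * Q * 1 := by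
      rw [abs_mul, abs_mul]
      exact mul_le_mul (mul_le_mul t3 (D.absq _ (H.mem x hx2)) (abs_nonneg _) (by positivity))
        (H.jet.bound x hx2) (abs_nonneg _) (by positivity)
    have t5 : |h' 0 * x| ≤ 1 * x ^ 2 + s * x ^ 2 + s * x ^ 2 * Q * 1 := by
      calc |h' 0 * x| = |-(h x - h 0 - h' 0 * x) + (η x - η 0) - G x * q (h x) * h' x| := by
            congr 1; have := heq x hx2; rw [e0]; linarith
        _ ≤ _ := by
            refine (abs_sub _ _).trans (add_le_add ((abs_add_le _ _).trans (add_le_add ?_ t2)) t4)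
            rwa [abs_neg]
    rw [abs_mul, abs_of_pos hx] at t5
    refine le_of_mul_le_mul_right (t5.trans ?_) hx
    nlinarith [sq_nonneg x]
  by_contra hne
  have hp := abs_pos.2 hne
  have := key (min (|h' 0| / 4) 1) (lt_min (by linarith) one_pos) (min_le_right _ _)
  linarith [min_le_left (|h' 0| / 4) 1]

/-! ### The planar system and its invariant curve -/

/-- The planar vector field for general functions `w` (for `W̄`) and `g` (for `f̄'`). -/
noncomputable def planarField (w g : ℝ → ℝ) (N : ℝ) (p : ℝ × ℝ) : ℝ × ℝ :=
  (-(p.1 + 1 / √6 * (w p.2 + N)) * (1 - p.1 ^ 2), √(2 / 3) * g p.2 * p.1)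

/-- The properties of `W̄`, `f̄'` that the analysis of the planar system uses. -/
structure PlanarData (w g : ℝ → ℝ) (N ε : ℝ) : Prop where
  pos : 0 < ε
  sq_lt : N ^ 2 < 6
  contDiffOn_w : ContDiffOn ℝ 2 w (Set.Icc 0 ε)
  contDiffOn_g : ContDiffOn ℝ 2 g (Set.Icc 0 ε)
  w_zero : w 0 = 0
  g_zero : g 0 = 0
  deriv_w : derivWithin w (Set.Icc 0 ε) 0 = 0
  deriv_g : derivWithin g (Set.Icc 0 ε) 0 = 0
  g_neg : ∀ z ∈ Set.Ioc 0 ε, g z < 0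

/-- `y = h z`, `0 ≤ z < δ`, is an invariant curve, tangent to the `z`-axis at `p_N`. -/
structure InvGraph (w g : ℝ → ℝ) (N δ : ℝ) (h h' : ℝ → ℝ) : Prop where
  pos : 0 < δ
  deriv : ∀ z ∈ Set.Ico 0 δ, HasDerivWithinAt h (h' z) (Set.Ico 0 δ) z
  cont : ContinuousOn h' (Set.Ico 0 δ)
  h_zero : h 0 = -N / √6
  deriv_zero : h' 0 = 0
  abs_lt : ∀ z ∈ Set.Ico 0 δ, |h z| < 1
  eq : ∀ z ∈ Set.Ico 0 δ,
    √(2 / 3) * g z * h z * h' z = -(h z + 1 / √6 * (w z + N)) * (1 - h z ^ 2)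

theorem abs_y0_lt {N : ℝ} (hN : N ^ 2 < 6) : |-N / √6| < 1 := by
  rw [abs_div, abs_neg, abs_of_nonneg (Real.sqrt_nonneg 6), div_lt_one (by positivity)]
  exact Real.lt_sqrt_of_sq_lt (by rwa [sq_abs])

theorem sqrt_two_thirds_le_one : √(2 / 3) ≤ 1 := Real.sqrt_le_one.2 (by norm_num)

/-- Put z = δx, multiply g by a cutoff which is 1 for x ≤ 1 and 0 at x = 2, and solve on [0, 2]; the
part x < 1 gives the curve. The scaling loses no smallness in the drift: dh/dz contributes 1/δ, but
g is of order δ² on this scale. -/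
theorem PlanarData.exists_invGraph {w g : ℝ → ℝ} {N ε : ℝ} (D : PlanarData w g N ε) :
    ∃ δ h h', δ < ε ∧ InvGraph w g N δ h h' := by
  set y₀ := -N / √6 with hy₀
  -- N² < 6 leaves an interval of radius r around y₀ on which 1 - y² is bounded away from 0, so that
  -- q is smooth there.
  have hy : |y₀| < 1 := abs_y0_lt D.sq_lt
  set r := (1 - |y₀|) / 2 with hr
  have hr0 : 0 < r := by rw [hr]; linarith
  set η : ℝ → ℝ := fun z => -(1 / √6) * w z + (-(1 / √6)) * N with hη
  have hη0 : η 0 = y₀ := by simp only [hη, hy₀, D.w_zero]; ring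
  have hlt : ∀ y ∈ Set.Icc (y₀ - r) (y₀ + r), 0 < 1 - y ^ 2 := by
    intro y hyI
    have h1 : |y| < 1 := by
      have := abs_le.1 (le_refl |y₀|)
      rw [abs_lt]; constructor <;> linarith [hyI.1, hyI.2]
    have : y ^ 2 < 1 := (sq_lt_one_iff_abs_lt_one y).2 h1
    linarith
  obtain ⟨Kw, Mw, hKw, hMw, Jw⟩ := IsJet.exists_of_contDiffOn D.pos D.contDiffOn_w
  obtain ⟨Kg, Mg, hKg, hMg, Jg⟩ := IsJet.exists_of_contDiffOn D.pos D.contDiffOn_g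
  have hqC : ContDiffOn ℝ 2 (fun y : ℝ => y / (1 - y ^ 2)) (Set.Icc (y₀ - r) (y₀ + r)) :=
    contDiffOn_id.div (contDiffOn_const.sub (contDiffOn_id.pow 2)) fun y hyI => (hlt y hyI).ne'
  obtain ⟨Kq, Mq, hKq, hMq, Jq⟩ := IsJet.exists_of_contDiffOn (by linarith) hqC
  obtain ⟨Bq, hBq⟩ := isCompact_Icc.exists_bound_of_continuousOn hqC.continuousOn
  set Q := max (max Kq Mq) (max Bq 1)
  have hQ1 : 1 ≤ Q := (le_max_right _ _).trans (le_max_right _ _)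
  have hKQ : Kq ≤ Q := (le_max_left _ _).trans (le_max_left _ _)
  have hMQ : Mq ≤ Q := (le_max_right _ _).trans (le_max_left _ _)
  have hBQ : Bq ≤ Q := (le_max_left _ _).trans (le_max_right _ _)
  set M := max 1 (max Mw Mg)
  have hM1 : 1 ≤ M := le_max_left _ _
  have hMwM : Mw ≤ M := (le_max_left _ _).trans (le_max_right _ _)
  have hMgM : Mg ≤ M := (le_max_right _ _).trans (le_max_right _ _)
  have hM0 : 0 ≤ M := by linarith
  replace Jw := Jw.mono_const le_rfl hMwM
  replace Jg := Jg.mono_const le_rfl hMgM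
  -- The bound with 544 = 32·17 makes s = 17Mδ satisfy 32sQ ≤ 1; the bound with r keeps the values
  -- of η in the domain of q.
  obtain ⟨δ, hδ0, hδ1, hδε, hδQ, hδr⟩ : ∃ δ : ℝ, 0 < δ ∧ δ ≤ 1 ∧ δ ≤ ε / 2 ∧
      δ ≤ 1 / (544 * M * Q) ∧ δ ≤ r / (4 * M) := by
    refine ⟨min (min 1 (ε / 2)) (min (1 / (544 * M * Q)) (r / (4 * M))), ?_, ?_, ?_, ?_, ?_⟩
    · have := D.pos
      exact lt_min (lt_min one_pos (by positivity)) (lt_min (by positivity) (by positivity))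
    · exact (min_le_left _ _).trans (min_le_left _ _)
    · exact (min_le_left _ _).trans (min_le_right _ _)
    · exact (min_le_right _ _).trans (min_le_left _ _)
    · exact (min_le_right _ _).trans (min_le_right _ _)
  rw [le_div_iff₀ (by positivity)] at hδQ hδr
  set η' : ℝ → ℝ := fun z => -(1 / √6) * derivWithin w (Set.Icc 0 ε) z
  set g' : ℝ → ℝ := derivWithin g (Set.Icc 0 ε)
  have hs6 : |-(1 / √6)| ≤ 1 := by
    rw [abs_neg, abs_of_nonneg (by positivity), div_le_one (by positivity)]
    exact Real.one_le_sqrt.2 (by norm_num)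
  have Jη : IsJet (Set.Icc 0 ε) Kw M η η' := by
    have J0 : IsJet (Set.Icc 0 ε) 0 0 (fun _ => N) (fun _ => 0) :=
      ⟨by simp, by simp, by simp⟩
    have J1 := Jw.lincomb J0 (a := -(1 / √6)) (b := -(1 / √6))
    have J2 := J1.mono_const (K₁ := Kw) (M₁ := M)
      (by rw [mul_zero, add_zero]; exact mul_le_of_le_one_left hKw hs6)
      (by rw [mul_zero, add_zero]; exact mul_le_of_le_one_left hM0 hs6)
    convert J2 using 1
    funext z; simp [η']
  obtain ⟨Jη1, bη⟩ := Jη.near_zero (by simp [η', D.deriv_w]) hM0 hδ0.le (by linarith)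
  obtain ⟨Jg1, bg⟩ := Jg.near_zero D.deriv_g hM0 hδ0.le (by linarith)
  have Jδ : IsJet (Set.Icc 0 2) δ 0 (fun x => δ * x) (fun _ => δ) :=
    ⟨fun z _ w _ => by rw [← mul_sub, abs_mul, abs_of_pos hδ0],
      fun z _ => (abs_of_pos hδ0).le, fun z _ w _ => by simp [← mul_sub]⟩
  have hmap : Set.MapsTo (fun x => δ * x) (Set.Icc 0 2) (Set.Icc 0 (2 * δ)) := fun x hx =>
    ⟨mul_nonneg hδ0.le hx.1, by simp only; nlinarith [hx.2]⟩
  have Jη2 := Jη1.comp Jδ hmap (by positivity) hM0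
  have Jg2 := Jg1.comp Jδ hmap (by positivity) hM0
  set c := √(2 / 3) with hc
  have hc0 : 0 ≤ c := Real.sqrt_nonneg _
  have hc1 : c ≤ 1 := sqrt_two_thirds_le_one
  have Jg3 : IsJet (Set.Icc 0 2) (6 * M * δ) (M * δ) (fun x => c / δ * g (δ * x))
      (fun x => c / δ * (g' (δ * x) * δ)) := by
    have J0 : IsJet (Set.Icc 0 2) 0 0 (fun _ => (0 : ℝ)) (fun _ => 0) :=
      ⟨by simp, by simp, by simp⟩
    have J1 := (Jg2.lincomb J0 (a := c / δ) (b := 0))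
    have e : |c / δ| * δ ≤ 1 := by
      rw [abs_of_nonneg (by positivity), div_mul_cancel₀ _ hδ0.ne']; exact hc1
    have J2 := J1.mono_const (K₁ := 6 * M * δ) (M₁ := M * δ)
      (by
        calc |c / δ| * (6 * M * δ * δ) + |(0 : ℝ)| * 0 = (|c / δ| * δ) * (6 * M * δ) := by
              simp; ring
          _ ≤ 1 * (6 * M * δ) := by gcongr
          _ = _ := one_mul _)
      (by
        calc |c / δ| * (M * δ ^ 2 + 6 * M * δ * 0) + |(0 : ℝ)| * 0 = (|c / δ| * δ) * (M * δ) := by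
              simp; ring
          _ ≤ 1 * (M * δ) := by gcongr
          _ = _ := one_mul _)
    convert J2 using 1
    · funext x; simp
    · funext x; simp [g']
  have bg3 : ∀ x ∈ Set.Icc (0 : ℝ) 2, |c / δ * g (δ * x)| ≤ 4 * M * δ := by
    intro x hx
    have := bg _ (hmap hx)
    rw [D.g_zero, sub_zero] at this
    rw [abs_mul, abs_of_nonneg (by positivity), div_mul_eq_mul_div, div_le_iff₀ hδ0]
    calc c * |g (δ * x)| ≤ 1 * (4 * M * δ ^ 2) := by gcongr
      _ = _ := by ring
  have bχ : ∀ x ∈ Set.Icc (0 : ℝ) 2, |1 - max (x - 1) 0 ^ 2| ≤ 1 := by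
    intro x hx
    have a1 : max (x - 1) 0 ≤ 1 := max_le (by linarith [hx.2]) zero_le_one
    have b1 : 0 ≤ max (x - 1) 0 := le_max_right _ _
    rw [abs_le]; constructor <;> nlinarith
  have JG := Jg3.mul IsJet.cutoff bg3 bχ (by positivity) (by positivity) (by positivity)
  have hMδ : 0 ≤ M * δ := by positivity
  have hMδ2 : M * δ * δ ≤ M * δ := mul_le_of_le_one_right hMδ hδ1
  -- The factor 17 is the remainder constant of the product with the cutoff: Mδ·1 + 4Mδ·1 + 6Mδ·2.
  have GD : GraphData (17 * (M * δ)) Q (y₀ - r) (y₀ + r) _ _ (fun x => η (δ * x))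
      (fun x => η' (δ * x) * δ) (fun y => y / (1 - y ^ 2)) _ :=
    { s_nonneg := by positivity
      one_le_Q := hQ1
      small := by nlinarith
      jetG := JG.mono_const (by linarith) (by linarith)
      absG := fun x hx => by
        rw [abs_mul]
        calc _ ≤ 4 * M * δ * 1 := mul_le_mul (bg3 x hx) (bχ x hx) (abs_nonneg _) (by positivity)
          _ ≤ _ := by linarith
      G_zero := by simp [D.g_zero]
      G_two := by norm_num
      jetη := Jη2.mono_const (by nlinarith) (by nlinarith)
      η_mem := fun x hx => by
        have h1 := bη _ (hmap hx)
        rw [hη0] at h1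
        have h2 := abs_le.1 (h1.trans (by nlinarith : 4 * M * δ ^ 2 ≤ r))
        constructor <;> linarith
      jetq := Jq.mono_const hKQ hMQ
      absq := fun y hyI => (hBq y hyI).trans hBQ }
  obtain ⟨h, h', Hc, heq⟩ := GD.exists_solution (by linarith)
  have hd0 : h' 0 = 0 := GD.deriv_zero Hc heq (by simp [g', D.deriv_g]) (by simp [η', D.deriv_w])
  have hh0 : h 0 = y₀ := by
    have := heq 0 (by simp)
    simpa [D.g_zero, hη0] using this
  have hmap2 : Set.MapsTo (fun z => δ⁻¹ * z) (Set.Ico 0 δ) (Set.Icc 0 2) := fun z hz =>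
    ⟨mul_nonneg (by positivity) hz.1, by
      simp only; rw [inv_mul_le_iff₀ hδ0]; linarith [hz.2]⟩
  have Jδ2 : IsJet (Set.Ico 0 δ) δ⁻¹ 0 (fun z => δ⁻¹ * z) (fun _ => δ⁻¹) :=
    ⟨fun z _ w _ => by rw [← mul_sub, abs_mul, abs_of_pos (inv_pos.2 hδ0)],
      fun z _ => (abs_of_pos (inv_pos.2 hδ0)).le, fun z _ w _ => by simp [← mul_sub]⟩
  have JH := Hc.jet.comp Jδ2 hmap2 zero_le_one zero_le_one
  refine ⟨δ, fun z => h (δ⁻¹ * z), fun z => h' (δ⁻¹ * z) * δ⁻¹, by linarith [D.pos], hδ0,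
    fun z hz => JH.hasDerivWithinAt hz, JH.continuousOn_deriv, by simp [hh0, hy₀],
    by simp [hd0], ?_, ?_⟩
  · intro z hz
    have := hlt _ (Hc.mem _ (hmap2 hz))
    exact (sq_lt_one_iff_abs_lt_one _).1 (by linarith)
  · intro z hz
    have h1 := hlt _ (Hc.mem _ (hmap2 hz))
    have h2 := heq _ (hmap2 hz)
    have h3 : max (δ⁻¹ * z - 1) 0 = 0 := by
      apply max_eq_right
      rw [sub_nonpos, inv_mul_le_iff₀ hδ0]; linarith [hz.2]
    simp only at h2
    rw [mul_inv_cancel_left₀ hδ0.ne', h3] at h2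
    set Y := h (δ⁻¹ * z)
    have h4 : c * g z * Y * (h' (δ⁻¹ * z) * δ⁻¹)
        = (c / δ * g z * (1 - 0 ^ 2) * (Y / (1 - Y ^ 2)) * h' (δ⁻¹ * z)) * (1 - Y ^ 2) := by
      field_simp
      ring
    rw [h4, show c / δ * g z * (1 - 0 ^ 2) * (Y / (1 - Y ^ 2)) * h' (δ⁻¹ * z) = η z - Y by
      linarith]
    simp only [hη]; ring

/-! ### Uniqueness of solutions -/

/-- Grönwall's inequality, with time reversed when t < s. It serves for uniqueness and for the
invariance of curves and boundary pieces alike. -/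
theorem eqOn_zero_of_norm_deriv_le {E : Type*} [NormedAddCommGroup E] [NormedSpace ℝ E]
    {u u' : ℝ → E} {s t C : ℝ}
    (hu : ∀ τ ∈ Set.uIcc s t, HasDerivWithinAt u (u' τ) (Set.uIcc s t) τ)
    (hb : ∀ τ ∈ Set.uIcc s t, ‖u' τ‖ ≤ C * ‖u τ‖) (h0 : u s = 0) :
    ∀ τ ∈ Set.uIcc s t, u τ = 0 := by
  rcases le_total s t with h | h
  · rw [Set.uIcc_of_le h] at *
    refine eq_zero_of_abs_deriv_le_mul_abs_self_of_eq_zero_right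
      (fun τ hτ => (hu τ hτ).continuousWithinAt) (fun τ hτ => ?_) h0
      (fun τ hτ => hb τ (Set.Ico_subset_Icc_self hτ))
    exact (hu τ (Set.Ico_subset_Icc_self hτ)).mono_of_mem_nhdsWithin
      (Icc_mem_nhdsGE_of_mem hτ)
  · rw [Set.uIcc_of_ge h] at *
    have hneg : Set.MapsTo (fun τ : ℝ => -τ) (Set.Icc (-s) (-t)) (Set.Icc t s) := fun τ hτ =>
      ⟨by linarith [hτ.2], by linarith [hτ.1]⟩
    have hd : ∀ τ ∈ Set.Icc (-s) (-t), HasDerivWithinAt (fun τ => u (-τ)) (-u' (-τ))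
        (Set.Icc (-s) (-t)) τ := fun τ hτ => by
      have := (hu _ (hneg hτ)).scomp τ (hasDerivAt_neg τ).hasDerivWithinAt hneg
      simpa [Function.comp_def] using this
    have key := eq_zero_of_abs_deriv_le_mul_abs_self_of_eq_zero_right (f := fun τ => u (-τ))
      (f' := fun τ => -u' (-τ)) (K := C) (fun τ hτ => (hd τ hτ).continuousWithinAt)
      (fun τ hτ => (hd τ (Set.Ico_subset_Icc_self hτ)).mono_of_mem_nhdsWithin
        (Icc_mem_nhdsGE_of_mem hτ)) (by simpa using h0)
      (fun τ hτ => by rw [norm_neg]; exact hb _ (hneg (Set.Ico_subset_Icc_self hτ)))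
    intro τ hτ
    have := key (-τ) ⟨by linarith [hτ.2], by linarith [hτ.1]⟩
    simpa using this

theorem IsSolutionOn.mono {X : ℝ × ℝ → ℝ × ℝ} {D D' : Set (ℝ × ℝ)} {I J : Set ℝ}
    {γ : ℝ → ℝ × ℝ} (h : IsSolutionOn X D I γ) (hD : D ⊆ D') (hJ : J ⊆ I) :
    IsSolutionOn X D' J γ := fun τ hτ => ⟨hD (h τ (hJ hτ)).1, (h τ (hJ hτ)).2.mono hJ⟩

theorem IsSolutionOn.shift {X : ℝ × ℝ → ℝ × ℝ} {D : Set (ℝ × ℝ)} {I J : Set ℝ}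
    {γ : ℝ → ℝ × ℝ} (h : IsSolutionOn X D I γ) (b : ℝ) (hJ : Set.MapsTo (· + b) J I) :
    IsSolutionOn X D J (fun τ => γ (τ + b)) := fun τ hτ =>
  ⟨(h _ (hJ hτ)).1, by
    have := (h _ (hJ hτ)).2.scomp τ ((hasDerivAt_id τ).add_const b).hasDerivWithinAt hJ
    simpa [Function.comp_def] using this⟩

theorem IsSolutionOn.continuousOn {X : ℝ × ℝ → ℝ × ℝ} {D : Set (ℝ × ℝ)} {I : Set ℝ}
    {γ : ℝ → ℝ × ℝ} (h : IsSolutionOn X D I γ) : ContinuousOn γ I := fun τ hτ =>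
  (h τ hτ).2.continuousWithinAt

theorem IsSolutionOn.eqOn {X : ℝ × ℝ → ℝ × ℝ} {D : Set (ℝ × ℝ)} {K : NNReal}
    (hX : LipschitzOnWith K X D) {s t : ℝ} {γ₁ γ₂ : ℝ → ℝ × ℝ}
    (h₁ : IsSolutionOn X D (Set.uIcc s t) γ₁) (h₂ : IsSolutionOn X D (Set.uIcc s t) γ₂)
    (h : γ₁ s = γ₂ s) : ∀ τ ∈ Set.uIcc s t, γ₁ τ = γ₂ τ := by
  intro τ hτ
  refine sub_eq_zero.1 (eqOn_zero_of_norm_deriv_le (C := K) (u := fun τ => γ₁ τ - γ₂ τ)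
    (u' := fun τ => X (γ₁ τ) - X (γ₂ τ)) (fun τ hτ => (h₁ τ hτ).2.sub (h₂ τ hτ).2)
    (fun τ hτ => ?_) (sub_eq_zero.2 h) τ hτ)
  rw [← dist_eq_norm, ← dist_eq_norm]
  exact hX.dist_le_mul _ (h₁ τ hτ).1 _ (h₂ τ hτ).1

/-- The open strip: the phase space for `ε = f φ₀`. -/
abbrev strip (ε : ℝ) : Set (ℝ × ℝ) := Set.Ioo (-1) 1 ×ˢ Set.Ioo 0 ε

/-- The extended strip: the extended phase space for `ε = f φ₀`. -/
abbrev extStrip (ε : ℝ) : Set (ℝ × ℝ) := Set.Icc (-1) 1 ×ˢ Set.Ico 0 ε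

theorem strip_subset (ε : ℝ) : strip ε ⊆ extStrip ε :=
  Set.prod_mono Set.Ioo_subset_Icc_self Set.Ioo_subset_Ico_self

theorem isOpen_strip (ε : ℝ) : IsOpen (strip ε) := isOpen_Ioo.prod isOpen_Ioo

theorem IsSolutionOn.hasDerivWithinAt_fst {w g : ℝ → ℝ} {N : ℝ} {D : Set (ℝ × ℝ)} {I : Set ℝ}
    {γ : ℝ → ℝ × ℝ} (h : IsSolutionOn (planarField w g N) D I γ) {τ : ℝ} (hτ : τ ∈ I) :
    HasDerivWithinAt (fun τ => (γ τ).1)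
      (-((γ τ).1 + 1 / √6 * (w (γ τ).2 + N)) * (1 - (γ τ).1 ^ 2)) I τ :=
  (ContinuousLinearMap.fst ℝ ℝ ℝ).hasFDerivAt.comp_hasDerivWithinAt τ (h τ hτ).2

theorem IsSolutionOn.hasDerivWithinAt_snd {w g : ℝ → ℝ} {N : ℝ} {D : Set (ℝ × ℝ)} {I : Set ℝ}
    {γ : ℝ → ℝ × ℝ} (h : IsSolutionOn (planarField w g N) D I γ) {τ : ℝ} (hτ : τ ∈ I) :
    HasDerivWithinAt (fun τ => (γ τ).2) (√(2 / 3) * g (γ τ).2 * (γ τ).1) I τ :=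
  (ContinuousLinearMap.snd ℝ ℝ ℝ).hasFDerivAt.comp_hasDerivWithinAt τ (h τ hτ).2

namespace PlanarData

variable {w g : ℝ → ℝ} {N ε : ℝ} (D : PlanarData w g N ε)
include D

theorem contDiffOn_field :
    ContDiffOn ℝ 2 (planarField w g N) (Set.Icc (-1) 1 ×ˢ Set.Icc 0 ε) := by
  have h1 : ContDiffOn ℝ 2 (fun p : ℝ × ℝ => w p.2) (Set.Icc (-1) 1 ×ˢ Set.Icc 0 ε) :=
    D.contDiffOn_w.comp contDiffOn_snd fun p hp => hp.2
  have h2 : ContDiffOn ℝ 2 (fun p : ℝ × ℝ => g p.2) (Set.Icc (-1) 1 ×ˢ Set.Icc 0 ε) :=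
    D.contDiffOn_g.comp contDiffOn_snd fun p hp => hp.2
  unfold planarField
  exact ((contDiffOn_fst.add (contDiffOn_const.mul (h1.add contDiffOn_const))).neg.mul
    (contDiffOn_const.sub (contDiffOn_fst.pow 2))).prodMk
      ((contDiffOn_const.mul h2).mul contDiffOn_fst)

theorem exists_lipschitz : ∃ K, LipschitzOnWith K (planarField w g N) (extStrip ε) := by
  obtain ⟨K, hK⟩ := D.contDiffOn_field.exists_lipschitzOnWith (by norm_num)
    ((convex_Icc _ _).prod (convex_Icc _ _)) (isCompact_Icc.prod isCompact_Icc)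
  exact ⟨K, hK.mono (Set.prod_mono le_rfl Set.Ico_subset_Icc_self)⟩

/-- Solutions in the extended phase space are unique. -/
theorem eqOn {s t : ℝ} {γ₁ γ₂ : ℝ → ℝ × ℝ}
    (h₁ : IsSolutionOn (planarField w g N) (extStrip ε) (Set.uIcc s t) γ₁)
    (h₂ : IsSolutionOn (planarField w g N) (extStrip ε) (Set.uIcc s t) γ₂)
    (h : γ₁ s = γ₂ s) : ∀ τ ∈ Set.uIcc s t, γ₁ τ = γ₂ τ :=
  let ⟨_, hK⟩ := D.exists_lipschitz
  h₁.eqOn hK h₂ h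

/-- The field is C¹ near points of the open strip, so a solution exists on both sides of time 0;
continuity keeps it in U for a short time. -/
theorem exists_local_solution {p : ℝ × ℝ} (hp : p ∈ strip ε) {U : Set (ℝ × ℝ)} (hU : U ∈ 𝓝 p) :
    ∃ e > 0, ∃ γ : ℝ → ℝ × ℝ, γ 0 = p ∧
      IsSolutionOn (planarField w g N) (strip ε ∩ U) (Set.Icc (-e) e) γ := by
  have hC : ContDiffAt ℝ 1 (planarField w g N) p :=
    (D.contDiffOn_field.contDiffAt (mem_of_superset ((isOpen_strip ε).mem_nhds hp)
      (Set.prod_mono Set.Ioo_subset_Icc_self Set.Ioo_subset_Icc_self))).of_le (by norm_num)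
  obtain ⟨γ, h0, e, he, hγ⟩ :=
    hC.exists_forall_mem_closedBall_exists_eq_forall_mem_Ioo_hasDerivAt₀ 0
  have hc : ContinuousAt γ 0 := (hγ 0 (by simp [he])).continuousAt
  have hn : γ ⁻¹' (strip ε ∩ U) ∈ 𝓝 0 :=
    hc (inter_mem (by rw [h0]; exact (isOpen_strip ε).mem_nhds hp) (by rwa [h0]))
  obtain ⟨d, hd, hball⟩ := Metric.mem_nhds_iff.1 hn
  refine ⟨min (e / 2) (d / 2), by positivity, γ, h0, fun τ hτ => ⟨hball ?_, ?_⟩⟩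
  · rw [Metric.mem_ball, Real.dist_eq, sub_zero, abs_lt]
    have := min_le_right (e / 2) (d / 2)
    constructor <;> linarith [hτ.1, hτ.2]
  · have := min_le_left (e / 2) (d / 2)
    exact (hγ τ ⟨by linarith [hτ.1], by linarith [hτ.2]⟩).hasDerivWithinAt

end PlanarData

/-! ### Invariant graphs -/

namespace InvGraph

variable {w g h h' : ℝ → ℝ} {N ε δ : ℝ}

/-- The rate at which solutions approach an invariant graph. -/
noncomputable def rate (w g h h' : ℝ → ℝ) (N : ℝ) (p : ℝ × ℝ) : ℝ :=
  (1 - p.1 ^ 2) - (h p.2 + 1 / √6 * (w p.2 + N)) * (p.1 + h p.2) + h' p.2 * (√(2 / 3) * g p.2)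

variable (H : InvGraph w g N δ h h')
include H

theorem continuousOn : ContinuousOn h (Set.Ico 0 δ) := fun z hz => (H.deriv z hz).continuousWithinAt

theorem mono {δ' : ℝ} (h0 : 0 < δ') (hδ : δ' ≤ δ) : InvGraph w g N δ' h h' where
  pos := h0
  deriv z hz := (H.deriv z (Set.Ico_subset_Ico_right hδ hz)).mono (Set.Ico_subset_Ico_right hδ)
  cont := H.cont.mono (Set.Ico_subset_Ico_right hδ)
  h_zero := H.h_zero
  deriv_zero := H.deriv_zero
  abs_lt z hz := H.abs_lt z (Set.Ico_subset_Ico_right hδ hz)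
  eq z hz := H.eq z (Set.Ico_subset_Ico_right hδ hz)

/-- The distance from an invariant graph satisfies a linear equation along solutions. -/
theorem hasDerivWithinAt_sub {S : Set (ℝ × ℝ)} {I : Set ℝ} {γ : ℝ → ℝ × ℝ}
    (hγ : IsSolutionOn (planarField w g N) S I γ)
    (hI : Set.MapsTo (fun τ => (γ τ).2) I (Set.Ico 0 δ)) {τ : ℝ} (hτ : τ ∈ I) :
    HasDerivWithinAt (fun τ => (γ τ).1 - h (γ τ).2)
      (-(rate w g h h' N (γ τ) * ((γ τ).1 - h (γ τ).2))) I τ := by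
  have h1 := (H.deriv _ (hI hτ)).comp τ (hγ.hasDerivWithinAt_snd hτ) hI
  refine ((hγ.hasDerivWithinAt_fst hτ).sub h1).congr_deriv ?_
  have := H.eq _ (hI hτ)
  simp only at this ⊢
  simp only [rate]
  linear_combination -this

theorem continuousOn_rate (D : PlanarData w g N ε) (hδ : δ ≤ ε) :
    ContinuousOn (rate w g h h' N) (Set.univ ×ˢ Set.Ico 0 δ) := by
  have hs : Set.Ico 0 δ ⊆ Set.Icc 0 ε := fun z hz => ⟨hz.1, hz.2.le.trans hδ⟩
  have m : Set.MapsTo (Prod.snd : ℝ × ℝ → ℝ) (Set.univ ×ˢ Set.Ico 0 δ) (Set.Ico 0 δ) :=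
    fun p hp => hp.2
  have c1 : ContinuousOn (fun p : ℝ × ℝ => h p.2) (Set.univ ×ˢ Set.Ico 0 δ) :=
    H.continuousOn.comp continuousOn_snd m
  have c2 : ContinuousOn (fun p : ℝ × ℝ => h' p.2) (Set.univ ×ˢ Set.Ico 0 δ) :=
    H.cont.comp continuousOn_snd m
  have c3 : ContinuousOn (fun p : ℝ × ℝ => w p.2) (Set.univ ×ˢ Set.Ico 0 δ) :=
    (D.contDiffOn_w.continuousOn.mono hs).comp continuousOn_snd m
  have c4 : ContinuousOn (fun p : ℝ × ℝ => g p.2) (Set.univ ×ˢ Set.Ico 0 δ) :=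
    (D.contDiffOn_g.continuousOn.mono hs).comp continuousOn_snd m
  have c5 : ContinuousOn (fun p : ℝ × ℝ => p.1) (Set.univ ×ˢ Set.Ico 0 δ) := continuousOn_fst
  unfold rate
  exact ((continuousOn_const.sub (c5.pow 2)).sub
    ((c1.add (continuousOn_const.mul (c3.add continuousOn_const))).mul (c5.add c1))).add
      (c2.mul (continuousOn_const.mul c4))

/-- A solution which meets an invariant graph stays in it. -/
theorem stays (D : PlanarData w g N ε) (hδ : δ ≤ ε) {s t : ℝ} {γ : ℝ → ℝ × ℝ}
    (hγ : IsSolutionOn (planarField w g N) (extStrip ε) (Set.uIcc s t) γ)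
    (hs : (γ s).1 = h (γ s).2) (hz : ∀ τ ∈ Set.uIcc s t, (γ τ).2 < δ) :
    ∀ τ ∈ Set.uIcc s t, (γ τ).1 = h (γ τ).2 := by
  have hI : Set.MapsTo (fun τ => (γ τ).2) (Set.uIcc s t) (Set.Ico 0 δ) := fun τ hτ =>
    ⟨(hγ τ hτ).1.2.1, hz τ hτ⟩
  obtain ⟨C, hC⟩ := isCompact_uIcc.exists_bound_of_continuousOn
    ((H.continuousOn_rate D hδ).comp hγ.continuousOn fun τ hτ => ⟨trivial, hI hτ⟩)
  intro τ hτ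
  refine sub_eq_zero.1 (eqOn_zero_of_norm_deriv_le (C := C)
    (fun τ hτ => H.hasDerivWithinAt_sub hγ hI hτ) (fun τ hτ => ?_) (sub_eq_zero.2 hs) τ hτ)
  rw [norm_neg, norm_mul]
  exact mul_le_mul_of_nonneg_right (hC τ hτ) (norm_nonneg _)

/-- A solution which tends to `p_N` in the past is eventually in each invariant graph. -/
theorem eventually_mem (D : PlanarData w g N ε) (hδ : δ ≤ ε) {T : ℝ} {γ : ℝ → ℝ × ℝ}
    (hγ : IsSolutionOn (planarField w g N) (extStrip ε) (Set.Iic T) γ)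
    (hlim : Tendsto γ atBot (𝓝 (pN N))) :
    ∀ᶠ τ in atBot, (γ τ).2 < δ ∧ (γ τ).1 = h (γ τ).2 := by
  have hp : pN N ∈ (Set.univ ×ˢ Set.Ico 0 δ : Set (ℝ × ℝ)) := ⟨trivial, le_rfl, H.pos⟩
  have hz : Tendsto (fun τ => (γ τ).2) atBot (𝓝 0) := (continuous_snd.tendsto _).comp hlim
  have hy : Tendsto (fun τ => (γ τ).1) atBot (𝓝 (-N / √6)) := (continuous_fst.tendsto _).comp hlim
  have ev1 : ∀ᶠ τ in atBot, (γ τ).2 < δ := hz.eventually (gt_mem_nhds H.pos)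
  have ev0 : ∀ᶠ τ in atBot, γ τ ∈ (Set.univ ×ˢ Set.Ico 0 δ : Set (ℝ × ℝ)) := by
    filter_upwards [ev1, eventually_le_atBot T] with τ h1 h2
    exact ⟨trivial, (hγ τ h2).1.2.1, h1⟩
  have hγ' : Tendsto γ atBot (𝓝[Set.univ ×ˢ Set.Ico 0 δ] (pN N)) :=
    tendsto_nhdsWithin_iff.2 ⟨hlim, ev0⟩
  have hrate : Tendsto (fun τ => rate w g h h' N (γ τ)) atBot (𝓝 (rate w g h h' N (pN N))) :=
    (H.continuousOn_rate D hδ _ hp).tendsto.comp hγ'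
  -- At p_N the rate is 1 - N²/6, minus the nonzero eigenvalue.
  have hpos : 0 < rate w g h h' N (pN N) := by
    have : (-N / √6) ^ 2 < 1 := (sq_lt_one_iff_abs_lt_one _).2 (abs_y0_lt D.sq_lt)
    simp only [rate, pN, H.h_zero, D.w_zero, D.g_zero]
    have e : -N / √6 + 1 / √6 * (0 + N) = 0 := by ring
    rw [e]; linarith
  have hu : Tendsto (fun τ => ((γ τ).1 - h (γ τ).2) ^ 2) atBot (𝓝 0) := by
    have h1 : Tendsto (fun τ => (γ τ).2) atBot (𝓝[Set.Ico 0 δ] 0) :=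
      tendsto_nhdsWithin_iff.2 ⟨hz, ev0.mono fun τ hτ => hτ.2⟩
    have h2 := (H.continuousOn 0 ⟨le_rfl, H.pos⟩).tendsto.comp h1
    rw [H.h_zero] at h2
    simpa using (hy.sub h2).pow 2
  obtain ⟨T₁, hT₁⟩ := eventually_atBot.1
    ((ev1.and (hrate.eventually (lt_mem_nhds hpos))).and (eventually_le_atBot T))
  have hsol := hγ.mono (J := Set.Iic T₁) le_rfl fun τ hτ => (hT₁ τ hτ).2
  have hI : Set.MapsTo (fun τ => (γ τ).2) (Set.Iic T₁) (Set.Ico 0 δ) := fun τ hτ =>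
    ⟨(hsol τ hτ).1.2.1, (hT₁ τ hτ).1.1⟩
  have hd := fun τ (hτ : τ ∈ Set.Iic T₁) => H.hasDerivWithinAt_sub hsol hI hτ
  -- The squared distance cannot increase in time, yet it tends to 0 in the past; hence it is 0
  -- throughout.
  have hanti : AntitoneOn (fun τ => ((γ τ).1 - h (γ τ).2) ^ 2) (Set.Iic T₁) := by
    refine antitoneOn_of_hasDerivWithinAt_nonpos (convex_Iic T₁)
      (f' := fun τ => 2 * ((γ τ).1 - h (γ τ).2) *
        (-(rate w g h h' N (γ τ) * ((γ τ).1 - h (γ τ).2))))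
      (fun τ hτ => ((hd τ hτ).pow 2).continuousWithinAt) (fun τ hτ => ?_) (fun τ hτ => ?_)
    · have hτ' : τ ∈ Set.Iic T₁ := interior_subset hτ
      exact (((hd τ hτ').mono interior_subset).fun_pow 2).congr_deriv (by norm_num)
    · have hτ' : τ ∈ Set.Iic T₁ := interior_subset hτ
      have := (hT₁ τ hτ').1.2
      nlinarith [mul_nonneg this.le (sq_nonneg ((γ τ).1 - h (γ τ).2))]
  filter_upwards [ev1, eventually_le_atBot T₁] with τ h1 h2
  refine ⟨h1, ?_⟩
  have : ((γ τ).1 - h (γ τ).2) ^ 2 ≤ 0 := by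
    refine ge_of_tendsto hu ?_
    filter_upwards [eventually_le_atBot τ] with σ hσ
    exact hanti (hσ.trans h2) h2 hσ
  have h3 := pow_eq_zero_iff (two_ne_zero) |>.1 (le_antisymm this (sq_nonneg _))
  linarith

end InvGraph

/-! ### Local center manifolds -/

section

variable {V f : ℝ → ℝ} {N φ₀ δ : ℝ} {h h' : ℝ → ℝ}

theorem InvGraph.isLocalCenterManifold
    (D : PlanarData (Wbar V N f φ₀) (fbar f φ₀) N (f φ₀))
    (H : InvGraph (Wbar V N f φ₀) (fbar f φ₀) N δ h h') (hδ : δ ≤ f φ₀) :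
    IsLocalCenterManifold V N f φ₀ {p | p.2 ∈ Set.Ico 0 δ ∧ p.1 = h p.2} := by
  have hu := uniqueDiffOn_Ico (0 : ℝ) δ
  have h0 : (0 : ℝ) ∈ Set.Ico 0 δ := ⟨le_rfl, H.pos⟩
  have hd : ∀ z ∈ Set.Ico 0 δ, derivWithin h (Set.Ico 0 δ) z = h' z := fun z hz =>
    (H.deriv z hz).derivWithin (hu z hz)
  refine ⟨δ, h, H.pos, ?_, H.h_zero, (hd 0 h0).trans H.deriv_zero, rfl, ?_, ?_⟩
  · rw [contDiffOn_one_iff_derivWithin hu]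
    exact ⟨fun z hz => (H.deriv z hz).differentiableWithinAt, H.cont.congr hd⟩
  · rintro ⟨y, z⟩ ⟨hz, rfl : y = h z⟩
    exact ⟨abs_le.1 (H.abs_lt z hz).le, hz.1, hz.2.trans_le hδ⟩
  · intro γ s t hγ hs hz
    have ht : t ∈ Set.uIcc s t := Set.right_mem_uIcc
    exact ⟨⟨(hγ t ht).1.2.1, hz t ht⟩, H.stays D hδ hγ hs.2 hz t ht⟩

/-- Dynamical invariance gives the differential equation of the curve: a solution started on it
stays on it, so y = h(z) can be differentiated at the initial time. -/
theorem IsLocalCenterManifold.exists_invGraph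
    (D : PlanarData (Wbar V N f φ₀) (fbar f φ₀) N (f φ₀)) {M : Set (ℝ × ℝ)}
    (hM : IsLocalCenterManifold V N f φ₀ M) :
    ∃ δ h h', δ ≤ f φ₀ ∧ InvGraph (Wbar V N f φ₀) (fbar f φ₀) N δ h h' ∧
      ∀ p : ℝ × ℝ, p.2 ∈ Set.Ico 0 δ → p.1 = h p.2 → p ∈ M := by
  obtain ⟨δ, h, hδ, hC, h0, hd0, rfl, hsub, hinv⟩ := hM
  have hu := uniqueDiffOn_Ico (0 : ℝ) δ
  have hz0 : (0 : ℝ) ∈ Set.Ico 0 δ := ⟨le_rfl, hδ⟩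
  have hδε : δ ≤ f φ₀ := by
    by_contra hlt
    push Not at hlt
    have : (h (f φ₀), f φ₀) ∈ extPhaseSpace f φ₀ := hsub ⟨⟨D.pos.le, hlt⟩, rfl⟩
    exact lt_irrefl _ this.2.2
  -- The extended phase space only gives |h| ≤ 1. The strict bound, needed for points in the open
  -- strip, holds near z = 0.
  have hlt1 : ∀ᶠ z in 𝓝[Set.Ico 0 δ] 0, |h z| < 1 := by
    have := (hC.continuousOn 0 hz0).abs
    refine this.tendsto.eventually (gt_mem_nhds ?_)
    rw [h0]; exact abs_y0_lt D.sq_lt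
  obtain ⟨e, he, hball⟩ := Metric.mem_nhdsWithin_iff.1 hlt1
  set δ' := min δ e
  have hδ'0 : 0 < δ' := lt_min hδ he
  have hss : Set.Ico 0 δ' ⊆ Set.Ico 0 δ := Set.Ico_subset_Ico_right (min_le_left _ _)
  rw [contDiffOn_one_iff_derivWithin hu] at hC
  have habs : ∀ z ∈ Set.Ico 0 δ', |h z| < 1 := fun z hz => by
    refine hball ⟨?_, hss hz⟩
    rw [Metric.mem_ball, Real.dist_eq, sub_zero, abs_of_nonneg hz.1]
    exact hz.2.trans_le (min_le_right _ _)
  refine ⟨δ', h, derivWithin h (Set.Ico 0 δ), (min_le_left _ _).trans hδε,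
    ⟨hδ'0, fun z hz => (hC.1 z (hss hz)).hasDerivWithinAt.mono hss, hC.2.mono hss, h0, hd0, habs,
      ?_⟩, fun p hp1 hp2 => ⟨hss hp1, hp2⟩⟩
  intro z hz
  rcases hz.1.eq_or_lt with rfl | hzpos
  · rw [D.g_zero, D.w_zero, h0]; ring
  have hzδ : z < δ := hz.2.trans_le (min_le_left _ _)
  have hp : (h z, z) ∈ strip (f φ₀) := ⟨abs_lt.1 (habs z hz), hzpos, hzδ.trans_le hδε⟩
  obtain ⟨a, ha, γ, hγ0, hγ⟩ := D.exists_local_solution hp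
    (U := Set.univ ×ˢ Set.Iio δ) ((isOpen_univ.prod isOpen_Iio).mem_nhds ⟨trivial, hzδ⟩)
  have hsol : IsSolutionOn (planarField (Wbar V N f φ₀) (fbar f φ₀) N)
      (strip (f φ₀) ∩ Set.univ ×ˢ Set.Iio δ) (Set.Icc 0 a) γ :=
    hγ.mono le_rfl (Set.Icc_subset_Icc (by linarith) le_rfl)
  have hmem : ∀ τ ∈ Set.Icc 0 a, (γ τ).1 = h (γ τ).2 := by
    intro τ hτ
    have hτs : Set.uIcc 0 τ ⊆ Set.Icc 0 a := by
      rw [Set.uIcc_of_le hτ.1]; exact Set.Icc_subset_Icc le_rfl hτ.2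
    refine (hinv γ 0 τ (hsol.mono (Set.inter_subset_left.trans (strip_subset _)) hτs) ?_ ?_).2
    · rw [hγ0]; exact ⟨⟨hz.1, hzδ⟩, rfl⟩
    · intro σ hσ
      exact (hsol σ (hτs hσ)).1.2.2
  have h0a : (0 : ℝ) ∈ Set.Icc 0 a := ⟨le_rfl, ha.le⟩
  have d1 := hsol.hasDerivWithinAt_fst h0a
  have d2 := hsol.hasDerivWithinAt_snd h0a
  have d3 : HasDerivAt h (derivWithin h (Set.Ico 0 δ) z) z :=
    (hC.1 z ⟨hz.1, hzδ⟩).hasDerivWithinAt.hasDerivAt (Ico_mem_nhds hzpos hzδ)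
  have d4 : HasDerivWithinAt (fun τ => h (γ τ).2) _ (Set.Icc 0 a) 0 :=
    HasDerivAt.comp_hasDerivWithinAt 0 (by rw [hγ0]; exact d3) d2
  have d5 := d1.congr_of_mem (fun τ hτ => (hmem τ hτ).symm) h0a
  have key := (uniqueDiffOn_Icc ha 0 h0a).eq_deriv _ d5 d4
  rw [hγ0] at key
  simp only at key
  linear_combination -key

end

/-! ### Orbits -/

/-- `p` and `q` lie on one solution in `D`. -/
def Joined (X : ℝ × ℝ → ℝ × ℝ) (D : Set (ℝ × ℝ)) (p q : ℝ × ℝ) : Prop :=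
  ∃ (γ : ℝ → ℝ × ℝ) (s t : ℝ), IsSolutionOn X D (Set.uIcc s t) γ ∧ γ s = p ∧ γ t = q

namespace Joined

variable {X : ℝ × ℝ → ℝ × ℝ} {D : Set (ℝ × ℝ)} {p q r : ℝ × ℝ}

theorem symm (h : Joined X D p q) : Joined X D q p := by
  obtain ⟨γ, s, t, hγ, hs, ht⟩ := h
  exact ⟨γ, t, s, by rwa [Set.uIcc_comm], ht, hs⟩

theorem right_mem (h : Joined X D p q) : q ∈ D := by
  obtain ⟨γ, s, t, hγ, -, rfl⟩ := h
  exact (hγ t Set.right_mem_uIcc).1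

theorem exists_from_zero (h : Joined X D p q) :
    ∃ (γ : ℝ → ℝ × ℝ) (t : ℝ), IsSolutionOn X D (Set.uIcc 0 t) γ ∧ γ 0 = p ∧ γ t = q := by
  obtain ⟨γ, s, t, hγ, rfl, rfl⟩ := h
  refine ⟨fun τ => γ (τ + s), t - s, hγ.shift s fun τ hτ => ?_, by simp, by simp⟩
  rw [Set.mem_uIcc] at hτ ⊢
  rcases hτ with ⟨h1, h2⟩ | ⟨h1, h2⟩
  · left; constructor <;> simp only <;> linarith
  · right; constructor <;> simp only <;> linarith

theorem of_glue {γ₁ γ₂ : ℝ → ℝ × ℝ} {a b : ℝ} (ha : a ≤ 0) (hb : 0 ≤ b)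
    (h₁ : IsSolutionOn X D (Set.uIcc 0 a) γ₁) (h₂ : IsSolutionOn X D (Set.uIcc 0 b) γ₂)
    (h : γ₁ 0 = γ₂ 0) : Joined X D (γ₁ a) (γ₂ b) := by
  rw [Set.uIcc_of_ge ha] at h₁
  rw [Set.uIcc_of_le hb] at h₂
  set γ : ℝ → ℝ × ℝ := fun τ => if τ ≤ 0 then γ₁ τ else γ₂ τ with hγ
  have e1 : ∀ τ ∈ Set.Icc a 0, γ τ = γ₁ τ := fun τ hτ => if_pos hτ.2
  have e2 : ∀ τ ∈ Set.Icc 0 b, γ τ = γ₂ τ := fun τ hτ => by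
    rcases hτ.1.eq_or_lt with rfl | hlt
    · rw [hγ]; simp [h]
    · exact if_neg (not_le.2 hlt)
  have s1 : IsSolutionOn X D (Set.Icc a 0) γ := fun τ hτ => by
    rw [e1 τ hτ]; exact ⟨(h₁ τ hτ).1, (h₁ τ hτ).2.congr_of_mem e1 hτ⟩
  have s2 : IsSolutionOn X D (Set.Icc 0 b) γ := fun τ hτ => by
    rw [e2 τ hτ]; exact ⟨(h₂ τ hτ).1, (h₂ τ hτ).2.congr_of_mem e2 hτ⟩
  refine ⟨γ, a, b, ?_, e1 a ⟨le_rfl, ha⟩, e2 b ⟨hb, le_rfl⟩⟩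
  rw [Set.uIcc_of_le (ha.trans hb), ← Set.Icc_union_Icc_eq_Icc ha hb]
  intro τ hτ
  rcases lt_trichotomy τ 0 with hlt | rfl | hlt
  · have hτ' : τ ∈ Set.Icc a 0 := hτ.resolve_right fun h => absurd h.1 (not_le.2 hlt)
    refine ⟨(s1 τ hτ').1, (s1 τ hτ').2.mono_of_mem_nhdsWithin ?_⟩
    filter_upwards [self_mem_nhdsWithin, mem_nhdsWithin_of_mem_nhds (Iio_mem_nhds hlt)] with σ h1 h2
    exact h1.resolve_right fun h => absurd h.1 (not_le.2 h2)
  -- At the junction both one-sided derivatives are the value of the field at the common point.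
  · exact ⟨(s1 0 ⟨ha, le_rfl⟩).1, (s1 0 ⟨ha, le_rfl⟩).2.union (s2 0 ⟨le_rfl, hb⟩).2⟩
  · have hτ' : τ ∈ Set.Icc 0 b := hτ.resolve_left fun h => absurd h.2 (not_le.2 hlt)
    refine ⟨(s2 τ hτ').1, (s2 τ hτ').2.mono_of_mem_nhdsWithin ?_⟩
    filter_upwards [self_mem_nhdsWithin, mem_nhdsWithin_of_mem_nhds (Ioi_mem_nhds hlt)] with σ h1 h2
    exact h1.resolve_left fun h => absurd h.2 (not_le.2 h2)

/-- With q at time 0 for both solutions, endpoints on opposite sides of 0 allow gluing. On the same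
side uniqueness makes one solution a piece of the other. -/
theorem trans {K : NNReal} (hX : LipschitzOnWith K X D) (h₁ : Joined X D p q)
    (h₂ : Joined X D q r) : Joined X D p r := by
  obtain ⟨γ₁, a, s₁, e₁, rfl⟩ := h₁.symm.exists_from_zero
  obtain ⟨γ₂, b, s₂, e₂, rfl⟩ := h₂.exists_from_zero
  have nested : ∀ {γ₁ γ₂ : ℝ → ℝ × ℝ} {a b : ℝ}, IsSolutionOn X D (Set.uIcc 0 a) γ₁ →
      IsSolutionOn X D (Set.uIcc 0 b) γ₂ → γ₁ 0 = γ₂ 0 → a ∈ Set.uIcc 0 b →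
      Joined X D (γ₁ a) (γ₂ b) := by
    intro γ₁ γ₂ a b s₁ s₂ e hab
    have hsub : Set.uIcc 0 a ⊆ Set.uIcc 0 b := Set.uIcc_subset_uIcc_left hab
    have := s₁.eqOn hX (s₂.mono le_rfl hsub) e a Set.right_mem_uIcc
    exact ⟨γ₂, a, b, s₂.mono le_rfl (Set.uIcc_subset_uIcc_right hab), this.symm, rfl⟩
  have e : γ₁ 0 = γ₂ 0 := e₁.trans e₂.symm
  rcases le_total a 0 with ha | ha <;> rcases le_total b 0 with hb | hb
  · rcases le_total a b with hab | hab
    · exact (nested s₂ s₁ e.symm (Set.mem_uIcc.2 (.inr ⟨hab, hb⟩))).symm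
    · exact nested s₁ s₂ e (Set.mem_uIcc.2 (.inr ⟨hab, ha⟩))
  · exact of_glue ha hb s₁ s₂ e
  · exact (of_glue hb ha s₂ s₁ e.symm).symm
  · rcases le_total a b with hab | hab
    · exact nested s₁ s₂ e (Set.mem_uIcc.2 (.inl ⟨ha, hab⟩))
    · exact (nested s₂ s₁ e.symm (Set.mem_uIcc.2 (.inl ⟨hb, hab⟩))).symm

end Joined

theorem isSolutionOn_const {w g : ℝ → ℝ} {N ε : ℝ} (I : Set ℝ) {p : ℝ × ℝ} (hp : p ∈ extStrip ε)
    (h : planarField w g N p = 0) :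
    IsSolutionOn (planarField w g N) (extStrip ε) I (fun _ => p) := fun τ _ =>
  ⟨hp, by rw [h]; exact hasDerivWithinAt_const _ _ _⟩

namespace PlanarData

variable {w g : ℝ → ℝ} {N ε : ℝ} (D : PlanarData w g N ε)
include D

theorem joined_trans {p q r : ℝ × ℝ} (h₁ : Joined (planarField w g N) (strip ε) p q)
    (h₂ : Joined (planarField w g N) (strip ε) q r) :
    Joined (planarField w g N) (strip ε) p r :=
  let ⟨_, hK⟩ := D.exists_lipschitz
  h₁.trans (hK.mono (strip_subset ε)) h₂

/-- The boundary `z = 0` is invariant. -/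
theorem snd_eq_zero {s t : ℝ} {γ : ℝ → ℝ × ℝ}
    (hγ : IsSolutionOn (planarField w g N) (extStrip ε) (Set.uIcc s t) γ) (hs : (γ s).2 = 0) :
    (γ t).2 = 0 := by
  obtain ⟨K, hK⟩ := D.contDiffOn_g.exists_lipschitzOnWith (by norm_num) (convex_Icc _ _)
    isCompact_Icc
  refine eqOn_zero_of_norm_deriv_le (C := K) (fun τ hτ => hγ.hasDerivWithinAt_snd hτ)
    (fun τ hτ => ?_) hs t Set.right_mem_uIcc
  obtain ⟨⟨y1, y2⟩, z1, z2⟩ := (hγ τ hτ).1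
  have h1 := hK.dist_le_mul (γ τ).2 ⟨z1, z2.le⟩ 0 ⟨le_rfl, D.pos.le⟩
  rw [D.g_zero, dist_zero_right, dist_zero_right] at h1
  rw [norm_mul, norm_mul]
  have h2 : ‖(γ τ).1‖ ≤ 1 := abs_le.2 ⟨y1, y2⟩
  have h3 : ‖√(2 / 3)‖ ≤ 1 := by
    rw [Real.norm_of_nonneg (Real.sqrt_nonneg _)]; exact sqrt_two_thirds_le_one
  calc ‖√(2 / 3)‖ * ‖g (γ τ).2‖ * ‖(γ τ).1‖ ≤ 1 * (K * ‖(γ τ).2‖) * 1 := by gcongr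
    _ = _ := by ring

/-- The boundary `y² = 1` is invariant. -/
theorem one_sub_sq_eq_zero {s t : ℝ} {γ : ℝ → ℝ × ℝ}
    (hγ : IsSolutionOn (planarField w g N) (extStrip ε) (Set.uIcc s t) γ)
    (hs : 1 - (γ s).1 ^ 2 = 0) : 1 - (γ t).1 ^ 2 = 0 := by
  have cw : ContinuousOn (fun τ => w (γ τ).2) (Set.uIcc s t) :=
    D.contDiffOn_w.continuousOn.comp (continuous_snd.comp_continuousOn hγ.continuousOn)
      fun τ hτ => Set.Ico_subset_Icc_self (hγ τ hτ).1.2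
  have cy : ContinuousOn (fun τ => (γ τ).1) (Set.uIcc s t) :=
    continuous_fst.comp_continuousOn hγ.continuousOn
  obtain ⟨C, hC⟩ := isCompact_uIcc.exists_bound_of_continuousOn
    ((continuousOn_const (c := (2 : ℝ))).mul (cy.mul
      (cy.add ((continuousOn_const (c := 1 / √6)).mul (cw.add (continuousOn_const (c := N)))))))
  refine eqOn_zero_of_norm_deriv_le (C := C) (u := fun τ => 1 - (γ τ).1 ^ 2)
    (u' := fun τ => 2 * ((γ τ).1 * ((γ τ).1 + 1 / √6 * (w (γ τ).2 + N))) * (1 - (γ τ).1 ^ 2))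
    (fun τ hτ => ?_) (fun τ hτ => ?_) hs t Set.right_mem_uIcc
  · refine (((hγ.hasDerivWithinAt_fst hτ).fun_pow 2).const_sub 1).congr_deriv ?_
    push_cast
    ring
  · rw [norm_mul]
    exact mul_le_mul_of_nonneg_right (hC τ hτ) (norm_nonneg _)

theorem field_pN : planarField w g N (pN N) = 0 := by
  simp only [planarField, pN, D.w_zero, D.g_zero]
  ext <;> simp only [Prod.fst_zero, Prod.snd_zero] <;> ring

theorem pN_mem : pN N ∈ extStrip ε := ⟨abs_le.1 (abs_y0_lt D.sq_lt).le, le_rfl, D.pos⟩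

/-- A past-asymptotic solution is constant or stays in the open phase space. -/
theorem strip_or_const {T : ℝ} {γ : ℝ → ℝ × ℝ}
    (hγ : IsSolutionOn (planarField w g N) (extStrip ε) (Set.Iic T) γ)
    (hlim : Tendsto γ atBot (𝓝 (pN N))) :
    IsSolutionOn (planarField w g N) (strip ε) (Set.Iic T) γ ∨ ∀ τ ≤ T, γ τ = pN N := by
  have hsub : ∀ {s t : ℝ}, s ≤ T → t ≤ T → Set.uIcc s t ⊆ Set.Iic T := fun hs ht τ hτ =>
    hτ.2.trans (max_le hs ht)
  by_cases h1 : ∃ τ₀ ≤ T, (γ τ₀).2 = 0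
  · right
    obtain ⟨τ₀, hτ₀, h0⟩ := h1
    have hz : ∀ τ ≤ T, (γ τ).2 = 0 := fun τ hτ =>
      D.snd_eq_zero (hγ.mono le_rfl (hsub hτ₀ hτ)) h0
    -- On the boundary z = 0 an invariant graph contains only p_N, so the solution reaches p_N and
    -- is constant by uniqueness.
    obtain ⟨δ, h, h', hδ, H⟩ := D.exists_invGraph
    obtain ⟨τ₁, ⟨-, hy⟩, hτ₁⟩ :=
      ((H.eventually_mem D hδ.le hγ hlim).and (eventually_le_atBot T)).exists
    rw [hz τ₁ hτ₁, H.h_zero] at hy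
    have e : γ τ₁ = pN N := Prod.ext hy (hz τ₁ hτ₁)
    intro τ hτ
    exact D.eqOn (hγ.mono le_rfl (hsub hτ₁ hτ)) (isSolutionOn_const _ D.pN_mem D.field_pN) e τ
      Set.right_mem_uIcc
  · left
    push Not at h1
    intro τ hτ
    obtain ⟨⟨⟨y1, y2⟩, z1, z2⟩, hd⟩ := hγ τ hτ
    have hy : 1 - (γ τ).1 ^ 2 ≠ 0 := by
      intro h0
      have hlim2 : Tendsto (fun τ => 1 - (γ τ).1 ^ 2) atBot (𝓝 (1 - (-N / √6) ^ 2)) :=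
        (((continuous_fst.tendsto _).comp hlim).pow 2).const_sub 1
      have : (-N / √6) ^ 2 < 1 := (sq_lt_one_iff_abs_lt_one _).2 (abs_y0_lt D.sq_lt)
      obtain ⟨σ, h2, hσ⟩ := ((hlim2.eventually (lt_mem_nhds
        (show 0 < 1 - (-N / √6) ^ 2 by linarith))).and (eventually_le_atBot T)).exists
      exact h2.ne' (D.one_sub_sq_eq_zero (hγ.mono le_rfl (hsub hτ hσ)) h0)
    refine ⟨⟨⟨lt_of_le_of_ne y1 ?_, lt_of_le_of_ne y2 ?_⟩, lt_of_le_of_ne z1 (h1 τ hτ).symm, z2⟩,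
      hd⟩
    · intro h; rw [← h] at hy; norm_num at hy
    · intro h; rw [h] at hy; norm_num at hy

/-! ### The monotone quantity `log K²` -/

/-- In the variable φ the integrand is (V'/V) dφ, so P(f(φ)) is log V up to a constant. With K² (1 -
y²) = 3V this is what makes `logEnergy` equal to log K² up to a constant. -/
theorem exists_primitive :
    ∃ P : ℝ → ℝ, ∀ z ∈ Set.Ioo 0 ε, HasDerivAt P ((w z + N) / g z) z := by
  have hc : ContinuousOn (fun z => (w z + N) / g z) (Set.Ioo 0 ε) :=
    ((D.contDiffOn_w.continuousOn.mono Set.Ioo_subset_Icc_self).add continuousOn_const).div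
      (D.contDiffOn_g.continuousOn.mono Set.Ioo_subset_Icc_self)
      fun z hz => (D.g_neg z ⟨hz.1, hz.2.le⟩).ne
  have hm : ε / 2 ∈ Set.Ioo 0 ε := ⟨by linarith [D.pos], by linarith [D.pos]⟩
  refine ⟨fun z => ∫ x in (ε / 2)..z, (w x + N) / g x, fun z hz => ?_⟩
  refine intervalIntegral.integral_hasDerivAt_right ?_
    (hc.stronglyMeasurableAtFilter isOpen_Ioo z hz) (hc.continuousAt (isOpen_Ioo.mem_nhds hz))
  exact (hc.mono ((convex_Ioo 0 ε).ordConnected.uIcc_subset hm hz)).intervalIntegrable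

end PlanarData

/-- `log K²` up to a constant, when `P' = (w + N) / g`. -/
noncomputable def logEnergy (P : ℝ → ℝ) (p : ℝ × ℝ) : ℝ := P p.2 - Real.log (1 - p.1 ^ 2)

theorem sqrt_two_thirds_mul : √(2 / 3) * √6 = 2 := by
  rw [← Real.sqrt_mul (by norm_num)]
  rw [show (2 / 3 * 6 : ℝ) = 2 ^ 2 by norm_num]
  exact Real.sqrt_sq (by norm_num)

theorem sqrt_two_thirds : √(2 / 3) = 2 * (1 / √6) := by
  rw [mul_one_div, eq_div_iff (by positivity), sqrt_two_thirds_mul]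

/-- The terms with w + N cancel and the derivative is -2y², the equation for K in disguise. -/
theorem PlanarData.logEnergy_antitone {w g : ℝ → ℝ} {N ε : ℝ} (D : PlanarData w g N ε)
    {P : ℝ → ℝ} (hP : ∀ z ∈ Set.Ioo 0 ε, HasDerivAt P ((w z + N) / g z) z) {s t : ℝ}
    {γ : ℝ → ℝ × ℝ} (hγ : IsSolutionOn (planarField w g N) (strip ε) (Set.uIcc s t) γ)
    (hst : s ≤ t) : logEnergy P (γ t) ≤ logEnergy P (γ s) := by
  rw [Set.uIcc_of_le hst] at hγ
  have hd : ∀ τ ∈ Set.Icc s t,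
      HasDerivWithinAt (fun τ => logEnergy P (γ τ)) (-2 * (γ τ).1 ^ 2) (Set.Icc s t) τ := by
    intro τ hτ
    obtain ⟨⟨y1, y2⟩, hz⟩ := (hγ τ hτ).1
    have hy : 0 < 1 - (γ τ).1 ^ 2 := by nlinarith
    have hg := (D.g_neg _ ⟨hz.1, hz.2.le⟩).ne
    have d1 := (hP _ hz).comp_hasDerivWithinAt τ (hγ.hasDerivWithinAt_snd hτ)
    have d2 := (((hγ.hasDerivWithinAt_fst hτ).fun_pow 2).const_sub 1).log hy.ne'
    refine (d1.sub d2).congr_deriv ?_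
    rw [sqrt_two_thirds]
    field_simp
    push_cast
    ring
  refine antitoneOn_of_hasDerivWithinAt_nonpos (convex_Icc s t)
    (fun τ hτ => (hd τ hτ).continuousWithinAt)
    (fun τ hτ => (hd τ (interior_subset hτ)).mono interior_subset) (fun τ _ => ?_)
    (Set.left_mem_Icc.2 hst) (Set.right_mem_Icc.2 hst) hst
  nlinarith [sq_nonneg (γ τ).1]

/-! ### The branch of an invariant graph without equilibria -/

namespace InvGraph

variable {w g h h' : ℝ → ℝ} {N ε δ : ℝ} (H : InvGraph w g N δ h h')
include H

theorem ne_zero (hne : ∀ z ∈ Set.Ioo 0 δ, w z + N ≠ 0) {z : ℝ} (hz : z ∈ Set.Ioo 0 δ) :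
    h z ≠ 0 := by
  intro h0
  have := H.eq z (Set.Ioo_subset_Ico_self hz)
  rw [h0] at this
  apply hne z hz
  have h6 : (1 / √6 : ℝ) ≠ 0 := by positivity
  apply (mul_eq_zero.1 (show 1 / √6 * (w z + N) = 0 by linarith)).resolve_left h6

theorem sign (hne : ∀ z ∈ Set.Ioo 0 δ, h z ≠ 0) :
    (∀ z ∈ Set.Ioo 0 δ, h z < 0) ∨ ∀ z ∈ Set.Ioo 0 δ, 0 < h z := by
  by_contra! hcon
  obtain ⟨⟨a, ha, ha'⟩, b, hb, hb'⟩ := hcon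
  obtain ⟨c, hc, hc'⟩ := isPreconnected_Ioo.intermediate_value hb ha
    (H.continuousOn.mono Set.Ioo_subset_Ico_self) ⟨hb', ha'⟩
  exact hne c hc hc'

theorem graph_mem_strip (hδ : δ ≤ ε) {z : ℝ} (hz : z ∈ Set.Ioo 0 δ) : (h z, z) ∈ strip ε :=
  ⟨_root_.abs_lt.1 (H.abs_lt z (Set.Ioo_subset_Ico_self hz)), hz.1, hz.2.trans_le hδ⟩

/-- Where h ≠ 0 the speed dz/dτ on the graph is nonzero, so a short solution covers a neighbourhood
in the graph. Being joined is thus locally constant along the connected interval. -/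
theorem joined (D : PlanarData w g N ε) (hδ : δ ≤ ε) (hne : ∀ z ∈ Set.Ioo 0 δ, h z ≠ 0)
    {z₁ z₂ : ℝ} (hz₁ : z₁ ∈ Set.Ioo 0 δ) (hz₂ : z₂ ∈ Set.Ioo 0 δ) :
    Joined (planarField w g N) (strip ε) (h z₁, z₁) (h z₂, z₂) := by
  refine isPreconnected_Ioo.induction₂
    (fun a b => Joined (planarField w g N) (strip ε) (h a, a) (h b, b))
    (fun z hz => ?_) (fun a b c _ _ _ => D.joined_trans) (fun a b _ _ => Joined.symm) hz₁ hz₂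
  refine Filter.Eventually.filter_mono nhdsWithin_le_nhds ?_
  obtain ⟨e, he, γ, hγ0, hγ⟩ := D.exists_local_solution (H.graph_mem_strip hδ hz)
    (U := Set.univ ×ˢ Set.Iio δ) ((isOpen_univ.prod isOpen_Iio).mem_nhds ⟨trivial, hz.2⟩)
  have hsub : ∀ {τ}, τ ∈ Set.Icc (-e) e → Set.uIcc 0 τ ⊆ Set.Icc (-e) e := fun hτ =>
    Set.uIcc_subset_Icc ⟨by linarith, he.le⟩ hτ
  have hgraph : ∀ τ ∈ Set.Icc (-e) e, (γ τ).1 = h (γ τ).2 := fun τ hτ =>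
    H.stays D hδ (hγ.mono (Set.inter_subset_left.trans (strip_subset ε)) (hsub hτ))
      (by rw [hγ0]) (fun σ hσ => (hγ σ (hsub hτ hσ)).1.2.2) τ Set.right_mem_uIcc
  have hnhds : ∀ τ ∈ Set.Ioo (-e) e, Set.Icc (-e) e ∈ 𝓝 τ := fun τ hτ => Icc_mem_nhds hτ.1 hτ.2
  have h0e : (0 : ℝ) ∈ Set.Ioo (-e) e := ⟨by linarith, he⟩
  have hder : ∀ τ ∈ Set.Ioo (-e) e,
      HasDerivAt (fun τ => (γ τ).2) (√(2 / 3) * g (γ τ).2 * (γ τ).1) τ := fun τ hτ =>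
    (hγ.hasDerivWithinAt_snd (Set.Ioo_subset_Icc_self hτ)).hasDerivAt (hnhds τ hτ)
  have cγ : ContinuousAt γ 0 := hγ.continuousOn.continuousAt (hnhds 0 h0e)
  have hzε : z < ε := hz.2.trans_le hδ
  have cg : ContinuousAt (fun τ => g (γ τ).2) 0 := by
    refine ContinuousAt.comp (g := g) ?_ (continuous_snd.continuousAt.comp cγ)
    simp only [hγ0]
    exact D.contDiffOn_g.continuousOn.continuousAt (Icc_mem_nhds hz.1 hzε)
  have hstrict := hasStrictDerivAt_of_hasDerivAt_of_continuousAt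
    (eventually_of_mem (isOpen_Ioo.mem_nhds h0e) hder)
    ((continuousAt_const.mul cg).mul (continuous_fst.continuousAt.comp cγ))
  -- Open mapping: the z-values of the solution at times near 0 fill a neighbourhood of z.
  have hmap := hstrict.map_nhds_eq (by
    rw [hγ0]
    have : √(2 / 3) ≠ (0 : ℝ) := by positivity
    exact mul_ne_zero (mul_ne_zero this (D.g_neg z ⟨hz.1, hzε.le⟩).ne) (hne z hz))
  rw [hγ0] at hmap
  rw [← hmap, eventually_map]
  filter_upwards [hnhds 0 h0e] with τ hτ
  exact ⟨γ, 0, τ, hγ.mono Set.inter_subset_left (hsub hτ), hγ0, Prod.ext (hgraph τ hτ) rfl⟩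

end InvGraph

/-! ### The orbit does not return to p_N off the graph -/

/-- A continuous function which starts below a level stays below it up to a first passage. -/
theorem lt_or_exists_first_passage {z : ℝ → ℝ} {s t c : ℝ} (hz : ContinuousOn z (Set.uIcc s t))
    (hs : z s < c) : (∀ τ ∈ Set.uIcc s t, z τ < c) ∨
      ∃ τ ∈ Set.uIcc s t, z τ = c ∧ ∀ σ ∈ Set.uIcc s τ, z σ ≤ c := by
  by_contra! hcon
  obtain ⟨⟨τ₀, hτ₀, hle⟩, hno⟩ := hcon
  have hcross : ∀ σ ∈ Set.uIcc s t, c ≤ z σ → ∃ τ ∈ Set.uIcc s σ, z τ = c := fun σ hσ h =>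
    intermediate_value_uIcc (hz.mono (Set.uIcc_subset_uIcc_left hσ))
      (Set.mem_uIcc.2 (.inl ⟨hs.le, h⟩))
  have hK : IsCompact (Set.uIcc s t ∩ z ⁻¹' {c}) :=
    isCompact_uIcc.of_isClosed_subset
      (hz.preimage_isClosed_of_isClosed isClosed_Icc isClosed_singleton) Set.inter_subset_left
  obtain ⟨τ₁, hτ₁, h₁⟩ := hcross τ₀ hτ₀ hle
  -- The first passage is the crossing time closest to s, so either order of s and t is covered.
  obtain ⟨τ, ⟨hτ, hzτ⟩, hmin⟩ := hK.exists_isMinOn ⟨τ₁, Set.uIcc_subset_uIcc_left hτ₀ hτ₁, h₁⟩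
    ((continuous_id.sub continuous_const).abs.continuousOn : ContinuousOn (fun σ => |σ - s|) _)
  obtain ⟨σ, hσ, hlt⟩ := hno τ hτ hzτ
  have hσ' := Set.uIcc_subset_uIcc_left hτ hσ
  obtain ⟨ρ, hρ, hρc⟩ := hcross σ hσ' hlt.le
  have h1 : |τ - s| ≤ |ρ - s| := hmin ⟨Set.uIcc_subset_uIcc_left hσ' hρ, hρc⟩
  have h2 : ρ = σ := by
    rw [Set.mem_uIcc] at hσ hρ
    rcases hσ with ⟨a1, a2⟩ | ⟨a1, a2⟩
    · rw [abs_of_nonneg (by linarith), abs_of_nonneg (by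
        rcases hρ with ⟨b1, b2⟩ | ⟨b1, b2⟩ <;> linarith)] at h1
      rcases hρ with ⟨b1, b2⟩ | ⟨b1, b2⟩ <;> linarith
    · rw [abs_of_nonpos (by linarith), abs_of_nonpos (by
        rcases hρ with ⟨b1, b2⟩ | ⟨b1, b2⟩ <;> linarith)] at h1
      rcases hρ with ⟨b1, b2⟩ | ⟨b1, b2⟩ <;> linarith
  rw [h2] at hρc
  exact hlt.ne' hρc

namespace InvGraph

variable {w g h h' : ℝ → ℝ} {N ε δ : ℝ} (H : InvGraph w g N δ h h')
include H

/-- A point of the orbit of an invariant graph at which the monotone quantity `Λ` is larger than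
at `(h z₁, z₁)` lies in the graph, since `Λ` prevents the orbit from leaving the graph. -/
theorem mem_of_joined (D : PlanarData w g N ε) (hδ : δ ≤ ε) {Λ : ℝ × ℝ → ℝ} {R : ℝ → ℝ → Prop}
    (htot : ∀ s t, R s t ∨ R t s) (hbet : ∀ s t τ, τ ∈ Set.uIcc s t → R t s → R τ s)
    (hΛ : ∀ (γ : ℝ → ℝ × ℝ) (s t : ℝ),
      IsSolutionOn (planarField w g N) (strip ε) (Set.uIcc s t) γ → R s t → Λ (γ t) ≤ Λ (γ s))
    {z₁ z₃ : ℝ} (h13 : z₁ < z₃) (h3 : z₃ < δ) (hΛ3 : Λ (h z₃, z₃) < Λ (h z₁, z₁)) {p : ℝ × ℝ}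
    (hp : Joined (planarField w g N) (strip ε) (h z₁, z₁) p) (hΛp : Λ (h z₁, z₁) < Λ p) :
    p.1 = h p.2 := by
  obtain ⟨γ, s, t, hγ, hs, rfl⟩ := hp
  -- R is the order of time when h < 0 and its reverse when h > 0. As Λ does not increase along R,
  -- the larger value at p puts p before the starting point.
  have hts : R t s := (htot s t).resolve_left fun hst =>
    absurd (hΛ γ s t hγ hst) (not_le.2 (by rwa [hs]))
  have hext := hγ.mono (strip_subset ε) le_rfl
  have hs1 : (γ s).1 = h (γ s).2 := by rw [hs]
  rcases lt_or_exists_first_passage (continuous_snd.comp_continuousOn hγ.continuousOn)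
    (show (γ s).2 < z₃ by rwa [hs]) with hlt | ⟨τ, hτ, hzτ, hle⟩
  · exact H.stays D hδ hext hs1 (fun τ hτ => (hlt τ hτ).trans h3) t Set.right_mem_uIcc
  · exfalso
    have hsub : Set.uIcc s τ ⊆ Set.uIcc s t := Set.uIcc_subset_uIcc_left hτ
    have hy := H.stays D hδ (hext.mono le_rfl hsub) hs1 (fun σ hσ => (hle σ hσ).trans_lt h3) τ
      Set.right_mem_uIcc
    have e : γ τ = (h z₃, z₃) := Prod.ext (by rw [hy]; exact congrArg h hzτ) hzτ
    have := hΛ γ τ s (hγ.mono le_rfl (by rwa [Set.uIcc_comm])) (hbet s t τ hτ hts)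
    rw [hs, e] at this
    exact absurd this (not_le.2 hΛ3)

/-- Along an invariant graph, the derivative of `log K²` has the sign of `h`. -/
theorem hasDerivAt_logEnergy (D : PlanarData w g N ε) (hδ : δ ≤ ε) {P : ℝ → ℝ}
    (hP : ∀ z ∈ Set.Ioo 0 ε, HasDerivAt P ((w z + N) / g z) z) {z : ℝ} (hz : z ∈ Set.Ioo 0 δ)
    (hne : h z ≠ 0) :
    HasDerivAt (fun z => logEnergy P (h z, z)) (-(2 * h z) / (√(2 / 3) * g z)) z := by
  have hzε : z < ε := hz.2.trans_le hδ
  have hg := (D.g_neg z ⟨hz.1, hzε.le⟩).ne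
  have hzI := Set.Ioo_subset_Ico_self hz
  have hh : HasDerivAt h (h' z) z := (H.deriv z hzI).hasDerivAt (Ico_mem_nhds hz.1 hz.2)
  have hy : 0 < 1 - h z ^ 2 := by
    have := (sq_lt_one_iff_abs_lt_one _).2 (H.abs_lt z hzI); linarith
  have h6 : (1 / √6 : ℝ) ≠ 0 := by positivity
  refine ((hP z ⟨hz.1, hzε⟩).sub (((hh.fun_pow 2).const_sub 1).log hy.ne')).congr_deriv ?_
  have heq := H.eq z hzI
  rw [sqrt_two_thirds] at heq ⊢
  set k : ℝ := 1 / √6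
  have e : h' z = -(h z + k * (w z + N)) * (1 - h z ^ 2) / (2 * k * g z * h z) := by
    rw [eq_div_iff (by positivity)]; linarith
  rw [e]
  field_simp
  push_cast
  ring

/-- The sign σ makes σ log K² strictly decreasing in z along the graph. Near p_N it therefore
exceeds its value at z = δ/2, and `mem_of_joined` applies with the barrier z = 3δ/4. -/
theorem locally_eq_of_sign (D : PlanarData w g N ε) (hδ : δ ≤ ε) {P : ℝ → ℝ}
    (hP : ∀ z ∈ Set.Ioo 0 ε, HasDerivAt P ((w z + N) / g z) z) {σ : ℝ}
    (hσ : ∀ z ∈ Set.Ioo 0 δ, σ * h z < 0) {R : ℝ → ℝ → Prop}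
    (htot : ∀ s t, R s t ∨ R t s) (hbet : ∀ s t τ, τ ∈ Set.uIcc s t → R t s → R τ s)
    (hΛ : ∀ (γ : ℝ → ℝ × ℝ) (s t : ℝ), IsSolutionOn (planarField w g N) (strip ε)
      (Set.uIcc s t) γ → R s t → σ * logEnergy P (γ t) ≤ σ * logEnergy P (γ s)) :
    ∃ U ∈ 𝓝 (pN N), ∀ p ∈ U, Joined (planarField w g N) (strip ε) (h (δ / 2), δ / 2) p →
      p.2 < δ ∧ p.1 = h p.2 := by
  have hδ0 := H.pos
  have hne : ∀ z ∈ Set.Ioo 0 δ, h z ≠ 0 := fun z hz h0 => by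
    have := hσ z hz; rw [h0] at this; simp at this
  have hd := fun z (hz : z ∈ Set.Ioo 0 δ) =>
    (H.hasDerivAt_logEnergy D hδ hP hz (hne z hz)).const_mul σ
  have hanti : StrictAntiOn (fun z => σ * logEnergy P (h z, z)) (Set.Ioo 0 δ) := by
    refine strictAntiOn_of_hasDerivWithinAt_neg (convex_Ioo 0 δ)
      (fun z hz => (hd z hz).continuousAt.continuousWithinAt)
      (fun z hz => (hd z (interior_subset hz)).hasDerivWithinAt) fun z hz => ?_
    replace hz : z ∈ Set.Ioo 0 δ := interior_subset hz
    have hg := D.g_neg z ⟨hz.1, hz.2.le.trans hδ⟩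
    have hc : 0 < √(2 / 3 : ℝ) := by positivity
    rw [show σ * (-(2 * h z) / (√(2 / 3) * g z)) = (-2 * (σ * h z)) / (√(2 / 3) * g z) by ring]
    exact div_neg_of_pos_of_neg (by linarith [hσ z hz]) (mul_neg_of_pos_of_neg hc hg)
  set S : Set (ℝ × ℝ) := Set.univ ×ˢ Set.Ico 0 δ
  have hpS : pN N ∈ S := ⟨trivial, le_rfl, hδ0⟩
  have hy0 : (-N / √6) ^ 2 < 1 := (sq_lt_one_iff_abs_lt_one _).2 (abs_y0_lt D.sq_lt)
  have hz2 : δ / 4 ∈ Set.Ioo 0 δ := ⟨by linarith, by linarith⟩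
  have hz1 : δ / 2 ∈ Set.Ioo 0 δ := ⟨by linarith, by linarith⟩
  have hz3 : 3 * δ / 4 ∈ Set.Ioo 0 δ := ⟨by linarith, by linarith⟩
  -- P need not have a limit at z = 0, so p is compared with the graph point at the same z: P
  -- cancels and the difference of logarithms tends to 0 at p_N. The graph value at z < δ/4 is at
  -- least that at δ/4.
  have hcont : ContinuousWithinAt (fun p : ℝ × ℝ => σ * logEnergy P (h (δ / 4), δ / 4)
      + σ * (Real.log (1 - h p.2 ^ 2) - Real.log (1 - p.1 ^ 2))) S (pN N) := by
    have c1 : ContinuousWithinAt (fun p : ℝ × ℝ => h p.2) S (pN N) :=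
      (H.continuousOn 0 ⟨le_rfl, hδ0⟩).comp (t := Set.Ico 0 δ) continuousWithinAt_snd
        fun p hp => hp.2
    have c2 : ContinuousWithinAt (fun p : ℝ × ℝ => p.1) S (pN N) := continuousWithinAt_fst
    have e1 : 1 - h (pN N).2 ^ 2 ≠ 0 := by simp only [pN, H.h_zero]; linarith
    have e2 : 1 - (pN N).1 ^ 2 ≠ 0 := by simp only [pN]; linarith
    exact continuousWithinAt_const.add (continuousWithinAt_const.mul
      (((continuousWithinAt_const.sub (c1.pow 2)).log e1).sub
        ((continuousWithinAt_const.sub (c2.pow 2)).log e2)))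
  have hval : σ * logEnergy P (h (δ / 2), δ / 2) < σ * logEnergy P (h (δ / 4), δ / 4)
      + σ * (Real.log (1 - h (pN N).2 ^ 2) - Real.log (1 - (pN N).1 ^ 2)) := by
    simp only [pN, H.h_zero, sub_self, mul_zero, add_zero]
    exact hanti hz2 hz1 (by linarith)
  have hev := hcont.tendsto.eventually (lt_mem_nhds hval)
  obtain ⟨U, hU, hUS⟩ := mem_nhdsWithin_iff_exists_mem_nhds_inter.1 hev
  refine ⟨U ∩ {p | p.2 < δ / 4}, inter_mem hU ?_, fun p hp hj => ?_⟩
  · exact (isOpen_lt continuous_snd continuous_const).mem_nhds (by simp [pN, hδ0])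
  · obtain ⟨-, hz, -⟩ := hj.right_mem
    have hp4 : p.2 < δ / 4 := hp.2
    have hpδ : p.2 < δ := by linarith
    refine ⟨hpδ, H.mem_of_joined D hδ (Λ := fun p => σ * logEnergy P p) htot hbet hΛ
      (show δ / 2 < 3 * δ / 4 by linarith) hz3.2 (hanti hz1 hz3 (by linarith)) hj ?_⟩
    refine (hUS ⟨hp.1, trivial, hz.le, hpδ⟩ :).trans_le ?_
    have := (hanti ⟨hz, hpδ⟩ hz2 hp4).le
    simp only [logEnergy] at this ⊢
    linarith

/-- Near `p_N`, the orbit of an invariant graph without equilibria is the graph. -/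
theorem locally_eq (D : PlanarData w g N ε) (hδ : δ ≤ ε) (hne : ∀ z ∈ Set.Ioo 0 δ, h z ≠ 0) :
    ∃ U ∈ 𝓝 (pN N), insert (pN N)
      {q | Joined (planarField w g N) (strip ε) (h (δ / 2), δ / 2) q} ∩ U
        = {p | p.2 ∈ Set.Ico 0 δ ∧ p.1 = h p.2} ∩ U := by
  obtain ⟨P, hP⟩ := D.exists_primitive
  have hδ0 := H.pos
  obtain ⟨U, hU, key⟩ : ∃ U ∈ 𝓝 (pN N), ∀ p ∈ U,
      Joined (planarField w g N) (strip ε) (h (δ / 2), δ / 2) p → p.2 < δ ∧ p.1 = h p.2 := by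
    rcases H.sign hne with hs | hs
    · refine H.locally_eq_of_sign D hδ hP (σ := 1) (R := (· ≤ ·)) (fun z hz => by
        rw [one_mul]; exact hs z hz) le_total (fun s t τ hτ hts => ?_) fun γ s t hγ hst => ?_
      · rw [Set.uIcc_of_ge hts] at hτ; exact hτ.2
      · rw [one_mul, one_mul]; exact D.logEnergy_antitone hP hγ hst
    · refine H.locally_eq_of_sign D hδ hP (σ := -1) (R := (· ≥ ·)) (fun z hz => by
        linarith [hs z hz]) (fun s t => le_total t s) (fun s t τ hτ hts => ?_)
        fun γ s t hγ hst => ?_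
      · rw [Set.uIcc_of_le hts] at hτ; exact hτ.1
      · rw [Set.uIcc_comm] at hγ
        linarith [D.logEnergy_antitone hP hγ hst]
  refine ⟨U, hU, Set.ext fun p => ⟨?_, ?_⟩⟩
  · rintro ⟨rfl | hp, hpU⟩
    · exact ⟨⟨⟨le_rfl, hδ0⟩, H.h_zero.symm⟩, hpU⟩
    · obtain ⟨h1, h2⟩ := key p hpU hp
      exact ⟨⟨⟨hp.right_mem.2.1.le, h1⟩, h2⟩, hpU⟩
  · rintro ⟨⟨⟨h1, h2⟩, h3⟩, hpU⟩
    refine ⟨?_, hpU⟩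
    rcases h1.eq_or_lt with h0 | h0
    · left
      exact Prod.ext (by rw [h3, ← h0, H.h_zero]; rfl) h0.symm
    · right
      have := H.joined D hδ hne (z₁ := δ / 2) ⟨by linarith, by linarith⟩ ⟨h0, h2⟩
      rwa [show (h p.2, p.2) = p from Prod.ext h3.symm rfl] at this

end InvGraph

/-! ### Admissible coordinates -/

namespace IsAdmissibleCoordinate

variable {V f : ℝ → ℝ} {N φ₀ : ℝ} (hf : IsAdmissibleCoordinate 2 V N f φ₀)
include hf

theorem apply_mem {φ : ℝ} (h : φ₀ ≤ φ) : f φ ∈ Set.Ioc 0 (f φ₀) :=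
  hf.onto ▸ Set.mem_image_of_mem f h

theorem exists_eq {z : ℝ} (hz : z ∈ Set.Ioc 0 (f φ₀)) : ∃ φ, φ₀ ≤ φ ∧ f φ = z := by
  rw [← hf.onto] at hz
  exact hz

theorem bar_apply (k : ℝ → ℝ) {φ : ℝ} (h : φ₀ ≤ φ) : bar f φ₀ k (f φ) = k φ := by
  rw [bar, if_pos (hf.apply_mem h).1]
  congr 1
  exact hf.strictAntiOn.injOn.leftInvOn_invFunOn h

theorem tendsto_bar_zero {k : ℝ → ℝ} (hk : ContinuousOn (bar f φ₀ k) (Set.Icc 0 (f φ₀))) :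
    Tendsto k atTop (𝓝 (bar f φ₀ k 0)) := by
  have h0 : (0 : ℝ) ∈ Set.Icc 0 (f φ₀) := ⟨le_rfl, (hf.apply_mem le_rfl).1.le⟩
  have h1 : Tendsto f atTop (𝓝[Set.Icc 0 (f φ₀)] 0) := by
    refine tendsto_nhdsWithin_iff.2 ⟨hf.tendsto, ?_⟩
    filter_upwards [eventually_ge_atTop φ₀] with φ h
    exact Set.Ioc_subset_Icc_self (hf.apply_mem h)
  refine ((hk 0 h0).tendsto.comp h1).congr' ?_
  filter_upwards [eventually_ge_atTop φ₀] with φ h using hf.bar_apply k h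

theorem hasDerivWithinAt {φ : ℝ} (h : φ₀ ≤ φ) :
    HasDerivWithinAt f (fbar f φ₀ (f φ)) (Set.Ici φ₀) φ := by
  rw [fbar, hf.bar_apply _ h]
  exact (hf.contDiffOn.differentiableOn (by simp) φ h).hasDerivWithinAt

theorem hasDerivAt {φ : ℝ} (h : φ₀ < φ) : HasDerivAt f (fbar f φ₀ (f φ)) φ :=
  (hf.hasDerivWithinAt h.le).hasDerivAt (Ici_mem_nhds h)

/-- Unit increments of f tend to 0 and are values of f' by the mean value theorem, so the limit of
f' at infinity is 0. -/
theorem fbar_zero : fbar f φ₀ 0 = 0 := by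
  have h1 := hf.tendsto_bar_zero hf.contDiffOn_fbar.continuousOn
  have hmvt : ∀ φ, ∃ ξ, φ₀ < φ → φ < ξ ∧ fbar f φ₀ (f ξ) = f (φ + 1) - f φ := by
    intro φ
    by_cases h : φ₀ < φ
    · obtain ⟨ξ, hξ, he⟩ := exists_hasDerivAt_eq_slope f (fun x => fbar f φ₀ (f x))
        (show φ < φ + 1 by linarith)
        (fun x hx => (hf.hasDerivAt (h.trans_le hx.1)).continuousAt.continuousWithinAt)
        (fun x hx => hf.hasDerivAt (h.trans hx.1))
      exact ⟨ξ, fun _ => ⟨hξ.1, by rw [he]; ring⟩⟩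
    · exact ⟨0, fun h' => absurd h' h⟩
  choose ξ hξ using hmvt
  have hξt : Tendsto ξ atTop atTop := by
    refine tendsto_atTop_mono' atTop ?_ tendsto_id
    filter_upwards [eventually_gt_atTop φ₀] with φ h using (hξ φ h).1.le
  have h2 : Tendsto (fun φ => f (φ + 1) - f φ) atTop (𝓝 (0 - 0)) :=
    (hf.tendsto.comp (tendsto_atTop_add_const_right atTop 1 tendsto_id)).sub hf.tendsto
  rw [sub_self] at h2
  refine tendsto_nhds_unique ((h1.comp hξt).congr' ?_) h2
  filter_upwards [eventually_gt_atTop φ₀] with φ h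
  rw [← (hξ φ h).2, Function.comp, fbar, hf.bar_apply _ (h.trans (hξ φ h).1).le]

/-- f solves the autonomous equation f' = f̄'(f) with Lipschitz right-hand side. A zero of f̄' at
some z > 0 would be an equilibrium and keep f constant, contradicting strict monotonicity. -/
theorem fbar_neg {z : ℝ} (hz : z ∈ Set.Ioc 0 (f φ₀)) : fbar f φ₀ z < 0 := by
  obtain ⟨φ, hφ, rfl⟩ := hf.exists_eq hz
  refine lt_of_le_of_ne ?_ fun h0 => ?_
  · rw [fbar, hf.bar_apply _ hφ]
    exact hf.strictAntiOn.antitoneOn.derivWithin_nonpos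
  · obtain ⟨K, hK⟩ := hf.contDiffOn_fbar.exists_lipschitzOnWith (by norm_num) (convex_Icc _ _)
      isCompact_Icc
    have hle : φ ≤ φ + 1 := by linarith
    have hsub : Set.uIcc φ (φ + 1) ⊆ Set.Ici φ₀ := by
      rw [Set.uIcc_of_le hle]; exact fun x hx => hφ.trans hx.1
    have := eqOn_zero_of_norm_deriv_le (C := K) (u := fun x => f x - f φ)
      (fun x hx => ((hf.hasDerivWithinAt (hsub hx)).mono hsub).sub_const _) (fun x hx => by
        have h1 := hK.dist_le_mul _ (Set.Ioc_subset_Icc_self (hf.apply_mem (hsub hx))) _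
          (Set.Ioc_subset_Icc_self hz)
        rwa [h0, dist_zero_right, dist_eq_norm] at h1) (sub_self _) _ Set.right_mem_uIcc
    have hlt := hf.strictAntiOn hφ (show φ₀ ≤ φ + 1 by linarith) (show φ < φ + 1 by linarith)
    linarith

theorem Wbar_add {φ : ℝ} (h : φ₀ ≤ φ) : Wbar V N f φ₀ (f φ) + N = deriv V φ / V φ := by
  rw [Wbar, hf.bar_apply _ h, W]; ring

theorem Wbar_add_eq_zero_iff {φ : ℝ} (h : φ₀ ≤ φ) :
    Wbar V N f φ₀ (f φ) + N = 0 ↔ deriv V φ = 0 := by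
  rw [hf.Wbar_add h, div_eq_zero_iff, or_iff_left (hf.V_pos φ h).ne']

theorem planarData (hV : IsWBI V N) (hN : N ^ 2 < 6) :
    PlanarData (Wbar V N f φ₀) (fbar f φ₀) N (f φ₀) where
  pos := (hf.apply_mem le_rfl).1
  sq_lt := hN
  contDiffOn_w := hf.contDiffOn_Wbar
  contDiffOn_g := hf.contDiffOn_fbar
  w_zero := tendsto_nhds_unique (hf.tendsto_bar_zero hf.contDiffOn_Wbar.continuousOn) hV.2.2.2
  g_zero := hf.fbar_zero
  deriv_w := hf.deriv_Wbar
  deriv_g := hf.deriv_fbar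
  g_neg _ hz := hf.fbar_neg hz

theorem exists_ne_zero (h : ∀ᶠ φ in atTop, deriv V φ ≠ 0) :
    ∃ δ, 0 < δ ∧ ∀ z ∈ Set.Ioo 0 δ, Wbar V N f φ₀ z + N ≠ 0 := by
  obtain ⟨Φ, hΦ⟩ := eventually_atTop.1 (h.and (eventually_ge_atTop φ₀))
  have hΦ0 := (hΦ Φ le_rfl).2
  refine ⟨f Φ, (hf.apply_mem hΦ0).1, fun z hz => ?_⟩
  obtain ⟨φ, hφ, rfl⟩ := hf.exists_eq ⟨hz.1, hz.2.le.trans (hf.apply_mem hΦ0).2⟩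
  rw [Ne, hf.Wbar_add_eq_zero_iff hφ]
  refine (hΦ φ ?_).1
  by_contra hlt
  exact absurd hz.2 (not_lt.2 (hf.strictAntiOn.antitoneOn hφ hΦ0 (not_le.1 hlt).le))

end IsAdmissibleCoordinate

/-! ### Past-asymptotic solutions cover an invariant graph -/

/-- The solution is eventually on the graph and its z tends to 0, so by the intermediate value
theorem it takes every small z > 0. -/
theorem InvGraph.exists_eq {w g h h' : ℝ → ℝ} {N ε δ : ℝ} (H : InvGraph w g N δ h h')
    (D : PlanarData w g N ε) (hδ : δ ≤ ε) {T : ℝ} {γ : ℝ → ℝ × ℝ}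
    (hγ : IsSolutionOn (planarField w g N) (strip ε) (Set.Iic T) γ)
    (hlim : Tendsto γ atBot (𝓝 (pN N))) :
    ∃ z₀ > 0, ∀ z ∈ Set.Ioc 0 z₀, ∃ τ ≤ T, γ τ = (h z, z) := by
  obtain ⟨T₁, hT₁⟩ := eventually_atBot.1
    ((H.eventually_mem D hδ (hγ.mono (strip_subset ε) le_rfl) hlim).and (eventually_le_atBot T))
  have hT : T₁ ≤ T := (hT₁ T₁ le_rfl).2
  refine ⟨(γ T₁).2, (hγ T₁ hT).1.2.1, fun z hz => ?_⟩
  have hz0 : Tendsto (fun τ => (γ τ).2) atBot (𝓝 0) := (continuous_snd.tendsto _).comp hlim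
  obtain ⟨τ₂, h2, hτ₂⟩ :=
    ((hz0.eventually (gt_mem_nhds hz.1)).and (eventually_le_atBot T₁)).exists
  obtain ⟨τ, hτ, rfl⟩ := intermediate_value_Icc hτ₂ ((continuous_snd.comp_continuousOn
    hγ.continuousOn).mono fun τ hτ => hτ.2.trans hT) ⟨h2.le, hz.2⟩
  exact ⟨τ, hτ.2.trans hT, Prod.ext (hT₁ τ hτ.2).1.2 rfl⟩

/-- If `V'` has arbitrarily large zeros, the equilibria accumulate at `p_N` and block all
past-asymptotic solutions. -/
theorem no_pastAsymptotic {V f : ℝ → ℝ} {N φ₀ : ℝ} (hf : IsAdmissibleCoordinate 2 V N f φ₀)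
    (hV : IsWBI V N) (hN : N ^ 2 < 6) (hfreq : ∃ᶠ φ in atTop, deriv V φ = 0) {T : ℝ}
    {γ : ℝ → ℝ × ℝ} (hγ : IsPastAsymptotic V N f φ₀ (phaseSpace f φ₀) T γ) : False := by
  have D := hf.planarData hV hN
  obtain ⟨hγ, hlim⟩ := hγ
  -- W = -N at zeros of V', while W → 0.
  have hN0 : N = 0 := by
    by_contra hne
    obtain ⟨φ, h1, h2⟩ :=
      (hfreq.and_eventually (hV.2.2.2.eventually_ne (neg_ne_zero.2 hne).symm)).exists
    exact h2 (by rw [W, h1, zero_div, zero_sub])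
  obtain ⟨δ, h, h', hδ, H⟩ := D.exists_invGraph
  obtain ⟨z₀, hz₀, hcov⟩ := H.exists_eq D hδ.le hγ hlim
  have h0 : (0 : ℝ) ∈ Set.Ico 0 δ := ⟨le_rfl, H.pos⟩
  have hcont : ContinuousWithinAt
      (fun z => √(2 / 3) * fbar f φ₀ z * h' z + (1 - h z ^ 2)) (Set.Ico 0 δ) 0 :=
    ((continuousWithinAt_const.mul ((D.contDiffOn_g.continuousOn 0 ⟨le_rfl, D.pos.le⟩).mono
      fun z hz => ⟨hz.1, hz.2.le.trans hδ.le⟩)).mul (H.cont 0 h0)).add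
      (continuousWithinAt_const.sub ((H.continuousOn 0 h0).pow 2))
  have hev : ∀ᶠ z in 𝓝[Set.Ico 0 δ] 0, 0 < √(2 / 3) * fbar f φ₀ z * h' z + (1 - h z ^ 2) := by
    refine hcont.tendsto.eventually (lt_mem_nhds ?_)
    rw [H.h_zero, H.deriv_zero, hN0]; simp
  have hft : Tendsto f atTop (𝓝[Set.Ico 0 δ] 0) := by
    refine tendsto_nhdsWithin_iff.2 ⟨hf.tendsto, ?_⟩
    filter_upwards [hf.tendsto.eventually (gt_mem_nhds H.pos), eventually_ge_atTop φ₀] with φ h1 h2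
    exact ⟨(hf.apply_mem h2).1.le, h1⟩
  obtain ⟨φ, hφ1, ⟨⟨⟨hφ2, hφ3⟩, hφ4⟩, hφ5⟩⟩ := (hfreq.and_eventually
    (((hft.eventually hev).and (hf.tendsto.eventually (gt_mem_nhds hz₀))).and
      (hf.tendsto.eventually (gt_mem_nhds H.pos)) |>.and (eventually_ge_atTop φ₀))).exists
  have hw := (hf.Wbar_add_eq_zero_iff hφ5).2 hφ1
  have hz := hf.apply_mem hφ5
  have heq := H.eq (f φ) ⟨hz.1.le, hφ4⟩
  rw [hw, mul_zero, add_zero] at heq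
  have hh : h (f φ) = 0 := by
    -- Where V' = 0 the invariance equation has the factor h, and the other factor is close to 1
    -- near z = 0; so the graph passes through the equilibrium (0, f φ).
    have : h (f φ) * (√(2 / 3) * fbar f φ₀ (f φ) * h' (f φ) + (1 - h (f φ) ^ 2)) = 0 := by
      linear_combination heq
    exact (mul_eq_zero.1 this).resolve_right hφ2.ne'
  obtain ⟨τ, hτ, hγτ⟩ := hcov (f φ) ⟨hz.1, hφ3.le⟩
  rw [hh] at hγτ
  have hfield : planarField (Wbar V N f φ₀) (fbar f φ₀) N (0, f φ) = 0 := by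
    simp [planarField, hw]
  have hmem : ((0 : ℝ), f φ) ∈ extStrip (f φ₀) := ⟨by simp, hz.1.le, hφ4.trans hδ⟩
  have hconst : ∀ σ ≤ T, γ σ = (0, f φ) := fun σ hσ =>
    D.eqOn (IsSolutionOn.mono hγ (strip_subset _) fun ρ hρ => hρ.2.trans (max_le hτ hσ))
      (isSolutionOn_const _ hmem hfield) hγτ σ Set.right_mem_uIcc
  have hz0 : Tendsto (fun τ => (γ τ).2) atBot (𝓝 0) := (continuous_snd.tendsto _).comp hlim
  have : Tendsto (fun τ => (γ τ).2) atBot (𝓝 (f φ)) := by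
    refine tendsto_const_nhds.congr' ?_
    filter_upwards [eventually_le_atBot T] with σ hσ
    rw [hconst σ hσ]
  exact hz.1.ne (tendsto_nhds_unique hz0 this)

/-! ### Reparametrisation of cosmologies -/

/-- The inverse of an increasing differentiable function on an open interval. -/
theorem exists_inverse {I : Set ℝ} (hI : IsOpen I) {θ θ' : ℝ → ℝ} {b : ℝ}
    (hθ : ∀ t ∈ I, HasDerivAt θ (θ' t) t) (hpos : ∀ t ∈ I, 0 < θ' t) (hc : Convex ℝ I)
    (hb : b ∈ I) (hunb : ∀ B, ∃ t ∈ I, t ≤ b ∧ θ t ≤ B) :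
    StrictMonoOn θ I ∧ ∃ T : ℝ → ℝ, ∀ τ < θ b,
      T τ ∈ I ∧ T τ < b ∧ θ (T τ) = τ ∧ HasDerivAt T (θ' (T τ))⁻¹ τ := by
  have hmono : StrictMonoOn θ I := strictMonoOn_of_hasDerivWithinAt_pos hc
    (fun t ht => (hθ t ht).continuousAt.continuousWithinAt)
    (fun t ht => (hθ t (interior_subset ht)).hasDerivWithinAt)
    fun t ht => hpos t (interior_subset ht)
  refine ⟨hmono, ?_⟩
  have hex : ∀ τ, ∃ t, τ < θ b → t ∈ I ∧ t < b ∧ θ t = τ := by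
    intro τ
    by_cases hτ : τ < θ b
    · obtain ⟨s, hs, hsb, hle⟩ := hunb τ
      have hsub : Set.Icc s b ⊆ I := hc.ordConnected.out hs hb
      obtain ⟨t, ht, rfl⟩ := intermediate_value_Icc hsb
        (fun t ht => (hθ t (hsub ht)).continuousAt.continuousWithinAt) ⟨hle, hτ.le⟩
      exact ⟨t, fun _ => ⟨hsub ht, (hmono.lt_iff_lt (hsub ht) hb).1 hτ, rfl⟩⟩
    · exact ⟨0, fun h => absurd h hτ⟩
  choose T hT using hex
  refine ⟨T, fun τ hτ => ?_⟩
  obtain ⟨h1, h2, h3⟩ := hT τ hτ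
  refine ⟨h1, h2, h3, ?_⟩
  have hTmono : MonotoneOn T (Set.Iio (θ b)) := fun σ hσ ρ hρ hle => by
    rw [← hmono.le_iff_le (hT σ hσ).1 (hT ρ hρ).1, (hT σ hσ).2.2, (hT ρ hρ).2.2]
    exact hle
  have himg : T '' Set.Iio (θ b) ∈ 𝓝 (T τ) := by
    filter_upwards [hI.mem_nhds h1, Iio_mem_nhds h2] with t ht htb
    have hlt : θ t < θ b := hmono ht hb htb
    exact ⟨θ t, hlt, hmono.injOn (hT _ hlt).1 ht (hT _ hlt).2.2⟩
  refine HasDerivAt.of_local_left_inverse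
    (continuousAt_of_monotoneOn_of_image_mem_nhds hTmono (Iio_mem_nhds hτ) himg) (hθ _ h1)
    (hpos _ h1).ne' ?_
  filter_upwards [Iio_mem_nhds hτ] with σ hσ using (hT σ hσ).2.2

section

variable {V f : ℝ → ℝ} {N φ₀ : ℝ} {I : Set ℝ} {φ ψ K : ℝ → ℝ}

/-- The trace of a cosmology in the `(y, z)`-plane. -/
noncomputable def trace (f φ ψ K : ℝ → ℝ) (t : ℝ) : ℝ × ℝ := (yCoord ψ K t, f (φ t))

theorem sqrt_three_halves : √(3 / 2) = 3 * (1 / √6) := by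
  rw [mul_one_div, eq_div_iff (by positivity), ← Real.sqrt_mul (by norm_num),
    show (3 / 2 * 6 : ℝ) = 3 ^ 2 by norm_num]
  exact Real.sqrt_sq (by norm_num)

theorem inv_sqrt_six_sq : (1 / √6 : ℝ) ^ 2 = 1 / 6 := by
  rw [div_pow, one_pow, Real.sq_sqrt (by norm_num)]

theorem IsCosmology.one_sub_yCoord_sq (hc : IsCosmology V I φ ψ K) {t : ℝ} (ht : t ∈ I) :
    1 - yCoord ψ K t ^ 2 = 3 * V (φ t) / K t ^ 2 := by
  have hK := (hc.K_pos t ht).ne'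
  rw [yCoord, div_pow, mul_pow, Real.sq_sqrt (by norm_num), eq_div_iff (by positivity), sub_mul,
    div_mul_cancel₀ _ (by positivity), hc.constraint t ht]
  ring

theorem IsCosmology.hasDerivAt_trace (hc : IsCosmology V I φ ψ K)
    (hf : IsAdmissibleCoordinate 2 V N f φ₀) {t : ℝ} (ht : t ∈ I) (hφ : φ₀ < φ t) :
    HasDerivAt (trace f φ ψ K)
      (K t • planarField (Wbar V N f φ₀) (fbar f φ₀) N (trace f φ ψ K t)) t := by
  have hK := (hc.K_pos t ht).ne'
  have hV := (hf.V_pos _ hφ.le).ne'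
  have h6 := inv_sqrt_six_sq
  have hy := hc.one_sub_yCoord_sq ht
  have hcon := hc.constraint t ht
  have d1 : HasDerivAt (yCoord ψ K) (K t * (-(yCoord ψ K t + 1 / √6 *
      (Wbar V N f φ₀ (f (φ t)) + N)) * (1 - yCoord ψ K t ^ 2))) t := by
    refine ((((hc.deriv_ψ t ht).const_mul (√(3 / 2))).div (hc.deriv_K t ht) hK)).congr_deriv ?_
    rw [hy, hf.Wbar_add hφ.le, yCoord, sqrt_three_halves]
    field_simp
    linear_combination (-2 * ψ t) * hcon
  have d2 : HasDerivAt (fun t => f (φ t))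
      (K t * (√(2 / 3) * fbar f φ₀ (f (φ t)) * yCoord ψ K t)) t := by
    refine ((hf.hasDerivAt hφ).comp t (hc.deriv_φ t ht)).congr_deriv ?_
    rw [yCoord, sqrt_three_halves, sqrt_two_thirds]
    set k : ℝ := 1 / √6
    field_simp
    linear_combination (-6 * (fbar f φ₀ (f (φ t)) * ψ t)) * h6
  exact d1.prodMk d2

theorem IsCosmology.trace_mem (hc : IsCosmology V I φ ψ K)
    (hf : IsAdmissibleCoordinate 2 V N f φ₀) {t : ℝ} (ht : t ∈ I) (hφ : φ₀ < φ t) :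
    trace f φ ψ K t ∈ strip (f φ₀) := by
  have hy := hc.one_sub_yCoord_sq ht
  have h1 : 0 < 3 * V (φ t) / K t ^ 2 := by
    have := hc.K_pos t ht
    have := hf.V_pos _ hφ.le
    positivity
  have h2 : yCoord ψ K t ^ 2 < 1 := by linarith
  exact ⟨abs_lt.1 ((sq_lt_one_iff_abs_lt_one _).1 h2), (hf.apply_mem hφ.le).1,
    hf.strictAntiOn (Set.mem_Ici.2 le_rfl) hφ.le hφ⟩

/-- A cosmology which originates at `p_N` traces out a past-asymptotic solution. -/
theorem IsCosmology.exists_pastAsymptotic (hc : IsCosmology V I φ ψ K)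
    (ho : OriginatesAtPN N I φ ψ K) (hf : IsAdmissibleCoordinate 2 V N f φ₀)
    (D : PlanarData (Wbar V N f φ₀) (fbar f φ₀) N (f φ₀)) :
    ∃ γ : ℝ → ℝ × ℝ, ∃ t₀ ∈ I,
      IsSolutionOn (planarField (Wbar V N f φ₀) (fbar f φ₀) N) (strip (f φ₀)) (Set.Iic 0) γ ∧
      Tendsto γ atBot (𝓝 (pN N)) ∧
      (∀ t ∈ I, t ≤ t₀ → φ₀ < φ t ∧ ∃ τ ≤ 0, γ τ = trace f φ ψ K t) ∧
      ∀ τ ≤ 0, ∃ t ∈ I, t ≤ t₀ ∧ γ τ = trace f φ ψ K t := by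
  have : Nonempty I := hc.nonempty.to_subtype
  have hconv : Convex ℝ I := hc.ordConnected.convex
  obtain ⟨⟨t₁, ht₁⟩, hφ'⟩ := eventually_atBot.1 (ho.1.eventually (eventually_gt_atTop φ₀))
  have hφ : ∀ t ∈ I, t ≤ t₁ → φ₀ < φ t := fun t ht hle => hφ' ⟨t, ht⟩ hle
  -- Strictly earlier than t₁, so that the inverse of θ is defined on a neighbourhood of (-∞, 0].
  obtain ⟨t₀, ht₀, h01⟩ : ∃ t₀ ∈ I, t₀ < t₁ := by
    obtain ⟨e, he, hball⟩ := Metric.isOpen_iff.1 hc.isOpen t₁ ht₁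
    exact ⟨t₁ - e / 2, hball (by rw [Metric.mem_ball, Real.dist_eq]; rw [abs_lt]
                                 constructor <;> linarith), by linarith⟩
  have hKc : ContinuousOn K I := fun t ht => (hc.deriv_K t ht).continuousAt.continuousWithinAt
  set θ : ℝ → ℝ := fun t => ∫ x in t₀..t, K x with hθdef
  have hθ : ∀ t ∈ I, HasDerivAt θ (K t) t := fun t ht =>
    intervalIntegral.integral_hasDerivAt_right
      (hKc.mono (hc.ordConnected.uIcc_subset ht₀ ht)).intervalIntegrable
      (hKc.stronglyMeasurableAtFilter hc.isOpen t ht) (hKc.continuousAt (hc.isOpen.mem_nhds ht))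
  have hθ0 : θ t₀ = 0 := by simp [hθdef]
  have htr := fun t (ht : t ∈ I) (hle : t ≤ t₁) => hc.hasDerivAt_trace hf ht (hφ t ht hle)
  have hmem := fun t (ht : t ∈ I) (hle : t ≤ t₁) => hc.trace_mem hf ht (hφ t ht hle)
  have hzlim : Tendsto (fun t : I => f (φ t)) atBot (𝓝 0) := hf.tendsto.comp ho.1
  -- As f̄'(z) = O(z), log z changes at a bounded rate in τ; it tends to -∞ towards the beginning,
  -- so τ must as well.
  have hunb : ∀ B, ∃ t ∈ I, t ≤ t₁ ∧ θ t ≤ B := by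
    intro B
    obtain ⟨C, hC⟩ := D.contDiffOn_g.exists_lipschitzOnWith (by norm_num) (convex_Icc _ _)
      isCompact_Icc
    set C' : ℝ := C + 1
    have hC' : 0 < C' := by positivity
    have hsub : Set.Iic t₀ ∩ I ⊆ I := Set.inter_subset_right
    have hd : ∀ t ∈ Set.Iic t₀ ∩ I, HasDerivAt (fun t => Real.log (f (φ t)) - C' * θ t)
        (K t * (√(2 / 3) * fbar f φ₀ (f (φ t)) * yCoord ψ K t) / f (φ t) - C' * K t) t := by
      intro t ht
      have hle : t ≤ t₁ := ht.1.trans h01.le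
      have hz := (hmem t ht.2 hle).2.1
      have h1 := (ContinuousLinearMap.snd ℝ ℝ ℝ).hasFDerivAt.comp_hasDerivAt t (htr t ht.2 hle)
      exact (HasDerivAt.log h1 hz.ne').sub ((hθ t ht.2).const_mul C')
    have hanti : AntitoneOn (fun t => Real.log (f (φ t)) - C' * θ t) (Set.Iic t₀ ∩ I) := by
      refine antitoneOn_of_hasDerivWithinAt_nonpos ((convex_Iic t₀).inter hconv)
        (fun t ht => (hd t ht).continuousAt.continuousWithinAt)
        (fun t ht => (hd t (interior_subset ht)).hasDerivWithinAt) fun t ht => ?_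
      replace ht := interior_subset ht
      have hle : t ≤ t₁ := ht.1.trans h01.le
      obtain ⟨hy, hz0, hzε⟩ := hmem t ht.2 hle
      have hy' : |yCoord ψ K t| ≤ 1 := (abs_lt.2 hy).le
      have h1 := hC.dist_le_mul _ ⟨hz0.le, hzε.le⟩ 0 ⟨le_rfl, D.pos.le⟩
      rw [D.g_zero, dist_zero_right, dist_zero_right] at h1
      have hz0' : 0 < f (φ t) := hz0
      have h2 : ‖f (φ t)‖ = f (φ t) := Real.norm_of_nonneg hz0'.le
      have h3 : ‖fbar f φ₀ (f (φ t))‖ ≤ C' * f (φ t) := by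
        calc _ ≤ C * ‖f (φ t)‖ := h1
          _ ≤ C' * f (φ t) := by rw [h2]; gcongr; simp [C']
      have h4 : √(2 / 3) * fbar f φ₀ (f (φ t)) * yCoord ψ K t ≤ C' * f (φ t) := by
        refine (le_abs_self _).trans ?_
        rw [abs_mul, abs_mul, abs_of_nonneg (Real.sqrt_nonneg _)]
        calc √(2 / 3) * |fbar f φ₀ (f (φ t))| * |yCoord ψ K t|
            ≤ 1 * (C' * f (φ t)) * 1 := by
              gcongr
              · exact sqrt_two_thirds_le_one
              · exact h3
          _ = _ := by ring
      rw [sub_nonpos, div_le_iff₀ hz0']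
      nlinarith [hc.K_pos t ht.2]
    obtain ⟨s, hs, hs0⟩ := ((hzlim.eventually (gt_mem_nhds
      (Real.exp_pos (Real.log (f (φ t₀)) + C' * B)))).and
        (eventually_le_atBot (⟨t₀, ht₀⟩ : I))).exists
    have hs0' : (s : ℝ) ≤ t₀ := hs0
    refine ⟨s, s.2, hs0'.trans h01.le, ?_⟩
    have h1 := hanti ⟨hs0', s.2⟩ ⟨Set.mem_Iic.2 le_rfl, ht₀⟩ hs0'
    have h2 : Real.log (f (φ s)) < Real.log (f (φ t₀)) + C' * B := by
      have hpos : 0 < f (φ s) := (hmem s s.2 (hs0'.trans h01.le)).2.1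
      exact (Real.log_lt_iff_lt_exp hpos).2 hs
    simp only [hθ0, mul_zero, sub_zero] at h1
    nlinarith
  obtain ⟨hmono, T, hT⟩ := exists_inverse hc.isOpen hθ hc.K_pos hconv ht₁ hunb
  have h0lt : 0 < θ t₁ := by rw [← hθ0]; exact hmono ht₀ ht₁ h01
  have hTle : ∀ τ ≤ 0, T τ ≤ t₀ := fun τ hτ => by
    obtain ⟨h1, -, h3, -⟩ := hT τ (hτ.trans_lt h0lt)
    rw [← hmono.le_iff_le h1 ht₀, h3, hθ0]; exact hτ
  refine ⟨fun τ => trace f φ ψ K (T τ), t₀, ht₀, fun τ hτ => ?_, ?_, fun t ht hle => ?_,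
    fun τ hτ => ⟨T τ, (hT τ (hτ.trans_lt h0lt)).1, hTle τ hτ, rfl⟩⟩
  · obtain ⟨h1, h2, h3, h4⟩ := hT τ (lt_of_le_of_lt hτ h0lt)
    refine ⟨hmem _ h1 h2.le, ?_⟩
    have := ((htr _ h1 h2.le).scomp τ h4).hasDerivWithinAt (s := Set.Iic 0)
    rwa [smul_smul, inv_mul_cancel₀ (hc.K_pos _ h1).ne', one_smul] at this
  · have hlim : Tendsto (fun t : I => trace f φ ψ K t) atBot (𝓝 (pN N)) :=
      ho.2.prodMk_nhds hzlim
    intro U hU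
    obtain ⟨s, hs⟩ := eventually_atBot.1 (hlim hU)
    change ∀ᶠ τ in atBot, trace f φ ψ K (T τ) ∈ U
    filter_upwards [eventually_lt_atBot (θ t₁), eventually_le_atBot (θ s)] with τ h1 h2
    obtain ⟨h3, -, h5, -⟩ := hT τ h1
    refine hs ⟨T τ, h3⟩ ?_
    change T τ ≤ s
    rw [← hmono.le_iff_le h3 s.2, h5]
    exact h2
  · refine ⟨hφ t ht (hle.trans h01.le), θ t, ?_, ?_⟩
    · rw [← hθ0]; exact hmono.monotoneOn ht ht₀ hle
    · have hlt : θ t < θ t₁ := hmono ht ht₁ (hle.trans_lt h01)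
      obtain ⟨h1, -, h3, -⟩ := hT _ hlt
      simp only
      rw [hmono.injOn h1 ht h3]

end

/-! ### Uniqueness of cosmologies -/

/-- Both solutions stay in a closed ball on the compact time interval, and there F is Lipschitz. -/
theorem eqOn_of_contDiff {E : Type*} [NormedAddCommGroup E] [NormedSpace ℝ E]
    [FiniteDimensional ℝ E] {F : E → E} (hF : ContDiff ℝ 1 F) {s t : ℝ} {u v : ℝ → E}
    (hu : ∀ τ ∈ Set.uIcc s t, HasDerivWithinAt u (F (u τ)) (Set.uIcc s t) τ)
    (hv : ∀ τ ∈ Set.uIcc s t, HasDerivWithinAt v (F (v τ)) (Set.uIcc s t) τ) (h : u s = v s) :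
    ∀ τ ∈ Set.uIcc s t, u τ = v τ := by
  have := FiniteDimensional.proper_real E
  obtain ⟨A, hA⟩ := isCompact_uIcc.exists_bound_of_continuousOn
    (fun τ hτ => (hu τ hτ).continuousWithinAt)
  obtain ⟨B, hB⟩ := isCompact_uIcc.exists_bound_of_continuousOn
    (fun τ hτ => (hv τ hτ).continuousWithinAt)
  obtain ⟨C, hC⟩ := hF.contDiffOn.exists_lipschitzOnWith (by norm_num)
    (convex_closedBall (0 : E) (max A B)) (isCompact_closedBall _ _)
  intro τ hτ
  refine sub_eq_zero.1 (eqOn_zero_of_norm_deriv_le (C := C) (u := fun τ => u τ - v τ)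
    (fun τ hτ => (hu τ hτ).sub (hv τ hτ)) (fun τ hτ => ?_) (sub_eq_zero.2 h) τ hτ)
  rw [← dist_eq_norm, ← dist_eq_norm]
  exact hC.dist_le_mul _ (mem_closedBall_zero_iff.2 ((hA τ hτ).trans (le_max_left _ _))) _
    (mem_closedBall_zero_iff.2 ((hB τ hτ).trans (le_max_right _ _)))

section

variable {V : ℝ → ℝ} {I₁ I₂ : Set ℝ} {φ₁ ψ₁ K₁ φ₂ ψ₂ K₂ : ℝ → ℝ} {c t₁ : ℝ}

theorem IsCosmology.shift (hc : IsCosmology V I₂ φ₂ ψ₂ K₂) (c : ℝ) :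
    IsCosmology V ((· + c) ⁻¹' I₂) (fun t => φ₂ (t + c)) (fun t => ψ₂ (t + c))
      (fun t => K₂ (t + c)) where
  isOpen := hc.isOpen.preimage (continuous_add_const c)
  ordConnected := ⟨fun _ ha _ hb _ hx => hc.ordConnected.out ha hb
    ⟨add_le_add_left hx.1 c, add_le_add_left hx.2 c⟩⟩
  nonempty := by
    obtain ⟨t, ht⟩ := hc.nonempty
    exact ⟨t - c, by simpa using ht⟩
  deriv_φ t ht := (hc.deriv_φ _ ht).comp_add_const t c
  deriv_ψ t ht := (hc.deriv_ψ _ ht).comp_add_const t c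
  deriv_K t ht := (hc.deriv_K _ ht).comp_add_const t c
  constraint t ht := hc.constraint _ ht
  K_pos t ht := hc.K_pos _ ht

theorem IsCosmology.eq (hV : ContDiff ℝ 2 V) (h₁ : IsCosmology V I₁ φ₁ ψ₁ K₁)
    (h₂ : IsCosmology V I₂ φ₂ ψ₂ K₂) (ht₁ : t₁ ∈ I₁) (ht₂ : t₁ ∈ I₂)
    (he : φ₁ t₁ = φ₂ t₁ ∧ ψ₁ t₁ = ψ₂ t₁ ∧ K₁ t₁ = K₂ t₁) {t : ℝ} (h1 : t ∈ I₁) (h2 : t ∈ I₂) :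
    φ₁ t = φ₂ t ∧ ψ₁ t = ψ₂ t ∧ K₁ t = K₂ t := by
  have hV' : ContDiff ℝ 1 (deriv V) := by
    have : ContDiff ℝ (1 + 1) V := by norm_num; exact hV
    exact (contDiff_succ_iff_deriv.1 this).2.2
  set F : ℝ × ℝ × ℝ → ℝ × ℝ × ℝ := fun p =>
    (p.2.1, -p.2.2 * p.2.1 - deriv V p.1, -(3 / 2) * p.2.1 ^ 2)
  have hF : ContDiff ℝ 1 F := by
    have := hV'.comp (contDiff_fst (E := ℝ) (F := ℝ × ℝ))
    simp only [Function.comp_def] at this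
    fun_prop
  have key := eqOn_of_contDiff hF (s := t₁) (t := t)
    (u := fun t => (φ₁ t, ψ₁ t, K₁ t)) (v := fun t => (φ₂ t, ψ₂ t, K₂ t))
    (fun τ hτ => by
      have hτ := h₁.ordConnected.uIcc_subset ht₁ h1 hτ
      exact ((h₁.deriv_φ τ hτ).prodMk ((h₁.deriv_ψ τ hτ).prodMk (h₁.deriv_K τ hτ))).hasDerivWithinAt)
    (fun τ hτ => by
      have hτ := h₂.ordConnected.uIcc_subset ht₂ h2 hτ
      exact ((h₂.deriv_φ τ hτ).prodMk ((h₂.deriv_ψ τ hτ).prodMk (h₂.deriv_K τ hτ))).hasDerivWithinAt)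
    (by simp [he.1, he.2.1, he.2.2]) t Set.right_mem_uIcc
  simpa using key

/-- The past of the first cosmology is contained in that of the second, since `φ → ∞` along the
second. -/
theorem IsCosmology.mem_of_mem (hV : ContDiff ℝ 2 V) (h₁ : IsCosmology V I₁ φ₁ ψ₁ K₁)
    (h₂ : IsCosmology V I₂ φ₂ ψ₂ K₂) (hlim : ∀ B, ∃ s ∈ I₂, ∀ t ∈ I₂, t ≤ s → B < φ₂ t)
    (ht₁ : t₁ ∈ I₁) (ht₂ : t₁ ∈ I₂)
    (he : φ₁ t₁ = φ₂ t₁ ∧ ψ₁ t₁ = ψ₂ t₁ ∧ K₁ t₁ = K₂ t₁) {t : ℝ} (hle : t ≤ t₁) (h1 : t ∈ I₁) :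
    t ∈ I₂ := by
  by_contra hno
  have hsub : Set.Icc t t₁ ⊆ I₁ := h₁.ordConnected.out h1 ht₁
  obtain ⟨B, hB⟩ := isCompact_Icc.exists_bound_of_continuousOn
    (fun τ hτ => (h₁.deriv_φ τ (hsub hτ)).continuousAt.continuousWithinAt :
      ContinuousOn φ₁ (Set.Icc t t₁))
  obtain ⟨s, hs, hsB⟩ := hlim B
  obtain ⟨u, hu, hus, hut⟩ : ∃ u ∈ I₂, u ≤ s ∧ u ≤ t₁ := by
    rcases le_total s t₁ with h | h
    · exact ⟨s, hs, le_rfl, h⟩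
    · exact ⟨t₁, ht₂, h, le_rfl⟩
  -- If t were missing from I₂, all times of I₂ up to t₁ would lie in [t, t₁], where φ₂ agrees with
  -- the bounded φ₁.
  have htu : t ≤ u := by
    by_contra hlt
    exact hno (h₂.ordConnected.out hu ht₂ ⟨(not_le.1 hlt).le, hle⟩)
  have h3 := (h₁.eq hV h₂ ht₁ ht₂ he (hsub ⟨htu, hut⟩) hu).1
  have h4 := hsB u hu hus
  rw [← h3] at h4
  exact absurd ((le_abs_self _).trans (hB u ⟨htu, hut⟩)) (not_le.2 h4)

end

/-- Two cosmologies with the same point in the `(y, z)`-plane have the same field values. -/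
theorem IsCosmology.eq_of_trace_eq {V f : ℝ → ℝ} {N φ₀ : ℝ} {I₁ I₂ : Set ℝ}
    {φ₁ ψ₁ K₁ φ₂ ψ₂ K₂ : ℝ → ℝ} {t₁ t₂ : ℝ} (hf : IsAdmissibleCoordinate 2 V N f φ₀)
    (h₁ : IsCosmology V I₁ φ₁ ψ₁ K₁) (h₂ : IsCosmology V I₂ φ₂ ψ₂ K₂) (ht₁ : t₁ ∈ I₁)
    (ht₂ : t₂ ∈ I₂) (hφ₁ : φ₀ < φ₁ t₁) (hφ₂ : φ₀ < φ₂ t₂)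
    (he : trace f φ₁ ψ₁ K₁ t₁ = trace f φ₂ ψ₂ K₂ t₂) :
    φ₁ t₁ = φ₂ t₂ ∧ ψ₁ t₁ = ψ₂ t₂ ∧ K₁ t₁ = K₂ t₂ := by
  have hy : yCoord ψ₁ K₁ t₁ = yCoord ψ₂ K₂ t₂ := congrArg Prod.fst he
  have hz : φ₁ t₁ = φ₂ t₂ :=
    hf.strictAntiOn.injOn hφ₁.le hφ₂.le (congrArg Prod.snd he)
  have hK1 := h₁.K_pos _ ht₁
  have hK2 := h₂.K_pos _ ht₂
  have e1 := h₁.one_sub_yCoord_sq ht₁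
  have e2 := h₂.one_sub_yCoord_sq ht₂
  have hV := hf.V_pos _ hφ₂.le
  rw [hy, e2, hz, div_eq_div_iff (by positivity) (by positivity)] at e1
  have hKsq : K₁ t₁ ^ 2 = K₂ t₂ ^ 2 :=
    mul_left_cancel₀ (show 3 * V (φ₂ t₂) ≠ 0 by positivity) e1
  have hK : K₁ t₁ = K₂ t₂ := (pow_left_inj₀ hK1.le hK2.le two_ne_zero).1 hKsq
  refine ⟨hz, ?_, hK⟩
  rw [yCoord, yCoord, hK, div_left_inj' hK2.ne'] at hy
  exact mul_left_cancel₀ (show √(3 / 2 : ℝ) ≠ 0 by positivity) hy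

/-! ### Assembly -/

variable {V f : ℝ → ℝ} {N φ₀ : ℝ}

theorem exists_orbit (hf : IsAdmissibleCoordinate 2 V N f φ₀) (hV : IsWBI V N) (hN : N ^ 2 < 6) :
    ∃ C, IsOrbit (field V N f φ₀) (phaseSpace f φ₀) C ∧
      (∀ (T : ℝ) (γ : ℝ → ℝ × ℝ), IsPastAsymptotic V N f φ₀ (extPhaseSpace f φ₀) T γ →
        ∀ τ ≤ T, γ τ ∈ insert (pN N) C) ∧
      ((∀ᶠ φ in atTop, deriv V φ ≠ 0) → IsLocallyCenterManifold V N f φ₀ C) := by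
  have D := hf.planarData hV hN
  by_cases hne : ∀ᶠ φ in atTop, deriv V φ ≠ 0
  · obtain ⟨δ₀, h, h', hδ₀, H₀⟩ := D.exists_invGraph
    obtain ⟨δ₁, hδ₁, hw⟩ := hf.exists_ne_zero hne
    have H := H₀.mono (lt_min H₀.pos hδ₁) (min_le_left _ _)
    set δ := min δ₀ δ₁
    have hδ : δ ≤ f φ₀ := (min_le_left _ _).trans hδ₀.le
    have hh : ∀ z ∈ Set.Ioo 0 δ, h z ≠ 0 := fun z hz => H.ne_zero
      (fun z hz => hw z ⟨hz.1, hz.2.trans_le (min_le_right _ _)⟩) hz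
    obtain ⟨U, hU, hCU⟩ := H.locally_eq D hδ hh
    refine ⟨_, ⟨_, H.graph_mem_strip hδ (z := δ / 2) ⟨by linarith [H.pos], by linarith [H.pos]⟩,
      rfl⟩, fun T γ hγ τ hτ => ?_, fun _ => ⟨_, H.isLocalCenterManifold D hδ, U, hU, hCU⟩⟩
    rcases D.strip_or_const hγ.1 hγ.2 with hs | hs
    · right
      obtain ⟨σ, ⟨⟨hσ1, hσ2⟩, hσU⟩, hσ⟩ := (((H.eventually_mem D hδ hγ.1 hγ.2).and
        (hγ.2.eventually hU)).and (eventually_le_atBot T)).exists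
      have hz := (hs σ hσ).1.2.1
      have hmem : γ σ ∈ insert (pN N) {q | Joined (planarField (Wbar V N f φ₀) (fbar f φ₀) N)
          (strip (f φ₀)) (h (δ / 2), δ / 2) q} ∩ U := by
        rw [hCU]; exact ⟨⟨⟨hz.le, hσ1⟩, hσ2⟩, hσU⟩
      refine D.joined_trans (hmem.1.resolve_left fun h0 => ?_)
        ⟨γ, σ, τ, hs.mono le_rfl fun ρ hρ => hρ.2.trans (max_le hσ hτ), rfl, rfl⟩
      rw [h0] at hz
      exact lt_irrefl _ hz
    · exact .inl (hs τ hτ)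
  -- When V' has arbitrarily large zeros only the constant solution p_N is past-asymptotic, so any
  -- orbit will do.
  · have hp : ((0 : ℝ), f φ₀ / 2) ∈ phaseSpace f φ₀ :=
      ⟨by simp, by linarith [D.pos], by linarith [D.pos]⟩
    refine ⟨_, ⟨_, hp, rfl⟩, fun T γ hγ τ hτ => ?_, fun h => absurd h hne⟩
    rcases D.strip_or_const hγ.1 hγ.2 with hs | hs
    · exact (no_pastAsymptotic hf hV hN (by simpa [Filter.Frequently] using hne) ⟨hs, hγ.2⟩).elim
    · exact .inl (hs τ hτ)

theorem eventually_trace_mem (hf : IsAdmissibleCoordinate 2 V N f φ₀) (hV : IsWBI V N)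
    (hN : N ^ 2 < 6) {C : Set (ℝ × ℝ)}
    (hC : ∀ (T : ℝ) (γ : ℝ → ℝ × ℝ), IsPastAsymptotic V N f φ₀ (extPhaseSpace f φ₀) T γ →
      ∀ τ ≤ T, γ τ ∈ insert (pN N) C) {I : Set ℝ} {φ ψ K : ℝ → ℝ}
    (hc : IsCosmology V I φ ψ K) (ho : OriginatesAtPN N I φ ψ K) :
    ∀ᶠ t : I in atBot, (yCoord ψ K t, f (φ t)) ∈ C := by
  have D := hf.planarData hV hN
  obtain ⟨γ, t₀, ht₀, hs, hlim, htr, -⟩ := hc.exists_pastAsymptotic ho hf D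
  filter_upwards [eventually_le_atBot (⟨t₀, ht₀⟩ : I)] with t ht
  obtain ⟨-, τ, hτ, he⟩ := htr t t.2 ht
  have hmem := hC 0 γ ⟨hs.mono (strip_subset _) le_rfl, hlim⟩ τ hτ
  have hz := (hs τ hτ).1.2.1
  rw [← show γ τ = (yCoord ψ K t, f (φ t)) from he]
  refine hmem.resolve_left fun h0 => ?_
  rw [h0] at hz
  exact lt_irrefl _ hz

theorem sameCosmology (hf : IsAdmissibleCoordinate 2 V N f φ₀) (hV : IsWBI V N)
    (hN : N ^ 2 < 6) {I₁ I₂ : Set ℝ} {φ₁ ψ₁ K₁ φ₂ ψ₂ K₂ : ℝ → ℝ}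
    (h₁ : IsCosmology V I₁ φ₁ ψ₁ K₁) (ho₁ : OriginatesAtPN N I₁ φ₁ ψ₁ K₁)
    (h₂ : IsCosmology V I₂ φ₂ ψ₂ K₂) (ho₂ : OriginatesAtPN N I₂ φ₂ ψ₂ K₂) :
    SameCosmology I₁ φ₁ ψ₁ K₁ I₂ φ₂ ψ₂ K₂ := by
  have D := hf.planarData hV hN
  obtain ⟨δ, h, h', hδ, H⟩ := D.exists_invGraph
  obtain ⟨γ₁, s₁, hs₁, sol₁, lim₁, tr₁, tr₁'⟩ := h₁.exists_pastAsymptotic ho₁ hf D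
  obtain ⟨γ₂, s₂, hs₂, sol₂, lim₂, tr₂, tr₂'⟩ := h₂.exists_pastAsymptotic ho₂ hf D
  obtain ⟨z₁, hz₁, cov₁⟩ := H.exists_eq D hδ.le sol₁ lim₁
  obtain ⟨z₂, hz₂, cov₂⟩ := H.exists_eq D hδ.le sol₂ lim₂
  -- Both solutions cover the graph up to min z₁ z₂, so they share the graph point at that height;
  -- its two proper times fix the translation c.
  obtain ⟨τ₁, hτ₁, e₁⟩ := cov₁ (min z₁ z₂) ⟨lt_min hz₁ hz₂, min_le_left _ _⟩
  obtain ⟨τ₂, hτ₂, e₂⟩ := cov₂ (min z₁ z₂) ⟨lt_min hz₁ hz₂, min_le_right _ _⟩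
  obtain ⟨t₁, ht₁, hts₁, f₁⟩ := tr₁' τ₁ hτ₁
  obtain ⟨t₂, ht₂, hts₂, f₂⟩ := tr₂' τ₂ hτ₂
  have he := h₁.eq_of_trace_eq hf h₂ ht₁ ht₂ (tr₁ t₁ ht₁ hts₁).1 (tr₂ t₂ ht₂ hts₂).1
    (by rw [← f₁, ← f₂, e₁, e₂])
  set c := t₂ - t₁
  have hc : t₁ + c = t₂ := by simp [c]
  have h₂' := h₂.shift c
  have ht₂' : t₁ ∈ (· + c) ⁻¹' I₂ := by simpa [hc] using ht₂
  rw [← hc] at he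
  have : Nonempty I₁ := ⟨t₁, ht₁⟩
  have : Nonempty I₂ := ⟨t₂, ht₂⟩
  have l₁ : ∀ B, ∃ s ∈ I₁, ∀ t ∈ I₁, t ≤ s → B < φ₁ t := fun B => by
    obtain ⟨s, hs⟩ := eventually_atBot.1 (ho₁.1.eventually (eventually_gt_atTop B))
    exact ⟨s, s.2, fun t ht hle => hs ⟨t, ht⟩ hle⟩
  have l₂ : ∀ B, ∃ s ∈ (· + c) ⁻¹' I₂, ∀ t ∈ (· + c) ⁻¹' I₂, t ≤ s → B < φ₂ (t + c) := fun B => by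
    obtain ⟨s, hs⟩ := eventually_atBot.1 (ho₂.1.eventually (eventually_gt_atTop B))
    refine ⟨s - c, by simp, fun t ht hle => hs ⟨t + c, ht⟩ ?_⟩
    change t + c ≤ s
    linarith
  refine ⟨c, ⟨t₁, ht₁, fun t hle => ⟨fun ht => ?_, fun ht => ?_⟩⟩, fun t ht ht' => ?_⟩
  · exact h₁.mem_of_mem hV.1 h₂' l₂ ht₁ ht₂' he hle ht
  · exact h₂'.mem_of_mem hV.1 h₁ l₁ ht₂' ht₁ ⟨he.1.symm, he.2.1.symm, he.2.2.symm⟩ hle ht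
  · exact h₁.eq hV.1 h₂' ht₁ ht₂' he ht ht'

end ScalarCosmology

theorem mainTheorem5 (V : ℝ → ℝ) (N : ℝ) (hV : IsClassWBI 2 V N) (hN : N ^ 2 < 6)
    (f : ℝ → ℝ) (φ₀ : ℝ) (hf : IsAdmissibleCoordinate 2 V N f φ₀) :
    -- there is a local center manifold, and each one contains every past-asymptotic solution
    ((∃ M, IsLocalCenterManifold V N f φ₀ M) ∧
      ∀ M, IsLocalCenterManifold V N f φ₀ M → ∀ (T : ℝ) (γ : ℝ → ℝ × ℝ),
        IsPastAsymptotic V N f φ₀ (extPhaseSpace f φ₀) T γ → ∀ᶠ τ in atBot, γ τ ∈ M) ∧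
    -- all past-asymptotic solutions lie on a single orbit `C`, locally a center manifold
    (∃ C, IsOrbit (field V N f φ₀) (phaseSpace f φ₀) C ∧
      (∀ (T : ℝ) (γ : ℝ → ℝ × ℝ), IsPastAsymptotic V N f φ₀ (extPhaseSpace f φ₀) T γ →
        ∀ τ ≤ T, γ τ ∈ insert (pN N) C) ∧
      (∀ (I : Set ℝ) (φ ψ K : ℝ → ℝ), IsCosmology V I φ ψ K → OriginatesAtPN N I φ ψ K →
        ∀ᶠ t : I in atBot, (yCoord ψ K t, f (φ t)) ∈ C) ∧
      ((∀ᶠ φ in atTop, deriv V φ ≠ 0) → IsLocallyCenterManifold V N f φ₀ C)) ∧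
    -- if `V'` has arbitrarily large zeros, no physical solution is past-asymptotic
    ((∃ᶠ φ in atTop, deriv V φ = 0) →
      ¬ ∃ (T : ℝ) (γ : ℝ → ℝ × ℝ), IsPastAsymptotic V N f φ₀ (phaseSpace f φ₀) T γ) ∧
    -- at most one cosmology originates at the equilibrium
    (∀ (I₁ : Set ℝ) (φ₁ ψ₁ K₁ : ℝ → ℝ) (I₂ : Set ℝ) (φ₂ ψ₂ K₂ : ℝ → ℝ),
      IsCosmology V I₁ φ₁ ψ₁ K₁ → OriginatesAtPN N I₁ φ₁ ψ₁ K₁ →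
      IsCosmology V I₂ φ₂ ψ₂ K₂ → OriginatesAtPN N I₂ φ₂ ψ₂ K₂ →
      SameCosmology I₁ φ₁ ψ₁ K₁ I₂ φ₂ ψ₂ K₂) := by
  have hW := hV.1
  have D := hf.planarData hW hN
  refine ⟨⟨?_, fun M hM T γ hγ => ?_⟩, ?_, ?_, fun I₁ φ₁ ψ₁ K₁ I₂ φ₂ ψ₂ K₂ h₁ ho₁ h₂ ho₂ =>
    sameCosmology hf hW hN h₁ ho₁ h₂ ho₂⟩
  · obtain ⟨δ, h, h', hδ, H⟩ := D.exists_invGraph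
    exact ⟨_, H.isLocalCenterManifold D hδ.le⟩
  · obtain ⟨δ, h, h', hδ, H, hsub⟩ := hM.exists_invGraph D
    filter_upwards [H.eventually_mem D hδ hγ.1 hγ.2, eventually_le_atBot T] with τ h1 h2
    exact hsub _ ⟨(hγ.1 τ h2).1.2.1, h1.1⟩ h1.2
  · obtain ⟨C, hC, hpast, hlcm⟩ := exists_orbit hf hW hN
    exact ⟨C, hC, hpast, fun I φ ψ K hc ho => eventually_trace_mem hf hW hN hpast hc ho, hlcm⟩
  · rintro hfreq ⟨T, γ, hγ⟩
    exact no_pastAsymptotic hf hW hN hfreq hγ
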